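/- Let $U\subset\mathbb R$ be an open neighborhood of $0$ and let $c:U\to\mathbb R$ satisfy $c(0)=1$. Let $\varphi\in C_b^2(\mathbb R)$ and $\psi\in C_b^1(\mathbb R)$ (that is, $\varphi$ and $\psi$ are of class $C^2$ and $C^1$ and are bounded together with all their derivatives up to order $2$ and $1$, respectively), suppose that $\varphi_x(x)\to0$ and $\psi(x)\to0$ as $|x|\to\infty$, and suppose that there is a point $x_0\in\mathbb R$ with $$\psi_x(x_0)+\varphi_{xx}(x_0)>0\qquad\text{or}\qquad \psi_x(x_0)-\varphi_{xx}(x_0)>0 .$$ For $\varepsilon>0$ consider the classical ($C^2$) solution $u$ of the Cauchy problem $$u_{tt}-c(u_x)^2u_{xx}=0,\qquad u(0,x)=\varepsilon\varphi(x),\quad u_t(0,x)=\varepsilon\psi(x),\qquad x\in\mathbb R,$$ with $u_x$ taking values in $U$, and let its lifespan $T^*$ be the supremum of all $T>0$ such that a classical solution exists on $[0,T)\times\mathbb R$ and $$\sup_{t\in[0,T)}\Bigl(\|u\|_{L^\infty}+\|u_t\|_{L^\infty}+\|u_x\|_{L^\infty}+\|u_{tt}\|_{L^\infty}+\|u_{tx}\|_{L^\infty}+\|u_{xx}\|_{L^\infty}+\|c(u_x)^{-1}\|_{L^\infty}\Bigr)(t)<\infty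 .$$ (a) Let $p>2$ and put $m=\lceil p-2\rceil$ and $\alpha=p-\lceil p-1\rceil\in(0,1]$. Suppose that $c\in C^{m,\alpha}(U)$ (that is, $c$ is $m$ times continuously differentiable on $U$ and $c^{(m)}$ is Hölder continuous with exponent $\alpha$ on $U$), that $c'(0)=\dots=c^{(m)}(0)=0$, and that there are constants $C_1,C_2>0$ with $|c^{(m)}(\theta)|\le C_1|\theta|^{\alpha}$ and $c'(\theta)\ge C_2|\theta|^{p-2}$ for all $\theta\in U$. Then there exist constants $\varepsilon_0>0$ and $C'>0$, with $C'$ independent of $\varepsilon$, such that for all $0<\varepsilon\le\varepsilon_0$ the solution has a positive lifespan $T^*$ with $$T^*\le C'\varepsilon^{-(p-1)} .$$ (b) Suppose instead that $c\in C^1(U)$ and $c'(0)>0$. Then there exist constants $\varepsilon_0>0$ and $C'>0$, with $C'$ independent of $\varepsilon$, such that for all $0<\varepsilon\le\varepsilon_0$ the solution has a positive lifespan $T^*$ with $$T^*\le C'\varepsilon^{-1} .$$ Moreover, in both cases, for all $0<\varepsilon\le\varepsilon_0$, the solution $u$ exists on $[0,T^*)\times\mathbb R$ and $$\limsup_{t\to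 T^*}\bigl\{\|u_{tx}(t)\|_{L^\infty}+\|u_{xx}(t)\|_{L^\infty}\bigr\}=\infty .$$ -/

import Mathlib

open Set Filter Topology
open scoped ENNReal

namespace QuasilinearWave

/-- `C_b^m(ℝ)`: the functions of class `C^m` that are bounded together with all their derivatives
up to order `m`. -/
def BoundedContDiff (m : ℕ) (f : ℝ → ℝ) : Prop :=
  ContDiff ℝ m f ∧ ∀ k ≤ m, ∃ M : ℝ, ∀ x, |iteratedDeriv k f x| ≤ M

/-- `C^{m,α}(Ω)` for an open set `Ω ⊆ ℝ`: the functions of class `C^m` on `Ω` whose `m`-th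
derivative is Hölder continuous with exponent `α` on `Ω` (used for `0 < α ≤ 1`). -/
def HolderClass (m : ℕ) (α : ℝ) (Ω : Set ℝ) (f : ℝ → ℝ) : Prop :=
  ContDiffOn ℝ m f Ω ∧ ∃ K : ℝ, ∀ x ∈ Ω, ∀ y ∈ Ω,
    |iteratedDeriv m f x - iteratedDeriv m f y| ≤ K * |x - y| ^ α

/-- The degeneracy condition on the wave speed with exponent `p > 2`. With `m = ⌈p - 2⌉ ≥ 1` and
`α = p - ⌈p - 1⌉ ∈ (0, 1]`: `c ∈ C^{m,α}(U)`, `c'(0) = ⋯ = c^{(m)}(0) = 0` and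
`|c^{(m)}(θ)| ≤ C |θ|^α` on `U`. -/
def DegenerateSpeed (p : ℝ) (U : Set ℝ) (c : ℝ → ℝ) : Prop :=
  HolderClass ⌈p - 2⌉₊ (p - (⌈p - 1⌉ : ℤ)) U c ∧
  (∀ k : ℕ, 1 ≤ k → k ≤ ⌈p - 2⌉₊ → iteratedDeriv k c 0 = 0) ∧
  ∃ C > 0, ∀ θ ∈ U, |iteratedDeriv ⌈p - 2⌉₊ c θ| ≤ C * |θ| ^ (p - (⌈p - 1⌉ : ℤ))

/-- Time derivative on `[0, ∞)` (one-sided at `t = 0`) of a function `u t x`. -/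
noncomputable def dt (u : ℝ → ℝ → ℝ) (t x : ℝ) : ℝ :=
  derivWithin (fun s => u s x) (Ici 0) t

/-- Space derivative of a function `u t x`. -/
noncomputable def dx (u : ℝ → ℝ → ℝ) (t x : ℝ) : ℝ :=
  deriv (fun y => u t y) x

/-- `u` is a classical (that is, `C^2`) solution on `[0, T) × ℝ` of `u_tt - c(u_x)^2 u_xx = 0`
with `u(0, ·) = f` and `u_t(0, ·) = g`. The speed `c` is only meaningful on `U`, so `u_x` is
required to take its values in `U`. -/
structure IsClassicalSolution (c : ℝ → ℝ) (U : Set ℝ) (f g : ℝ → ℝ) (T : ℝ)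
    (u : ℝ → ℝ → ℝ) : Prop where
  contDiffOn : ContDiffOn ℝ 2 (fun z : ℝ × ℝ => u z.1 z.2) (Ico 0 T ×ˢ univ)
  dx_mem : ∀ t ∈ Ico 0 T, ∀ x, dx u t x ∈ U
  equation : ∀ t ∈ Ico 0 T, ∀ x, dt (dt u) t x - c (dx u t x) ^ 2 * dx (dx u) t x = 0
  initial : ∀ x, u 0 x = f x
  initial_dt : ∀ x, dt u 0 x = g x

/-- The sup norm with values in `[0, ∞]`; for continuous functions it is the `L^∞` norm. -/
noncomputable def supNorm (f : ℝ → ℝ) : ℝ≥0∞ := ⨆ x, ‖f x‖ₑ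

/-- The sum of the `L^∞` norms at time `t` of `u`, `u_t`, `u_x`, `u_tt`, `u_tx`, `u_xx` and
`c(u_x)⁻¹`. The last inverse is taken in `[0, ∞]`, so that it is `∞` where `c(u_x) = 0`. -/
noncomputable def totalNorm (c : ℝ → ℝ) (u : ℝ → ℝ → ℝ) (t : ℝ) : ℝ≥0∞ :=
  supNorm (u t) + supNorm (dt u t) + supNorm (dx u t) + supNorm (dt (dt u) t)
    + supNorm (dx (dt u) t) + supNorm (dx (dx u) t) + ⨆ x, ‖c (dx u t x)‖ₑ⁻¹

/-- `u` is a classical solution on `[0, T) × ℝ` with `sup_{t ∈ [0, T)} totalNorm < ∞`. -/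
def IsBoundedSolution (c : ℝ → ℝ) (U : Set ℝ) (f g : ℝ → ℝ) (T : ℝ) (u : ℝ → ℝ → ℝ) : Prop :=
  IsClassicalSolution c U f g T u ∧ ⨆ t ∈ Ico 0 T, totalNorm c u t < ∞

/-- `T` is the lifespan of the Cauchy problem with data `f`, `g`: the supremum (in particular,
positive and finite) of all `T' > 0` up to which there is a solution with bounded norms. -/
def IsLifespan (c : ℝ → ℝ) (U : Set ℝ) (f g : ℝ → ℝ) (T : ℝ) : Prop :=
  IsLUB {T' : ℝ | 0 < T' ∧ ∃ u, IsBoundedSolution c U f g T' u} T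

/-- `u` is the solution on `[0, T) × ℝ`, with norms bounded on `[0, T')` for all `T' < T`. -/
def IsSolutionUpTo (c : ℝ → ℝ) (U : Set ℝ) (f g : ℝ → ℝ) (T : ℝ) (u : ℝ → ℝ → ℝ) : Prop :=
  IsClassicalSolution c U f g T u ∧ ∀ T' < T, ⨆ t ∈ Ico 0 T', totalNorm c u t < ∞

/-- `limsup_{t ↑ T} (‖u_tx(t)‖ + ‖u_xx(t)‖) = ∞`. -/
def SecondDerivativesBlowUp (T : ℝ) (u : ℝ → ℝ → ℝ) : Prop :=
  limsup (fun t => supNorm (dx (dt u) t) + supNorm (dx (dx u) t)) (𝓝[<] T) = ∞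

/-- The blowup assertion with rate `ε^{-q}` for the data `(ε φ, ε ψ)`, for all small `ε`: the
lifespan `T` is finite with `T ≤ C' ε^{-q}`, the solution exists on `[0, T)`, and its second
derivatives `u_tx`, `u_xx` become unbounded as `t ↑ T`. -/
def BlowsUpWithRate (c : ℝ → ℝ) (U : Set ℝ) (φ ψ : ℝ → ℝ) (q : ℝ) : Prop :=
  ∃ ε₀ > 0, ∃ C' > 0, ∀ ε : ℝ, 0 < ε → ε ≤ ε₀ →
    ∃ T : ℝ, IsLifespan c U (fun x => ε * φ x) (fun x => ε * ψ x) T ∧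
      T ≤ C' * ε ^ (-q) ∧
      (∃ u, IsSolutionUpTo c U (fun x => ε * φ x) (fun x => ε * ψ x) T u) ∧
      ∀ u, IsSolutionUpTo c U (fun x => ε * φ x) (fun x => ε * ψ x) T u →
        SecondDerivativesBlowUp T u

end QuasilinearWave

/-!
With `L' = c` and `L 0 = 0`, the Riemann invariants `r = u_t + L(u_x)` and `s = u_t - L(u_x)` turn
the equation into the diagonal system `r_t = k r_x`, `s_t = -k s_x`, whose speed `k` is `c(u_x)`
written as a function of `q = (r - s) / 2 = L(u_x)`. Each invariant is constant along its
characteristics, so for small data `u_x` stays small and `c` may be replaced by a globally defined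
speed close to `1`. A solution with bounded gradient can be continued for a further time that
depends only on the bound, hence a finite lifespan forces `u_tx` or `u_xx` to blow up.

To bound the lifespan, choose a point with `r_x > 0` and `r ≠ 0` at time `0`. Along the
characteristic of `r` from that point, `y = √k r_x` solves the Riccati equation
`y' = k'(q) y² / (2 √k)`. Once the characteristic only meets values of `s` coming from the far
field, where the data are negligible, `|q|` is at least a multiple of `ε`, so `k'(q)` is at least
a multiple of `ε ^ (p - 2)`. As `r_x` starts at size `ε`, it blows up before a time of order
`ε ^ (-(p - 1))`. The reflection `x ↦ -x` exchanges the two families of characteristics, and with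
them the two conditions on `x₀`.
-/

namespace QuasilinearWave

section Calculus

variable {E : Type*} [NormedAddCommGroup E] [NormedSpace ℝ E] [CompleteSpace E]

lemma sub_eq_integral_of_tendsto_of_dominated {ι : Type*} {l : Filter ι} [l.NeBot]
    [l.IsCountablyGenerated] {F f : ι → ℝ → E} {F₀ f₀ : ℝ → E} {a b B : ℝ} (hab : a ≤ b)
    (hF : ∀ᶠ i in l, ∀ τ ∈ Icc a b, HasDerivWithinAt (F i) (f i τ) (Icc a b) τ)
    (hf : ∀ᶠ i in l, ContinuousOn (f i) (Icc a b))
    (hB : ∀ᶠ i in l, ∀ τ ∈ Icc a b, ‖f i τ‖ ≤ B)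
    (hFlim : ∀ τ ∈ Icc a b, Tendsto (F · τ) l (𝓝 (F₀ τ)))
    (hflim : ∀ τ ∈ Icc a b, Tendsto (f · τ) l (𝓝 (f₀ τ))) :
    F₀ b - F₀ a = ∫ τ in a..b, f₀ τ := by
  have hIoc : Set.uIoc a b ⊆ Icc a b := uIoc_of_le hab ▸ Ioc_subset_Icc_self
  have hlim : Tendsto (fun i => ∫ τ in a..b, f i τ) l (𝓝 (∫ τ in a..b, f₀ τ)) := by
    refine intervalIntegral.tendsto_integral_filter_of_dominated_convergence (fun _ => B) ?_ ?_
      intervalIntegrable_const (Eventually.of_forall fun τ hτ => hflim τ (hIoc hτ))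
    · exact hf.mono fun i hi => (hi.mono hIoc).aestronglyMeasurable measurableSet_uIoc
    · exact hB.mono fun i hi => Eventually.of_forall fun τ hτ => hi τ (hIoc hτ)
  have hFTC : ∀ᶠ i in l, ∫ τ in a..b, f i τ = F i b - F i a := by
    filter_upwards [hF, hf] with i hFi hfi
    exact intervalIntegral.integral_eq_sub_of_hasDerivAt_of_le hab
      (fun τ hτ => (hFi τ hτ).continuousWithinAt)
      (fun τ hτ => (hFi τ (Ioo_subset_Icc_self hτ)).hasDerivAt (Icc_mem_nhds hτ.1 hτ.2))
      (hfi.intervalIntegrable_of_Icc hab)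
  exact tendsto_nhds_unique
    ((hFlim b (right_mem_Icc.2 hab)).sub (hFlim a (left_mem_Icc.2 hab))) (hlim.congr' hFTC)

lemma hasDerivWithinAt_of_sub_eq_integral {F f : ℝ → E} {a b t : ℝ}
    (hf : ContinuousOn f (Icc a b))
    (hF : ∀ τ ∈ Icc a b, F τ - F a = ∫ σ in a..τ, f σ) (ht : t ∈ Icc a b) :
    HasDerivWithinAt F (f t) (Icc a b) t := by
  have : Fact (t ∈ Icc a b) := ⟨ht⟩
  have hderiv : HasDerivWithinAt (fun τ => ∫ σ in a..τ, f σ) (f t) (Icc a b) t :=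
    intervalIntegral.integral_hasDerivWithinAt_right
      ((hf.mono (Icc_subset_Icc_right ht.2)).intervalIntegrable_of_Icc ht.1)
      (hf.stronglyMeasurableAtFilter_nhdsWithin measurableSet_Icc t) (hf t ht)
  have heq : ∀ τ ∈ Icc a b, F τ = (∫ σ in a..τ, f σ) + F a := fun τ hτ => by
    rw [← hF τ hτ, sub_add_cancel]
  exact (hderiv.add_const (F a)).congr heq (heq t ht)

lemma hasDerivAt_pow_succ_div_factorial (n : ℕ) (x : ℝ) :
    HasDerivAt (fun x : ℝ => x ^ (n + 1) / (n + 1).factorial) (x ^ n / n.factorial) x := by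
  refine ((hasDerivAt_pow (n + 1) x).div_const _).congr_deriv ?_
  rw [Nat.factorial_succ, Nat.cast_mul, Nat.add_sub_cancel,
    mul_div_mul_left _ _ (Nat.cast_ne_zero.2 n.succ_ne_zero)]

lemma mul_sub_lt_inv_of_riccati {y m : ℝ → ℝ} {t₀ t₁ a : ℝ} (ht₀ : 0 ≤ t₀) (ht : t₀ ≤ t₁)
    (hy : ∀ t ∈ Icc 0 t₁, HasDerivWithinAt y (m t * y t ^ 2) (Icc 0 t₁) t)
    (hm : ∀ t ∈ Icc 0 t₁, 0 ≤ m t) (ha : ∀ t ∈ Icc t₀ t₁, a ≤ m t) (hy₀ : 0 < y 0) :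
    a * (t₁ - t₀) < (y 0)⁻¹ := by
  -- `(y⁻¹)' = -m`, so `y⁻¹`, which stays positive, falls at least at rate `a` on `[t₀, t₁]`.
  have h0 : (0 : ℝ) ∈ Icc 0 t₁ := left_mem_Icc.2 (ht₀.trans ht)
  have hsub : Icc t₀ t₁ ⊆ Icc 0 t₁ := Icc_subset_Icc_left ht₀
  have hmono : MonotoneOn y (Icc 0 t₁) :=
    monotoneOn_of_hasDerivWithinAt_nonneg (convex_Icc 0 t₁) (f' := fun t => m t * y t ^ 2)
      (fun t ht => (hy t ht).continuousWithinAt)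
      (fun t ht => (hy t (interior_subset ht)).mono interior_subset)
      (fun t ht => mul_nonneg (hm t (interior_subset ht)) (sq_nonneg _))
  have hpos : ∀ t ∈ Icc 0 t₁, 0 < y t := fun t ht => hy₀.trans_le (hmono h0 ht ht.1)
  have hinv : ∀ t ∈ Icc t₀ t₁,
      HasDerivWithinAt (fun t => (y t)⁻¹ + a * t) (-m t + a) (Icc t₀ t₁) t := fun t ht => by
    have hne := (hpos t (hsub ht)).ne'
    refine ((((hy t (hsub ht)).mono hsub).inv hne).add
      ((hasDerivWithinAt_id t _).const_mul a)).congr_deriv ?_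
    field_simp
  have hanti : AntitoneOn (fun t => (y t)⁻¹ + a * t) (Icc t₀ t₁) :=
    antitoneOn_of_hasDerivWithinAt_nonpos (convex_Icc t₀ t₁) (f' := fun t => -m t + a)
      (fun t ht => (hinv t ht).continuousWithinAt)
      (fun t ht => (hinv t (interior_subset ht)).mono interior_subset)
      (fun t ht => by linarith [ha t (interior_subset ht)])
  have hdecay : (y t₁)⁻¹ + a * t₁ ≤ (y t₀)⁻¹ + a * t₀ :=
    hanti (left_mem_Icc.2 ht) (right_mem_Icc.2 ht) ht
  have hend : 0 < (y t₁)⁻¹ := inv_pos.2 (hpos t₁ (right_mem_Icc.2 (ht₀.trans ht)))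
  have hstart : (y t₀)⁻¹ ≤ (y 0)⁻¹ := inv_anti₀ hy₀ (hmono h0 ⟨ht₀, ht⟩ ht₀)
  linarith

lemma exists_deriv_pos_ne_zero {F F' : ℝ → ℝ} (hF : ∀ x, HasDerivAt F (F' x) x)
    (hF' : Continuous F') {x₀ : ℝ} (h₀ : 0 < F' x₀) : ∃ x, 0 < F' x ∧ F x ≠ 0 := by
  have hne : ∀ᶠ x in 𝓝[≠] x₀, F x ≠ 0 := (hF x₀).eventually_ne h₀.ne'
  have hpos : ∀ᶠ x in 𝓝[≠] x₀, 0 < F' x :=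
    (hF'.continuousAt.eventually_const_lt h₀).filter_mono nhdsWithin_le_nhds
  exact (hpos.and hne).exists

end Calculus

/-! ### Diagonal systems -/

/-- The space-time slab `[0, T) × ℝ`. -/
def slab (T : ℝ) : Set (ℝ × ℝ) := Ico 0 T ×ˢ univ

/-- The linear form `(τ, ξ) ↦ a τ + b ξ`, used for the differential of a function with partial
derivatives `a` in time and `b` in space. -/
noncomputable def form (a b : ℝ) : ℝ × ℝ →L[ℝ] ℝ :=
  a • ContinuousLinearMap.fst ℝ ℝ ℝ + b • ContinuousLinearMap.snd ℝ ℝ ℝ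

/-- Speeds of class `C^1` on the whole line, with derivative bounded by `K`. The wave equation
has speed `1` at rest and only small data occur, so a fixed tolerance around `1` is enough; the
value `1 / 100` leaves room in the contraction argument for local existence. -/
structure IsSpeed (k : ℝ → ℝ) (K : ℝ) : Prop where
  contDiff : ContDiff ℝ 1 k
  near_one : ∀ q, |k q - 1| ≤ 1 / 100
  deriv_le : ∀ q, |deriv k q| ≤ K

/-- The quantity `q = (r - s) / 2` on which the speed of the diagonal system depends. For the
Riemann invariants `r` and `s` of the wave equation it is a function of the strain `u_x` alone. -/
noncomputable def strain (r s : ℝ → ℝ → ℝ) (t x : ℝ) : ℝ := (r t x - s t x) / 2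

/-- The diagonal system `r_t = k(q) r_x`, `s_t = -k(q) s_x` with `q = (r - s) / 2`, for functions
of class `C^1` on `[0, T) × ℝ`. -/
structure IsDiagSolution (k : ℝ → ℝ) (T : ℝ) (r s : ℝ → ℝ → ℝ) : Prop where
  left : ∀ t ∈ Ico 0 T, ∀ x, HasFDerivWithinAt (fun z : ℝ × ℝ => r z.1 z.2)
    (form (k (strain r s t x) * dx r t x) (dx r t x)) (slab T) (t, x)
  right : ∀ t ∈ Ico 0 T, ∀ x, HasFDerivWithinAt (fun z : ℝ × ℝ => s z.1 z.2)
    (form (-(k (strain r s t x) * dx s t x)) (dx s t x)) (slab T) (t, x)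
  continuousOn_dx_left : ContinuousOn (fun z : ℝ × ℝ => dx r z.1 z.2) (slab T)
  continuousOn_dx_right : ContinuousOn (fun z : ℝ × ℝ => dx s z.1 z.2) (slab T)

/-- The space derivatives of `r` and `s` are bounded by `M` on `[0, T) × ℝ`. -/
def GradientBound (T : ℝ) (r s : ℝ → ℝ → ℝ) (M : ℝ) : Prop :=
  ∀ t ∈ Ico 0 T, ∀ x, |dx r t x| ≤ M ∧ |dx s t x| ≤ M

/-- `γ` is, on the time interval `[0, t₁]`, a characteristic of the equation `r_t = k(q) r_x`. It
moves to the left, since the speed `k` is positive. -/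
def IsLeftCharacteristic (k : ℝ → ℝ) (r s : ℝ → ℝ → ℝ) (t₁ : ℝ) (γ : ℝ → ℝ) : Prop :=
  ∀ t ∈ Icc 0 t₁, HasDerivWithinAt γ (-k (strain r s t (γ t))) (Icc 0 t₁) t

@[simp] lemma form_apply (a b : ℝ) (z : ℝ × ℝ) : form a b z = a * z.1 + b * z.2 := by
  simp [form]

lemma mem_slab {T t x : ℝ} : (t, x) ∈ slab T ↔ t ∈ Ico 0 T := by simp [slab]

lemma slab_mono {T T' : ℝ} (h : T ≤ T') : slab T ⊆ slab T' :=
  prod_mono (Ico_subset_Ico_right h) Subset.rfl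

lemma mem_Ico_of_mem_Icc {T t t₁ : ℝ} (ht₁ : t₁ < T) (ht : t ∈ Icc 0 t₁) : t ∈ Ico 0 T :=
  ⟨ht.1, ht.2.trans_lt ht₁⟩

namespace IsSpeed

variable {k : ℝ → ℝ} {K : ℝ}

lemma hasDerivAt (hk : IsSpeed k K) (q : ℝ) : HasDerivAt k (deriv k q) q :=
  (hk.contDiff.differentiable one_ne_zero q).hasDerivAt

lemma continuous (hk : IsSpeed k K) : Continuous k := hk.contDiff.continuous

lemma continuous_deriv (hk : IsSpeed k K) : Continuous (deriv k) :=
  hk.contDiff.continuous_deriv le_rfl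

lemma nonneg (hk : IsSpeed k K) : 0 ≤ K := (abs_nonneg _).trans (hk.deriv_le 0)

lemma lower (hk : IsSpeed k K) (q : ℝ) : 99 / 100 ≤ k q := by
  linarith [(abs_le.1 (hk.near_one q)).1]

lemma upper (hk : IsSpeed k K) (q : ℝ) : k q ≤ 101 / 100 := by
  linarith [(abs_le.1 (hk.near_one q)).2]

lemma pos (hk : IsSpeed k K) (q : ℝ) : 0 < k q := by linarith [hk.lower q]

lemma abs_sub_le (hk : IsSpeed k K) (p q : ℝ) : |k p - k q| ≤ K * |p - q| :=
  convex_univ.norm_image_sub_le_of_norm_hasDerivWithin_le (f' := deriv k) (C := K)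
    (fun x _ => (hk.hasDerivAt x).hasDerivWithinAt) (fun x _ => hk.deriv_le x)
    (mem_univ q) (mem_univ p)

lemma lower_sqrt (hk : IsSpeed k K) (q : ℝ) : 99 / 100 ≤ √(k q) :=
  Real.le_sqrt_of_sq_le (by linarith [hk.lower q])

lemma sqrt_upper (hk : IsSpeed k K) (q : ℝ) : √(k q) ≤ 101 / 100 :=
  Real.sqrt_le_iff.2 ⟨by norm_num, by linarith [hk.upper q]⟩

end IsSpeed

lemma hasDerivAt_of_hasFDerivWithinAt_slab {f : ℝ → ℝ → ℝ} {T t x a b : ℝ} (ht : t ∈ Ico 0 T)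
    (h : HasFDerivWithinAt (fun z : ℝ × ℝ => f z.1 z.2) (form a b) (slab T) (t, x)) :
    HasDerivAt (f t) b x := by
  have hslice : HasDerivWithinAt (fun y : ℝ => (t, y)) ((0 : ℝ), (1 : ℝ)) univ x :=
    ((hasDerivAt_const x t).prodMk (hasDerivAt_id x)).hasDerivWithinAt
  simpa [Function.comp_def] using
    HasFDerivWithinAt.comp_hasDerivWithinAt x h hslice fun _ _ => mem_slab.2 ht

lemma hasDerivWithinAt_along_of_hasFDerivWithinAt_slab {f : ℝ → ℝ → ℝ} {T t t₁ a b v : ℝ}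
    {γ : ℝ → ℝ} (ht₁ : t₁ < T)
    (h : HasFDerivWithinAt (fun z : ℝ × ℝ => f z.1 z.2) (form a b) (slab T) (t, γ t))
    (hγ : HasDerivWithinAt γ v (Icc 0 t₁) t) :
    HasDerivWithinAt (fun t => f t (γ t)) (a + b * v) (Icc 0 t₁) t := by
  have hgraph : HasDerivWithinAt (fun t => (t, γ t)) ((1 : ℝ), v) (Icc 0 t₁) t :=
    (hasDerivWithinAt_id t _).prodMk hγ
  simpa [Function.comp_def] using HasFDerivWithinAt.comp_hasDerivWithinAt t h hgraph
    fun _ hy => mem_slab.2 (mem_Ico_of_mem_Icc ht₁ hy)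

lemma abs_half_sub_le {a b B : ℝ} (ha : |a| ≤ B) (hb : |b| ≤ B) : |(a - b) / 2| ≤ B := by
  rw [abs_div, abs_two]
  linarith [abs_sub a b]

lemma abs_strain_le {r s : ℝ → ℝ → ℝ} {t x N : ℝ} (hr : |r t x| ≤ N) (hs : |s t x| ≤ N) :
    |strain r s t x| ≤ N :=
  abs_half_sub_le hr hs

lemma abs_strain_sub_strain_le {r s r' s' : ℝ → ℝ → ℝ} {t x y B : ℝ}
    (hr : |r t x - r' t y| ≤ B) (hs : |s t x - s' t y| ≤ B) :
    |strain r s t x - strain r' s' t y| ≤ B := by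
  have h := abs_half_sub_le hr hs
  rwa [show (r t x - r' t y - (s t x - s' t y)) / 2 = strain r s t x - strain r' s' t y by
    simp only [strain]; ring] at h

lemma dx_neg_comp_neg (f : ℝ → ℝ → ℝ) (t x : ℝ) :
    dx (fun t x => -f t (-x)) t x = dx f t (-x) := by
  rw [dx, dx, deriv.fun_neg, deriv_comp_neg (f t), neg_neg]

lemma strain_reflect (r s : ℝ → ℝ → ℝ) (t x : ℝ) :
    strain (fun t x => -s t (-x)) (fun t x => -r t (-x)) t x = strain r s t (-x) := by
  simp only [strain]
  ring

namespace GradientBound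

variable {T T' M M' : ℝ} {r s : ℝ → ℝ → ℝ}

lemma mono (hM : GradientBound T r s M) (hT : T' ≤ T) (hMM' : M ≤ M') :
    GradientBound T' r s M' := fun t ht x =>
  (hM t ⟨ht.1, ht.2.trans_le hT⟩ x).imp (·.trans hMM') (·.trans hMM')

lemma reflect (hM : GradientBound T r s M) :
    GradientBound T (fun t x => -s t (-x)) (fun t x => -r t (-x)) M := fun t ht x => by
  simpa only [dx_neg_comp_neg] using (hM t ht (-x)).symm

end GradientBound

namespace IsDiagSolution

variable {k : ℝ → ℝ} {K T M : ℝ} {r s : ℝ → ℝ → ℝ}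

lemma hasDerivAt_left (h : IsDiagSolution k T r s) {t : ℝ} (ht : t ∈ Ico 0 T) (x : ℝ) :
    HasDerivAt (r t) (dx r t x) x :=
  hasDerivAt_of_hasFDerivWithinAt_slab ht (h.left t ht x)

lemma hasDerivAt_right (h : IsDiagSolution k T r s) {t : ℝ} (ht : t ∈ Ico 0 T) (x : ℝ) :
    HasDerivAt (s t) (dx s t x) x :=
  hasDerivAt_of_hasFDerivWithinAt_slab ht (h.right t ht x)

lemma hasDerivAt_strain (h : IsDiagSolution k T r s) {t : ℝ} (ht : t ∈ Ico 0 T) (x : ℝ) :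
    HasDerivAt (strain r s t) ((dx r t x - dx s t x) / 2) x :=
  ((h.hasDerivAt_left ht x).sub (h.hasDerivAt_right ht x)).div_const 2

lemma continuousOn_left (h : IsDiagSolution k T r s) :
    ContinuousOn (fun z : ℝ × ℝ => r z.1 z.2) (slab T) :=
  fun z hz => (h.left z.1 hz.1 z.2).continuousWithinAt

lemma continuousOn_right (h : IsDiagSolution k T r s) :
    ContinuousOn (fun z : ℝ × ℝ => s z.1 z.2) (slab T) :=
  fun z hz => (h.right z.1 hz.1 z.2).continuousWithinAt

lemma continuousOn_strain (h : IsDiagSolution k T r s) :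
    ContinuousOn (fun z : ℝ × ℝ => strain r s z.1 z.2) (slab T) :=
  (h.continuousOn_left.sub h.continuousOn_right).div_const 2

lemma continuousOn_speed (h : IsDiagSolution k T r s) (hk : IsSpeed k K) :
    ContinuousOn (fun z : ℝ × ℝ => k (strain r s z.1 z.2)) (slab T) :=
  hk.continuous.comp_continuousOn h.continuousOn_strain

lemma mono (h : IsDiagSolution k T r s) {T' : ℝ} (hT : T' ≤ T) : IsDiagSolution k T' r s where
  left t ht x := (h.left t ⟨ht.1, ht.2.trans_le hT⟩ x).mono (slab_mono hT)
  right t ht x := (h.right t ⟨ht.1, ht.2.trans_le hT⟩ x).mono (slab_mono hT)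
  continuousOn_dx_left := h.continuousOn_dx_left.mono (slab_mono hT)
  continuousOn_dx_right := h.continuousOn_dx_right.mono (slab_mono hT)

lemma abs_speed_sub_le (h : IsDiagSolution k T r s) (hk : IsSpeed k K)
    (hM : GradientBound T r s M) {t : ℝ} (ht : t ∈ Ico 0 T) (x y : ℝ) :
    |k (strain r s t x) - k (strain r s t y)| ≤ K * M * |x - y| := by
  have hstrain : |strain r s t x - strain r s t y| ≤ M * |x - y| :=
    convex_univ.norm_image_sub_le_of_norm_hasDerivWithin_le
      (fun x _ => (h.hasDerivAt_strain ht x).hasDerivWithinAt)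
      (fun x _ => abs_half_sub_le (hM t ht x).1 (hM t ht x).2) (mem_univ y) (mem_univ x)
  calc |k (strain r s t x) - k (strain r s t y)|
      ≤ K * |strain r s t x - strain r s t y| := hk.abs_sub_le _ _
    _ ≤ K * (M * |x - y|) := mul_le_mul_of_nonneg_left hstrain hk.nonneg
    _ = K * M * |x - y| := (mul_assoc _ _ _).symm

lemma reflect (h : IsDiagSolution k T r s) :
    IsDiagSolution k T (fun t x => -s t (-x)) (fun t x => -r t (-x)) := by
  have hmaps : MapsTo (fun z : ℝ × ℝ => (z.1, -z.2)) (slab T) (slab T) :=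
    fun _ hz => ⟨hz.1, mem_univ _⟩
  have hderiv : ∀ z : ℝ × ℝ, HasFDerivWithinAt (fun z : ℝ × ℝ => (z.1, -z.2))
      ((ContinuousLinearMap.fst ℝ ℝ ℝ).prod (-ContinuousLinearMap.snd ℝ ℝ ℝ)) (slab T) z :=
    fun z => hasFDerivWithinAt_fst.prodMk hasFDerivWithinAt_snd.neg
  refine ⟨fun t ht x => ?_, fun t ht x => ?_, ?_, ?_⟩
  · rw [dx_neg_comp_neg, strain_reflect]
    refine HasFDerivWithinAt.congr_fderiv
      ((h.right t ht (-x)).comp (t, x) (hderiv (t, x)) hmaps).neg ?_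
    ext <;> simp
  · rw [dx_neg_comp_neg, strain_reflect]
    refine HasFDerivWithinAt.congr_fderiv
      ((h.left t ht (-x)).comp (t, x) (hderiv (t, x)) hmaps).neg ?_
    ext <;> simp
  · simp only [dx_neg_comp_neg]
    exact h.continuousOn_dx_right.comp (f := fun z : ℝ × ℝ => (z.1, -z.2)) (by fun_prop) hmaps
  · simp only [dx_neg_comp_neg]
    exact h.continuousOn_dx_left.comp (f := fun z : ℝ × ℝ => (z.1, -z.2)) (by fun_prop) hmaps

/-! ### Characteristics -/

lemma exists_isLeftCharacteristic (h : IsDiagSolution k T r s) (hk : IsSpeed k K)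
    (hM : GradientBound T r s M) {t₀ t₁ : ℝ} (ht₁ : t₁ < T) (ht₀ : t₀ ∈ Icc 0 t₁) (x : ℝ) :
    ∃ γ : ℝ → ℝ, γ t₀ = x ∧ IsLeftCharacteristic k r s t₁ γ := by
  have ht₁0 : 0 ≤ t₁ := ht₀.1.trans ht₀.2
  have hmem : ∀ t ∈ Icc 0 t₁, t ∈ Ico 0 T := fun t => mem_Ico_of_mem_Icc ht₁
  have hM0 : 0 ≤ M := (abs_nonneg _).trans (hM t₀ (hmem t₀ ht₀) 0).1
  have hPicard : IsPicardLindelof (fun t x => -k (strain r s t x)) (⟨t₀, ht₀⟩ : Icc 0 t₁) x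
      (2 * ⟨t₁, ht₁0⟩) 0 2 ⟨K * M, mul_nonneg hk.nonneg hM0⟩ := by
    refine ⟨fun t ht => ?_, fun y _ => ?_, fun _ _ _ _ => ?_, ?_⟩
    · refine LipschitzOnWith.of_dist_le_mul fun y _ z _ => ?_
      rw [Real.dist_eq, Real.dist_eq, neg_sub_neg, abs_sub_comm]
      exact h.abs_speed_sub_le hk hM (hmem t ht) y z
    · exact ((h.continuousOn_speed hk).comp (f := fun t => (t, y)) (by fun_prop)
        (fun t ht => mem_slab.2 (hmem t ht))).neg
    · rw [norm_neg, Real.norm_eq_abs, abs_of_pos (hk.pos _)]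
      exact (hk.upper _).trans (by norm_num)
    · have : max (t₁ - t₀) (t₀ - 0) ≤ t₁ := max_le (by linarith [ht₀.1]) (by linarith [ht₀.2])
      change 2 * max (t₁ - t₀) (t₀ - 0) ≤ 2 * t₁ - 0
      linarith
  exact hPicard.exists_eq_forall_mem_Icc_hasDerivWithinAt₀

end IsDiagSolution

namespace IsLeftCharacteristic

variable {k : ℝ → ℝ} {K T M t₁ : ℝ} {r s : ℝ → ℝ → ℝ} {γ : ℝ → ℝ}

lemma continuousOn (hγ : IsLeftCharacteristic k r s t₁ γ) : ContinuousOn γ (Icc 0 t₁) :=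
  fun t ht => (hγ t ht).continuousWithinAt

lemma mono (hγ : IsLeftCharacteristic k r s t₁ γ) {t : ℝ} (ht : t ≤ t₁) :
    IsLeftCharacteristic k r s t γ :=
  fun τ hτ => (hγ τ ⟨hτ.1, hτ.2.trans ht⟩).mono (Icc_subset_Icc_right ht)

lemma apply_add_le (hγ : IsLeftCharacteristic k r s t₁ γ) (hk : IsSpeed k K) {t : ℝ}
    (ht : t ∈ Icc 0 t₁) : γ t + 99 / 100 * t ≤ γ 0 := by
  have hanti : AntitoneOn (fun τ => γ τ + 99 / 100 * τ) (Icc 0 t₁) :=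
    antitoneOn_of_hasDerivWithinAt_nonpos (convex_Icc 0 t₁)
      (f' := fun τ => -k (strain r s τ (γ τ)) + 99 / 100 * 1)
      (hγ.continuousOn.add (by fun_prop))
      (fun τ hτ => ((hγ τ (interior_subset hτ)).mono interior_subset).add
        ((hasDerivWithinAt_id τ _).const_mul _))
      (fun τ _ => by linarith [hk.lower (strain r s τ (γ τ))])
  simpa using hanti (left_mem_Icc.2 (ht.1.trans ht.2)) ht ht.1

lemma mapsTo_slab (ht₁ : t₁ < T) : MapsTo (fun t => (t, γ t)) (Icc 0 t₁) (slab T) :=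
  fun _ ht => mem_slab.2 (mem_Ico_of_mem_Icc ht₁ ht)

lemma left_eq (hγ : IsLeftCharacteristic k r s t₁ γ) (h : IsDiagSolution k T r s)
    (ht₁ : t₁ < T) {t : ℝ} (ht : t ∈ Icc 0 t₁) : r t (γ t) = r 0 (γ 0) := by
  have hderiv : ∀ t ∈ Icc 0 t₁, HasDerivWithinAt (fun t => r t (γ t)) 0 (Icc 0 t₁) t :=
    fun t ht => (hasDerivWithinAt_along_of_hasFDerivWithinAt_slab ht₁
      (h.left t (mem_Ico_of_mem_Icc ht₁ ht) (γ t)) (hγ t ht)).congr_deriv (by ring)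
  refine constant_of_derivWithin_zero (fun t ht => (hderiv t ht).differentiableWithinAt)
    (fun τ hτ => ?_) t ht
  exact (hderiv τ (Ico_subset_Icc_self hτ)).derivWithin
    (uniqueDiffOn_Icc (hτ.1.trans_lt hτ.2) τ (Ico_subset_Icc_self hτ))

end IsLeftCharacteristic

namespace IsDiagSolution

variable {k : ℝ → ℝ} {K T M : ℝ} {r s : ℝ → ℝ → ℝ}

lemma exists_left_eq_initial (h : IsDiagSolution k T r s) (hk : IsSpeed k K)
    (hM : GradientBound T r s M) {t : ℝ} (ht : t ∈ Ico 0 T) (x : ℝ) :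
    ∃ y, x + 99 / 100 * t ≤ y ∧ r t x = r 0 y := by
  obtain ⟨γ, rfl, hγ⟩ :=
    h.exists_isLeftCharacteristic hk hM ht.2 (right_mem_Icc.2 ht.1) x
  exact ⟨γ 0, hγ.apply_add_le hk (right_mem_Icc.2 ht.1), hγ.left_eq h ht.2 (right_mem_Icc.2 ht.1)⟩

lemma exists_right_eq_initial (h : IsDiagSolution k T r s) (hk : IsSpeed k K)
    (hM : GradientBound T r s M) {t : ℝ} (ht : t ∈ Ico 0 T) (x : ℝ) :
    ∃ y, y ≤ x - 99 / 100 * t ∧ s t x = s 0 y := by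
  obtain ⟨y, hy, heq⟩ := h.reflect.exists_left_eq_initial hk hM.reflect ht (-x)
  exact ⟨-y, by linarith, by simpa using heq⟩

lemma abs_left_le (h : IsDiagSolution k T r s) (hk : IsSpeed k K) (hM : GradientBound T r s M)
    {N : ℝ} (hN : ∀ x, |r 0 x| ≤ N) {t : ℝ} (ht : t ∈ Ico 0 T) (x : ℝ) : |r t x| ≤ N := by
  obtain ⟨y, -, heq⟩ := h.exists_left_eq_initial hk hM ht x
  exact heq ▸ hN y

lemma abs_right_le (h : IsDiagSolution k T r s) (hk : IsSpeed k K) (hM : GradientBound T r s M)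
    {N : ℝ} (hN : ∀ x, |s 0 x| ≤ N) {t : ℝ} (ht : t ∈ Ico 0 T) (x : ℝ) : |s t x| ≤ N := by
  obtain ⟨y, -, heq⟩ := h.exists_right_eq_initial hk hM ht x
  exact heq ▸ hN y

end IsDiagSolution

/-! ### Uniqueness -/

namespace IsDiagSolution

variable {k : ℝ → ℝ} {K T M : ℝ} {r s r' s' : ℝ → ℝ → ℝ}

lemma abs_speed_sub_mul_dx_le (hk : IsSpeed k K) (hM' : GradientBound T r' s' M) {t x B : ℝ}
    (ht : t ∈ Ico 0 T) (hr : |r t x - r' t x| ≤ B) (hs : |s t x - s' t x| ≤ B) :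
    |(k (strain r s t x) - k (strain r' s' t x)) * dx r' t x| ≤ K * M * B := by
  have hB : 0 ≤ B := (abs_nonneg _).trans hr
  have hspeed : |k (strain r s t x) - k (strain r' s' t x)| ≤ K * B :=
    (hk.abs_sub_le _ _).trans
      (mul_le_mul_of_nonneg_left (abs_strain_sub_strain_le hr hs) hk.nonneg)
  rw [abs_mul, mul_right_comm]
  exact mul_le_mul hspeed (hM' t ht x).1 (abs_nonneg _) (mul_nonneg hk.nonneg hB)

lemma abs_left_sub_le_succ (h : IsDiagSolution k T r s) (h' : IsDiagSolution k T r' s')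
    (hk : IsSpeed k K) (hM : GradientBound T r s M) (hM' : GradientBound T r' s' M)
    (hr₀ : r 0 = r' 0) {N : ℝ} {n : ℕ}
    (hr : ∀ t ∈ Ico 0 T, ∀ x, |r t x - r' t x| ≤ N * ((K * M * t) ^ n / n.factorial))
    (hs : ∀ t ∈ Ico 0 T, ∀ x, |s t x - s' t x| ≤ N * ((K * M * t) ^ n / n.factorial))
    {t : ℝ} (ht : t ∈ Ico 0 T) (x : ℝ) :
    |r t x - r' t x| ≤ N * ((K * M * t) ^ (n + 1) / (n + 1).factorial) := by
  obtain ⟨γ, rfl, hγ⟩ := h.exists_isLeftCharacteristic hk hM ht.2 (right_mem_Icc.2 ht.1) x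
  have hmem : ∀ τ ∈ Icc 0 t, τ ∈ Ico 0 T := fun τ => mem_Ico_of_mem_Icc ht.2
  have hderiv : ∀ τ ∈ Icc 0 t, HasDerivWithinAt (fun τ => r τ (γ τ) - r' τ (γ τ))
      ((k (strain r s τ (γ τ)) - k (strain r' s' τ (γ τ))) * dx r' τ (γ τ)) (Icc 0 t) τ :=
    fun τ hτ => ((hasDerivWithinAt_along_of_hasFDerivWithinAt_slab ht.2
      (h.left τ (hmem τ hτ) (γ τ)) (hγ τ hτ)).sub
      (hasDerivWithinAt_along_of_hasFDerivWithinAt_slab ht.2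
        (h'.left τ (hmem τ hτ) (γ τ)) (hγ τ hτ))).congr_deriv (by ring)
  have hbound : ∀ τ, HasDerivAt (fun τ => N * ((K * M * τ) ^ (n + 1) / (n + 1).factorial))
      (K * M * (N * ((K * M * τ) ^ n / n.factorial))) τ := fun τ =>
    (((hasDerivAt_pow_succ_div_factorial n (K * M * τ)).comp τ
      ((hasDerivAt_id τ).const_mul (K * M))).const_mul N).congr_deriv (by ring)
  refine image_norm_le_of_norm_deriv_right_le_deriv_boundary
    (fun τ hτ => (hderiv τ hτ).continuousWithinAt)
    (fun τ hτ => (hderiv τ (Ico_subset_Icc_self hτ)).mono_of_mem_nhdsWithin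
      (Icc_mem_nhdsGE_of_mem hτ)) (by simp [hr₀]) hbound (fun τ hτ => ?_) (right_mem_Icc.2 ht.1)
  have hτ := hmem τ (Ico_subset_Icc_self hτ)
  exact abs_speed_sub_mul_dx_le hk hM' hτ (hr τ hτ (γ τ)) (hs τ hτ (γ τ))

/-- Picard iteration: the factorial gained at each step replaces a Gronwall argument, which would
have to be applied to a supremum over `x`. -/
lemma abs_sub_le_pow_div_factorial (h : IsDiagSolution k T r s) (h' : IsDiagSolution k T r' s')
    (hk : IsSpeed k K) (hM : GradientBound T r s M) (hM' : GradientBound T r' s' M)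
    (hr₀ : r 0 = r' 0) (hs₀ : s 0 = s' 0)
    {N : ℝ} (hrN : ∀ x, |r 0 x| ≤ N) (hsN : ∀ x, |s 0 x| ≤ N) (n : ℕ) :
    ∀ t ∈ Ico 0 T, ∀ x, |r t x - r' t x| ≤ 2 * N * ((K * M * t) ^ n / n.factorial) ∧
      |s t x - s' t x| ≤ 2 * N * ((K * M * t) ^ n / n.factorial) := by
  induction n with
  | zero =>
    intro t ht x
    have hr := h.abs_left_le hk hM hrN ht x
    have hr' := h'.abs_left_le hk hM' (hr₀ ▸ hrN) ht x
    have hs := h.abs_right_le hk hM hsN ht x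
    have hs' := h'.abs_right_le hk hM' (hs₀ ▸ hsN) ht x
    simp only [pow_zero, Nat.factorial_zero, Nat.cast_one, div_one, mul_one]
    exact ⟨(abs_sub _ _).trans (by linarith), (abs_sub _ _).trans (by linarith)⟩
  | succ n ih =>
    intro t ht x
    refine ⟨h.abs_left_sub_le_succ h' hk hM hM' hr₀ (fun t ht x => (ih t ht x).1)
      (fun t ht x => (ih t ht x).2) ht x, ?_⟩
    have hreflect := h.reflect.abs_left_sub_le_succ h'.reflect hk hM.reflect hM'.reflect
      (by simp only [hs₀]) (N := 2 * N) (n := n)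
      (fun t ht x => by simpa only [neg_sub_neg, abs_sub_comm] using (ih t ht (-x)).2)
      (fun t ht x => by simpa only [neg_sub_neg, abs_sub_comm] using (ih t ht (-x)).1) ht (-x)
    simpa only [neg_neg, neg_sub_neg, abs_sub_comm] using hreflect

lemma eq_of_initial_eq (h : IsDiagSolution k T r s) (h' : IsDiagSolution k T r' s')
    (hk : IsSpeed k K) (hM : ∃ M, GradientBound T r s M) (hM' : ∃ M, GradientBound T r' s' M)
    (hr₀ : r 0 = r' 0) (hs₀ : s 0 = s' 0)
    {N : ℝ} (hrN : ∀ x, |r 0 x| ≤ N) (hsN : ∀ x, |s 0 x| ≤ N)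
    {t : ℝ} (ht : t ∈ Ico 0 T) : r t = r' t ∧ s t = s' t := by
  obtain ⟨M₁, hM₁⟩ := hM
  obtain ⟨M₂, hM₂⟩ := hM'
  have hle := h.abs_sub_le_pow_div_factorial h' hk (hM₁.mono le_rfl (le_max_left M₁ M₂))
    (hM₂.mono le_rfl (le_max_right M₁ M₂)) hr₀ hs₀ hrN hsN
  have hlim : Tendsto (fun n : ℕ => 2 * N * ((K * max M₁ M₂ * t) ^ n / n.factorial)) atTop
      (𝓝 0) := by
    simpa using (FloorSemiring.tendsto_pow_div_factorial_atTop (K * max M₁ M₂ * t)).const_mul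
      (2 * N)
  have hzero : ∀ d : ℝ, (∀ n : ℕ, |d| ≤ 2 * N * ((K * max M₁ M₂ * t) ^ n / n.factorial)) →
      d = 0 := fun d hd => abs_nonpos_iff.1 (ge_of_tendsto' hlim hd)
  exact ⟨funext fun x => sub_eq_zero.1 (hzero _ fun n => (hle n t ht x).1),
    funext fun x => sub_eq_zero.1 (hzero _ fun n => (hle n t ht x).2)⟩

end IsDiagSolution

/-! ### The gradient along characteristics -/

namespace IsLeftCharacteristic

variable {k : ℝ → ℝ} {K T M t₁ : ℝ} {r s : ℝ → ℝ → ℝ} {γ : ℝ → ℝ}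

lemma hasDerivWithinAt_quotient (hγ : IsLeftCharacteristic k r s t₁ γ)
    (h : IsDiagSolution k T r s) (ht₁ : t₁ < T) (η : ℝ) {t : ℝ} (ht : t ∈ Icc 0 t₁) :
    HasDerivWithinAt (fun t => η⁻¹ * (r t (γ t + η) - r t (γ t)))
      (η⁻¹ * (k (strain r s t (γ t + η)) - k (strain r s t (γ t))) * dx r t (γ t + η))
      (Icc 0 t₁) t := by
  have ht' : t ∈ Ico 0 T := mem_Ico_of_mem_Icc ht₁ ht
  have hshift := hasDerivWithinAt_along_of_hasFDerivWithinAt_slab (γ := fun t => γ t + η) ht₁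
    (h.left t ht' (γ t + η)) ((hγ t ht).add_const η)
  have hbase := hasDerivWithinAt_along_of_hasFDerivWithinAt_slab ht₁ (h.left t ht' (γ t)) (hγ t ht)
  exact ((hshift.sub hbase).const_mul η⁻¹).congr_deriv (by ring)

lemma continuousOn_quotient_deriv (hγ : IsLeftCharacteristic k r s t₁ γ)
    (h : IsDiagSolution k T r s) (hk : IsSpeed k K) (ht₁ : t₁ < T) (η : ℝ) :
    ContinuousOn (fun t => η⁻¹ * (k (strain r s t (γ t + η)) - k (strain r s t (γ t))) *
      dx r t (γ t + η)) (Icc 0 t₁) := by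
  have hgraph : ContinuousOn (fun t => (t, γ t)) (Icc 0 t₁) :=
    continuousOn_id.prodMk hγ.continuousOn
  have hgraph_add : ContinuousOn (fun t => (t, γ t + η)) (Icc 0 t₁) :=
    continuousOn_id.prodMk (hγ.continuousOn.add continuousOn_const)
  exact (continuousOn_const.mul
    (((h.continuousOn_speed hk).comp hgraph_add (mapsTo_slab (γ := (γ · + η)) ht₁)).sub
      ((h.continuousOn_speed hk).comp hgraph (mapsTo_slab ht₁)))).mul
    (h.continuousOn_dx_left.comp hgraph_add (mapsTo_slab (γ := (γ · + η)) ht₁))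

/-- Since `r_x` need not be differentiable, the equation obtained by differentiating
`r_t = k(q) r_x` in `x` is derived in integrated form, from difference quotients. -/
lemma dx_left_sub_eq_integral (hγ : IsLeftCharacteristic k r s t₁ γ)
    (h : IsDiagSolution k T r s) (hk : IsSpeed k K) (hM : GradientBound T r s M) (ht₁ : t₁ < T)
    (ht₁0 : 0 ≤ t₁) :
    dx r t₁ (γ t₁) - dx r 0 (γ 0) = ∫ t in 0..t₁,
      deriv k (strain r s t (γ t)) * ((dx r t (γ t) - dx s t (γ t)) / 2) * dx r t (γ t) := by
  have hmem : ∀ t ∈ Icc 0 t₁, t ∈ Ico 0 T := fun t => mem_Ico_of_mem_Icc ht₁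
  refine sub_eq_integral_of_tendsto_of_dominated (l := 𝓝[≠] 0) (B := K * M * M) ht₁0
    (F₀ := fun t => dx r t (γ t))
    (Eventually.of_forall fun η t ht => hγ.hasDerivWithinAt_quotient h ht₁ η ht)
    (Eventually.of_forall fun η => hγ.continuousOn_quotient_deriv h hk ht₁ η)
    ?_ (fun t ht => ?_) (fun t ht => ?_)
  · filter_upwards [self_mem_nhdsWithin] with η hη t ht
    have hspeed := h.abs_speed_sub_le hk hM (hmem t ht) (γ t + η) (γ t)
    rw [add_sub_cancel_left, ← div_le_iff₀ (abs_pos.2 hη), ← abs_div, div_eq_inv_mul] at hspeed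
    rw [Real.norm_eq_abs, abs_mul]
    exact mul_le_mul hspeed (hM t (hmem t ht) _).1 (abs_nonneg _) ((abs_nonneg _).trans hspeed)
  · exact (h.hasDerivAt_left (hmem t ht) (γ t)).tendsto_slope_zero
  · have hspeed : HasDerivAt (fun x => k (strain r s t x)) _ (γ t) :=
      (hk.hasDerivAt _).comp (γ t) (h.hasDerivAt_strain (hmem t ht) (γ t))
    have hdx : Tendsto (fun η => dx r t (γ t + η)) (𝓝[≠] 0) (𝓝 (dx r t (γ t))) := by
      have hcont : Continuous (dx r t) := continuousOn_univ.1 <|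
        h.continuousOn_dx_left.comp (f := fun x => (t, x)) (by fun_prop)
          fun _ _ => mem_slab.2 (hmem t ht)
      exact ((hcont.comp (continuous_const_add (γ t))).tendsto' 0 _ (by simp)).mono_left
        nhdsWithin_le_nhds
    exact hspeed.tendsto_slope_zero.mul hdx

lemma hasDerivWithinAt_dx_left (hγ : IsLeftCharacteristic k r s t₁ γ)
    (h : IsDiagSolution k T r s) (hk : IsSpeed k K) (hM : GradientBound T r s M) (ht₁ : t₁ < T)
    {t : ℝ} (ht : t ∈ Icc 0 t₁) :
    HasDerivWithinAt (fun t => dx r t (γ t))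
      (deriv k (strain r s t (γ t)) * ((dx r t (γ t) - dx s t (γ t)) / 2) * dx r t (γ t))
      (Icc 0 t₁) t := by
  have hgraph : ContinuousOn (fun t => (t, γ t)) (Icc 0 t₁) :=
    continuousOn_id.prodMk hγ.continuousOn
  have hcont : ContinuousOn (fun t => deriv k (strain r s t (γ t)) *
      ((dx r t (γ t) - dx s t (γ t)) / 2) * dx r t (γ t)) (Icc 0 t₁) :=
    ((hk.continuous_deriv.comp_continuousOn
      (h.continuousOn_strain.comp hgraph (mapsTo_slab ht₁))).mul
      (((h.continuousOn_dx_left.comp hgraph (mapsTo_slab ht₁)).sub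
        (h.continuousOn_dx_right.comp hgraph (mapsTo_slab ht₁))).div_const 2)).mul
      (h.continuousOn_dx_left.comp hgraph (mapsTo_slab ht₁))
  exact hasDerivWithinAt_of_sub_eq_integral (F := fun t => dx r t (γ t)) hcont
    (fun τ hτ => (hγ.mono hτ.2).dx_left_sub_eq_integral h hk hM (hτ.2.trans_lt ht₁) hτ.1) ht

/-- Weighting `r_x` by `√k` cancels the term in `r_x s_x` and leaves a Riccati equation. -/
lemma hasDerivWithinAt_sqrt_mul_dx_left (hγ : IsLeftCharacteristic k r s t₁ γ)
    (h : IsDiagSolution k T r s) (hk : IsSpeed k K) (hM : GradientBound T r s M) (ht₁ : t₁ < T)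
    {t : ℝ} (ht : t ∈ Icc 0 t₁) :
    HasDerivWithinAt (fun t => √(k (strain r s t (γ t))) * dx r t (γ t))
      (deriv k (strain r s t (γ t)) / (2 * √(k (strain r s t (γ t)))) *
        (√(k (strain r s t (γ t))) * dx r t (γ t)) ^ 2) (Icc 0 t₁) t := by
  have ht' : t ∈ Ico 0 T := mem_Ico_of_mem_Icc ht₁ ht
  have hstrain : HasDerivWithinAt (fun t => strain r s t (γ t)) _ (Icc 0 t₁) t :=
    ((hasDerivWithinAt_along_of_hasFDerivWithinAt_slab ht₁ (h.left t ht' (γ t)) (hγ t ht)).sub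
      (hasDerivWithinAt_along_of_hasFDerivWithinAt_slab ht₁ (h.right t ht' (γ t))
        (hγ t ht))).div_const 2
  have hpos : 0 < k (strain r s t (γ t)) := hk.pos _
  have hsqrt : HasDerivWithinAt (fun t => √(k (strain r s t (γ t)))) _ (Icc 0 t₁) t :=
    ((hk.hasDerivAt _).comp_hasDerivWithinAt t hstrain).sqrt hpos.ne'
  refine (hsqrt.mul (hγ.hasDerivWithinAt_dx_left h hk hM ht₁ ht)).congr_deriv ?_
  have hsq : √(k (strain r s t (γ t))) ^ 2 = k (strain r s t (γ t)) := Real.sq_sqrt hpos.le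
  have hne : √(k (strain r s t (γ t))) ≠ 0 := (Real.sqrt_pos.2 hpos).ne'
  simp only [Function.comp_apply]
  field_simp
  rw [hsq]
  ring

end IsLeftCharacteristic

lemma IsDiagSolution.le_of_le_deriv_speed {k : ℝ → ℝ} {K T M : ℝ} {r s : ℝ → ℝ → ℝ}
    (h : IsDiagSolution k T r s) (hk : IsSpeed k K) (hM : GradientBound T r s M)
    (hk₀ : ∀ t ∈ Ico 0 T, ∀ x, 0 ≤ deriv k (strain r s t x)) {x₁ a t₀ : ℝ}
    (hx₁ : 0 < dx r 0 x₁) (ha : 0 < a) (ht₀ : 0 ≤ t₀)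
    (hka : ∀ t ∈ Ico t₀ T, ∀ x ≤ x₁ - 99 / 100 * t, r t x = r 0 x₁ →
      a ≤ deriv k (strain r s t x)) :
    T ≤ t₀ + 4 / (a * dx r 0 x₁) := by
  by_contra! hT
  set t₁ := t₀ + 4 / (a * dx r 0 x₁) with ht₁
  have ht₀₁ : t₀ ≤ t₁ := le_add_of_nonneg_right (by positivity)
  have ht₁0 : 0 ≤ t₁ := ht₀.trans ht₀₁
  obtain ⟨γ, rfl, hγ⟩ := h.exists_isLeftCharacteristic hk hM hT (left_mem_Icc.2 ht₁0) x₁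
  have hcoef : ∀ t ∈ Icc t₀ t₁,
      a / 3 ≤ deriv k (strain r s t (γ t)) / (2 * √(k (strain r s t (γ t)))) := fun t ht => by
    have ht' : t ∈ Icc 0 t₁ := ⟨ht₀.trans ht.1, ht.2⟩
    have hka := hka t ⟨ht.1, ht.2.trans_lt hT⟩ (γ t)
      (by linarith [hγ.apply_add_le hk ht']) (hγ.left_eq h hT ht')
    have hlower := hk.lower_sqrt (strain r s t (γ t))
    rw [div_le_div_iff₀ three_pos (by linarith)]
    nlinarith [hk.sqrt_upper (strain r s t (γ t))]
  have hy₀ : 99 / 100 * dx r 0 (γ 0) ≤ √(k (strain r s 0 (γ 0))) * dx r 0 (γ 0) :=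
    mul_le_mul_of_nonneg_right (hk.lower_sqrt _) hx₁.le
  have hriccati : a / 3 * (t₁ - t₀) < (√(k (strain r s 0 (γ 0))) * dx r 0 (γ 0))⁻¹ :=
    mul_sub_lt_inv_of_riccati ht₀ ht₀₁
      (fun t ht => hγ.hasDerivWithinAt_sqrt_mul_dx_left h hk hM hT ht)
      (fun t ht => div_nonneg (hk₀ t (mem_Ico_of_mem_Icc hT ht) _) (by positivity)) hcoef
      (by positivity [hk.pos (strain r s 0 (γ 0))])
  have hinv : (√(k (strain r s 0 (γ 0))) * dx r 0 (γ 0))⁻¹ ≤ 100 / 99 * (dx r 0 (γ 0))⁻¹ :=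
    (inv_anti₀ (by positivity) hy₀).trans_eq (by rw [mul_inv]; norm_num)
  have htime : a / 3 * (t₁ - t₀) = 4 / 3 * (dx r 0 (γ 0))⁻¹ := by
    rw [ht₁]
    field_simp
    ring
  linarith [inv_pos.2 hx₁]

/-! ### Characteristic labels -/

section ContractionPrinciple

open scoped NNReal BoundedContinuousFunction

lemma exists_continuous_fixedPoint {X E : Type*} [TopologicalSpace X] [NormedAddCommGroup E]
    [CompleteSpace E] {Φ : (X → E) → X → E} {κ : ℝ≥0} {A : ℝ} (hκ : κ < 1) (hA : 0 ≤ A)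
    (hcont : ∀ N, Continuous N → Continuous (Φ N)) (h₀ : ∀ x, ‖Φ 0 x‖ ≤ A)
    (hlip : ∀ N N', Continuous N → Continuous N' → ∀ D, (∀ x, ‖N x - N' x‖ ≤ D) →
      ∀ x, ‖Φ N x - Φ N' x‖ ≤ κ * D) :
    ∃ N, Continuous N ∧ (∀ x, ‖N x‖ ≤ A / (1 - κ)) ∧ Φ N = N := by
  have hbound : ∀ (N : X →ᵇ E) x, ‖Φ N x‖ ≤ A + κ * ‖N‖ := fun N x => by
    have hdiff := hlip N 0 N.continuous continuous_zero ‖N‖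
      (fun x => by simpa using N.norm_coe_le_norm x) x
    linarith [norm_le_norm_add_norm_sub (Φ 0 x) (Φ N x), h₀ x, norm_sub_rev (Φ N x) (Φ 0 x)]
  let Ψ : (X →ᵇ E) → (X →ᵇ E) := fun N =>
    BoundedContinuousFunction.ofNormedAddCommGroup (Φ N) (hcont N N.continuous) _ (hbound N)
  have hΨ : ContractingWith κ Ψ := ⟨hκ, LipschitzWith.of_dist_le_mul fun N N' =>
    (BoundedContinuousFunction.dist_le (by positivity)).2 fun x => by
      rw [dist_eq_norm]
      exact hlip N N' N.continuous N'.continuous _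
        (fun x => dist_eq_norm (N x) (N' x) ▸ BoundedContinuousFunction.dist_coe_le_dist x) x⟩
  have hnorm : ‖ContractingWith.fixedPoint Ψ hΨ‖ ≤ A / (1 - κ) := by
    have hzero : ‖Ψ 0‖ ≤ A := (BoundedContinuousFunction.norm_le hA).2 h₀
    calc ‖ContractingWith.fixedPoint Ψ hΨ‖ ≤ ‖Ψ 0‖ / (1 - κ) := by
          simpa only [dist_zero_left] using hΨ.dist_fixedPoint_le 0
      _ ≤ A / (1 - κ) := div_le_div_of_nonneg_right hzero hΨ.one_sub_K_pos.le
  exact ⟨⇑(ContractingWith.fixedPoint Ψ hΨ), BoundedContinuousFunction.continuous _,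
    fun x => (BoundedContinuousFunction.norm_coe_le_norm _ x).trans hnorm,
    congrArg DFunLike.coe hΨ.fixedPoint_isFixedPt⟩

end ContractionPrinciple

/-- Truncation of a real number to `[-h, h]`. -/
noncomputable def clip (h x : ℝ) : ℝ := max (-h) (min x h)

lemma continuous_clip (h : ℝ) : Continuous (clip h) := by
  unfold clip
  fun_prop

lemma abs_clip_le {h : ℝ} (hh : 0 ≤ h) (x : ℝ) : |clip h x| ≤ h :=
  abs_le.2 ⟨le_max_left _ _, max_le (neg_le_self hh) (min_le_right _ _)⟩

lemma clip_of_abs_le {h x : ℝ} (hx : |x| ≤ h) : clip h x = x := by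
  rw [clip, min_eq_left (abs_le.1 hx).2, max_eq_right (abs_le.1 hx).1]

/-- The strip of width `h` around the diagonal, in the plane of characteristic labels. The
diagonal itself corresponds to the initial line `t = 0`. -/
def diagStrip (h : ℝ) : Set (ℝ × ℝ) := {z | |z.2 - z.1| < h}

/-- Integral of `N` over the segment from `(z.1, z.1)` to `z`, truncated at length `h` in order
to be defined by bounded data on the whole plane. -/
noncomputable def diagIntegral (h : ℝ) (N : ℝ × ℝ → ℝ) (z : ℝ × ℝ) : ℝ :=
  ∫ b in (0 : ℝ)..clip h (z.2 - z.1), N (z.1, z.1 + b)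

section DiagIntegral

variable {h D : ℝ} {N N' : ℝ × ℝ → ℝ}

lemma isOpen_diagStrip (h : ℝ) : IsOpen (diagStrip h) := isOpen_lt (by fun_prop) continuous_const

lemma swap_mem_diagStrip {z : ℝ × ℝ} (hz : z ∈ diagStrip h) : z.swap ∈ diagStrip h :=
  (abs_sub_comm z.1 z.2).trans_lt hz

lemma convex_diagStrip (h : ℝ) : Convex ℝ (diagStrip h) := by
  have hpreimage : diagStrip h = form (-1) 1 ⁻¹' Metric.ball 0 h := by
    ext z
    simp [diagStrip, neg_add_eq_sub]
  rw [hpreimage]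
  exact (convex_ball _ _).linear_preimage (form (-1) 1).toLinearMap

lemma continuous_diagIntegral (h : ℝ) (hN : Continuous N) : Continuous (diagIntegral h N) :=
  intervalIntegral.continuous_parametric_intervalIntegral_of_continuous
    (f := fun (z : ℝ × ℝ) b => N (z.1, z.1 + b)) (hN.comp (by fun_prop))
    ((continuous_clip h).comp (by fun_prop))

lemma abs_diagIntegral_sub_le (hh : 0 ≤ h) (hN : Continuous N) (hN' : Continuous N')
    (hD : ∀ z, |N z - N' z| ≤ D) (z : ℝ × ℝ) :
    |diagIntegral h N z - diagIntegral h N' z| ≤ h * D := by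
  have hD0 : 0 ≤ D := (abs_nonneg _).trans (hD 0)
  have hI : ∀ {F : ℝ × ℝ → ℝ}, Continuous F → IntervalIntegrable (fun b => F (z.1, z.1 + b))
      MeasureTheory.volume 0 (clip h (z.2 - z.1)) := fun hF =>
    (hF.comp (by fun_prop : Continuous fun b => (z.1, z.1 + b))).intervalIntegrable _ _
  rw [diagIntegral, diagIntegral, ← intervalIntegral.integral_sub (hI hN) (hI hN')]
  have hint := intervalIntegral.norm_integral_le_of_norm_le_const (a := 0)
    (b := clip h (z.2 - z.1)) (f := fun b => N (z.1, z.1 + b) - N' (z.1, z.1 + b))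
    fun b _ => hD (z.1, z.1 + b)
  rw [sub_zero, mul_comm] at hint
  exact hint.trans (mul_le_mul_of_nonneg_right (abs_clip_le hh _) hD0)

lemma diagIntegral_zero (h : ℝ) (z : ℝ × ℝ) : diagIntegral h 0 z = 0 :=
  intervalIntegral.integral_zero

lemma diagIntegral_diag (hh : 0 ≤ h) (N : ℝ × ℝ → ℝ) (a : ℝ) : diagIntegral h N (a, a) = 0 := by
  simp [diagIntegral, clip_of_abs_le (show |(0 : ℝ)| ≤ h by simpa using hh)]

lemma hasDerivAt_diagIntegral (hN : Continuous N) {z : ℝ × ℝ} (hz : z ∈ diagStrip h) :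
    HasDerivAt (fun b => diagIntegral h N (z.1, b)) (N z) z.2 := by
  have hcont : Continuous fun b => N (z.1, z.1 + b) := hN.comp (by fun_prop)
  have hFTC := (hcont.integral_hasStrictDerivAt 0 (z.2 - z.1)).hasDerivAt.comp z.2
    ((hasDerivAt_id z.2).sub_const z.1)
  rw [add_sub_cancel, mul_one] at hFTC
  have hnear : ∀ᶠ b in 𝓝 z.2, |b - z.1| < h :=
    (by fun_prop : Continuous fun b => |b - z.1|).continuousAt.eventually_lt_const hz
  refine hFTC.congr_of_eventuallyEq (hnear.mono fun b hb => ?_)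
  simp only [diagIntegral, clip_of_abs_le hb.le, Function.comp, id]

end DiagIntegral

/-- The derivative `∂t/∂a` of time with respect to the first label, in terms of the mixed
derivative `N = ∂²t/∂a∂b` and of its value `1 / (2C)` on the initial line. -/
noncomputable def timeFst (C : ℝ × ℝ → ℝ) (h : ℝ) (N : ℝ × ℝ → ℝ) (z : ℝ × ℝ) : ℝ :=
  1 / (2 * C (z.1, z.1)) + diagIntegral h N z

/-- The derivative `-∂t/∂b` of time with respect to the second label, in terms of the mixed
derivative `N`. The sign makes it positive, and symmetric to `timeFst`. -/
noncomputable def timeSnd (C : ℝ × ℝ → ℝ) (h : ℝ) (N : ℝ × ℝ → ℝ) (z : ℝ × ℝ) : ℝ :=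
  timeFst C h (fun w => -N w.swap) z.swap

section TimeDerivatives

variable {C N N' : ℝ × ℝ → ℝ} {h D : ℝ}

lemma pos_of_near_one (hC : ∀ z, |C z - 1| ≤ 1 / 100) (z : ℝ × ℝ) : 0 < C z := by
  linarith [(abs_le.1 (hC z)).1]

lemma abs_inv_two_mul_sub_half_le (hC : ∀ z, |C z - 1| ≤ 1 / 100) (z : ℝ × ℝ) :
    |1 / (2 * C z) - 1 / 2| ≤ 1 / 100 := by
  have hpos := pos_of_near_one hC z
  obtain ⟨hlower, hupper⟩ := abs_le.1 (hC z)
  rw [show 1 / (2 * C z) - 1 / 2 = (1 - C z) / (2 * C z) by field_simp, abs_div,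
    abs_of_pos (by positivity : 0 < 2 * C z), div_le_iff₀ (by positivity), abs_le]
  constructor <;> linarith

lemma continuous_timeFst (hCc : Continuous C) (hC : ∀ z, |C z - 1| ≤ 1 / 100)
    (hN : Continuous N) : Continuous (timeFst C h N) := by
  have hdiag : Continuous fun z : ℝ × ℝ => 2 * C (z.1, z.1) := by fun_prop
  exact (continuous_const.div hdiag fun z =>
    (mul_pos two_pos (pos_of_near_one hC (z.1, z.1))).ne').add (continuous_diagIntegral h hN)

lemma continuous_timeSnd (hCc : Continuous C) (hC : ∀ z, |C z - 1| ≤ 1 / 100)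
    (hN : Continuous N) : Continuous (timeSnd C h N) :=
  (continuous_timeFst hCc hC (hN.comp continuous_swap).neg).comp continuous_swap

lemma abs_timeFst_sub_le (hh : 0 ≤ h) (hN : Continuous N) (hN' : Continuous N')
    (hD : ∀ z, |N z - N' z| ≤ D) (z : ℝ × ℝ) :
    |timeFst C h N z - timeFst C h N' z| ≤ h * D := by
  rw [timeFst, timeFst, add_sub_add_left_eq_sub]
  exact abs_diagIntegral_sub_le hh hN hN' hD z

lemma abs_timeSnd_sub_le (hh : 0 ≤ h) (hN : Continuous N) (hN' : Continuous N')
    (hD : ∀ z, |N z - N' z| ≤ D) (z : ℝ × ℝ) :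
    |timeSnd C h N z - timeSnd C h N' z| ≤ h * D := by
  refine abs_timeFst_sub_le hh (hN.comp continuous_swap).neg (hN'.comp continuous_swap).neg
    (fun w => ?_) z.swap
  change |-N w.swap - -N' w.swap| ≤ D
  rw [neg_sub_neg, abs_sub_comm]
  exact hD w.swap

lemma abs_timeFst_sub_half_le (hC : ∀ z, |C z - 1| ≤ 1 / 100) (hh : 0 ≤ h) (hN : Continuous N)
    (hD : ∀ z, |N z| ≤ D) (z : ℝ × ℝ) : |timeFst C h N z - 1 / 2| ≤ 1 / 100 + h * D := by
  have hdiag := abs_inv_two_mul_sub_half_le hC (z.1, z.1)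
  have hint := abs_diagIntegral_sub_le hh hN continuous_zero (by simpa using hD) z
  rw [diagIntegral_zero, sub_zero] at hint
  rw [timeFst, add_sub_right_comm]
  exact (abs_add_le _ _).trans (add_le_add hdiag hint)

lemma abs_timeSnd_sub_half_le (hC : ∀ z, |C z - 1| ≤ 1 / 100) (hh : 0 ≤ h) (hN : Continuous N)
    (hD : ∀ z, |N z| ≤ D) (z : ℝ × ℝ) : |timeSnd C h N z - 1 / 2| ≤ 1 / 100 + h * D :=
  abs_timeFst_sub_half_le hC hh (hN.comp continuous_swap).neg
    (fun w => (abs_neg (N w.swap)).trans_le (hD w.swap)) z.swap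

lemma hasDerivAt_timeFst (hN : Continuous N) {z : ℝ × ℝ} (hz : z ∈ diagStrip h) :
    HasDerivAt (fun b => timeFst C h N (z.1, b)) (N z) z.2 :=
  (hasDerivAt_diagIntegral hN hz).const_add (1 / (2 * C (z.1, z.1)))

lemma hasDerivAt_timeSnd (hN : Continuous N) {z : ℝ × ℝ} (hz : z ∈ diagStrip h) :
    HasDerivAt (fun a => timeSnd C h N (a, z.2)) (-N z) z.1 :=
  hasDerivAt_timeFst (hN.comp continuous_swap).neg (swap_mem_diagStrip hz)

lemma timeFst_diag (hh : 0 ≤ h) (a : ℝ) : timeFst C h N (a, a) = 1 / (2 * C (a, a)) := by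
  rw [timeFst, diagIntegral_diag hh, add_zero]

lemma timeSnd_diag (hh : 0 ≤ h) (a : ℝ) : timeSnd C h N (a, a) = 1 / (2 * C (a, a)) :=
  timeFst_diag hh a

end TimeDerivatives

/-- A speed near `1`, given as a function `C` of the labels of the two characteristics through a
point, together with its partial derivatives `Cα` and `Cβ`, which are bounded by `B`. -/
structure IsLabelSpeed (C Cα Cβ : ℝ × ℝ → ℝ) (B : ℝ) : Prop where
  continuous : Continuous C
  continuous_fst : Continuous Cα
  continuous_snd : Continuous Cβ
  near_one : ∀ z, |C z - 1| ≤ 1 / 100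
  abs_fst_le : ∀ z, |Cα z| ≤ B
  abs_snd_le : ∀ z, |Cβ z| ≤ B
  hasDerivAt_fst : ∀ z : ℝ × ℝ, HasDerivAt (fun a => C (a, z.2)) (Cα z) z.1
  hasDerivAt_snd : ∀ z : ℝ × ℝ, HasDerivAt (fun b => C (z.1, b)) (Cβ z) z.2

/-- The value of the mixed derivative `∂²t/∂a∂b` when `p = ∂t/∂a` and `q = -∂t/∂b`. It is found by
eliminating `x` from the equations `∂x/∂a = C ∂t/∂a` and `∂x/∂b = -C ∂t/∂b`. -/
noncomputable def mixedDeriv (C Cα Cβ p q : ℝ × ℝ → ℝ) (z : ℝ × ℝ) : ℝ :=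
  (Cα z * q z - Cβ z * p z) / (2 * C z)

/-- A solution of the characteristic problem for time as a function of the labels, which is given
by its derivatives `p = ∂t/∂a`, `q = -∂t/∂b` and `N = ∂²t/∂a∂b`. -/
structure IsLabelTime (C Cα Cβ : ℝ × ℝ → ℝ) (h : ℝ) (p q N : ℝ × ℝ → ℝ) : Prop where
  continuous_fst : Continuous p
  continuous_snd : Continuous q
  continuous_mixed : Continuous N
  fst_near_half : ∀ z, |p z - 1 / 2| ≤ 1 / 50
  snd_near_half : ∀ z, |q z - 1 / 2| ≤ 1 / 50
  hasDerivAt_fst : ∀ z ∈ diagStrip h, HasDerivAt (fun b => p (z.1, b)) (N z) z.2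
  hasDerivAt_snd : ∀ z ∈ diagStrip h, HasDerivAt (fun a => q (a, z.2)) (-N z) z.1
  fst_diag : ∀ a, p (a, a) = 1 / (2 * C (a, a))
  snd_diag : ∀ a, q (a, a) = 1 / (2 * C (a, a))
  mixed_eq : ∀ z, N z = mixedDeriv C Cα Cβ p q z

lemma mixedDeriv_sub (C Cα Cβ p q p' q' : ℝ × ℝ → ℝ) (z : ℝ × ℝ) :
    mixedDeriv C Cα Cβ p q z - mixedDeriv C Cα Cβ p' q' z =
      mixedDeriv C Cα Cβ (p - p') (q - q') z := by
  simp only [mixedDeriv, Pi.sub_apply]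
  ring

namespace IsLabelSpeed

variable {C Cα Cβ p q : ℝ × ℝ → ℝ} {B h : ℝ}

lemma bound_nonneg (hC : IsLabelSpeed C Cα Cβ B) : 0 ≤ B := (abs_nonneg _).trans (hC.abs_fst_le 0)

lemma pos (hC : IsLabelSpeed C Cα Cβ B) (z : ℝ × ℝ) : 0 < C z := pos_of_near_one hC.near_one z

lemma continuous_mixedDeriv (hC : IsLabelSpeed C Cα Cβ B) (hp : Continuous p)
    (hq : Continuous q) : Continuous (mixedDeriv C Cα Cβ p q) :=
  ((hC.continuous_fst.mul hq).sub (hC.continuous_snd.mul hp)).div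
    (continuous_const.mul hC.continuous) fun z => (mul_pos two_pos (hC.pos z)).ne'

lemma abs_mixedDeriv_le (hC : IsLabelSpeed C Cα Cβ B) {D : ℝ} {z : ℝ × ℝ} (hp : |p z| ≤ D)
    (hq : |q z| ≤ D) : |mixedDeriv C Cα Cβ p q z| ≤ 2 * (B * D) := by
  have hBD : 0 ≤ B * D := mul_nonneg hC.bound_nonneg ((abs_nonneg _).trans hp)
  have hprod : ∀ {x y : ℝ}, |x| ≤ B → |y| ≤ D → |x * y| ≤ B * D := fun hx hy => by
    rw [abs_mul]
    exact mul_le_mul hx hy (abs_nonneg _) hC.bound_nonneg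
  have hnum : |Cα z * q z - Cβ z * p z| ≤ B * D + B * D :=
    (abs_sub _ _).trans (add_le_add (hprod (hC.abs_fst_le z) hq) (hprod (hC.abs_snd_le z) hp))
  have hpos : 0 < 2 * C z := mul_pos two_pos (hC.pos z)
  rw [mixedDeriv, abs_div, abs_of_pos hpos, div_le_iff₀ hpos]
  nlinarith [(abs_le.1 (hC.near_one z)).1]

lemma exists_isLabelTime (hC : IsLabelSpeed C Cα Cβ B) (hh : 0 < h) (hB : B * h ≤ 1 / 200) :
    ∃ p q N, IsLabelTime C Cα Cβ h p q N := by
  have hB0 := hC.bound_nonneg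
  have habs : ∀ {y : ℝ}, |y - 1 / 2| ≤ 1 / 100 + h * 0 → |y| ≤ 51 / 100 := fun hy => by
    rw [abs_le] at hy ⊢
    constructor <;> linarith
  obtain ⟨N, hN, hNle, hfix⟩ := exists_continuous_fixedPoint (κ := 1 / 100)
    (A := 2 * (B * (51 / 100)))
    (Φ := fun N => mixedDeriv C Cα Cβ (timeFst C h N) (timeSnd C h N))
    (by rw [← NNReal.coe_lt_coe]; norm_num) (by positivity)
    (fun N hN => hC.continuous_mixedDeriv (continuous_timeFst hC.continuous hC.near_one hN)
      (continuous_timeSnd hC.continuous hC.near_one hN))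
    (fun z => hC.abs_mixedDeriv_le
      (habs (abs_timeFst_sub_half_le hC.near_one hh.le continuous_zero (by simp) z))
      (habs (abs_timeSnd_sub_half_le hC.near_one hh.le continuous_zero (by simp) z)))
    (fun N N' hN hN' D hD z => by
      have hD0 : 0 ≤ D := (norm_nonneg _).trans (hD 0)
      rw [mixedDeriv_sub]
      refine (hC.abs_mixedDeriv_le (abs_timeFst_sub_le hh.le hN hN' hD z)
        (abs_timeSnd_sub_le hh.le hN hN' hD z)).trans ?_
      push_cast
      nlinarith)
  have hNh : h * (2 * (B * (51 / 100)) / (1 - (1 / 100 : NNReal))) ≤ 1 / 100 := by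
    rw [NNReal.coe_div, NNReal.coe_one, NNReal.coe_ofNat, mul_div_assoc', div_le_iff₀ (by norm_num)]
    linarith
  exact ⟨timeFst C h N, timeSnd C h N, N,
    { continuous_fst := continuous_timeFst hC.continuous hC.near_one hN
      continuous_snd := continuous_timeSnd hC.continuous hC.near_one hN
      continuous_mixed := hN
      fst_near_half := fun z =>
        (abs_timeFst_sub_half_le hC.near_one hh.le hN hNle z).trans (by linarith)
      snd_near_half := fun z =>
        (abs_timeSnd_sub_half_le hC.near_one hh.le hN hNle z).trans (by linarith)
      hasDerivAt_fst := fun z hz => hasDerivAt_timeFst hN hz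
      hasDerivAt_snd := fun z hz => hasDerivAt_timeSnd hN hz
      fst_diag := timeFst_diag hh.le
      snd_diag := timeSnd_diag hh.le
      mixed_eq := fun z => (congrFun hfix z).symm }⟩

end IsLabelSpeed

lemma hasDerivAt_integral_diag {P : ℝ × ℝ → ℝ} (hP : Continuous P) (b₀ : ℝ) :
    HasDerivAt (fun b => ∫ a in b₀..b, P (a, b)) (P (b₀, b₀)) b₀ := by
  rw [hasDerivAt_iff_isLittleO, Asymptotics.isLittleO_iff]
  intro ε hε
  obtain ⟨δ, hδ, hPδ⟩ := Metric.continuousAt_iff.1 (hP.continuousAt (x := (b₀, b₀))) ε hε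
  filter_upwards [Metric.ball_mem_nhds b₀ hδ] with b hb
  have herror : (∫ a in b₀..b, P (a, b)) - (∫ a in b₀..b₀, P (a, b₀)) - (b - b₀) • P (b₀, b₀) =
      ∫ a in b₀..b, (P (a, b) - P (b₀, b₀)) := by
    have hI : IntervalIntegrable (fun a => P (a, b)) MeasureTheory.volume b₀ b :=
      (hP.comp (by fun_prop : Continuous fun a => (a, b))).intervalIntegrable _ _
    rw [intervalIntegral.integral_sub hI intervalIntegrable_const, intervalIntegral.integral_same,
      intervalIntegral.integral_const, sub_zero]
  rw [herror]
  refine intervalIntegral.norm_integral_le_of_norm_le_const fun a ha => ?_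
  rw [← dist_eq_norm]
  refine (hPδ ?_).le
  rw [Metric.mem_ball, Real.dist_eq] at hb
  rw [Prod.dist_eq, max_lt_iff, Real.dist_eq, Real.dist_eq]
  exact ⟨(abs_sub_left_of_mem_uIcc (uIoc_subset_uIcc ha)).trans_lt hb, hb⟩

section Potential

variable {P Q N : ℝ × ℝ → ℝ} {h : ℝ}

lemma hasDerivAt_integral_of_mem_diagStrip (hP : Continuous P) (hN : Continuous N)
    (hPN : ∀ z ∈ diagStrip h, HasDerivAt (fun b => P (z.1, b)) (N z) z.2)
    (hQN : ∀ z ∈ diagStrip h, HasDerivAt (fun a => Q (a, z.2)) (N z) z.1)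
    {z : ℝ × ℝ} (hz : z ∈ diagStrip h) :
    HasDerivAt (fun b => ∫ a in z.2..z.1, P (a, b)) (Q z - Q (z.2, z.2)) z.2 := by
  have hslice : ∀ b : ℝ, Continuous fun a : ℝ => (a, b) := fun b => by fun_prop
  have hseg : ∀ a ∈ uIcc z.2 z.1, |z.2 - a| ≤ |z.2 - z.1| := fun a ha => by
    rw [abs_sub_comm z.2 a, abs_sub_comm z.2 z.1]
    exact abs_sub_left_of_mem_uIcc ha
  obtain ⟨η, hη, hηh⟩ : ∃ η > 0, η + |z.2 - z.1| < h :=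
    ⟨(h - |z.2 - z.1|) / 2, half_pos (sub_pos.2 hz), by linarith [show |z.2 - z.1| < h from hz]⟩
  obtain ⟨D, hD⟩ := ((isCompact_uIcc (a := z.2) (b := z.1)).prod
    (isCompact_closedBall z.2 η)).exists_bound_of_continuousOn hN.continuousOn
  have hFTC : ∫ a in z.2..z.1, N (a, z.2) = Q z - Q (z.2, z.2) :=
    intervalIntegral.integral_eq_sub_of_hasDerivAt (f := fun a => Q (a, z.2))
      (fun a ha => hQN (a, z.2) ((hseg a ha).trans_lt hz))
      ((hN.comp (hslice z.2)).intervalIntegrable _ _)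
  rw [← hFTC]
  refine (intervalIntegral.hasDerivAt_integral_of_dominated_loc_of_deriv_le
    (F := fun b a => P (a, b)) (F' := fun b a => N (a, b)) (bound := fun _ => D)
    (Metric.ball_mem_nhds z.2 hη)
    (Eventually.of_forall fun b => (hP.comp (hslice b)).aestronglyMeasurable)
    ((hP.comp (hslice z.2)).intervalIntegrable _ _) (hN.comp (hslice z.2)).aestronglyMeasurable
    (Eventually.of_forall fun a ha b hb =>
      hD (a, b) ⟨uIoc_subset_uIcc ha, Metric.ball_subset_closedBall hb⟩)
    intervalIntegrable_const
    (Eventually.of_forall fun a ha b hb => hPN (a, b) ?_)).2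
  calc |b - a| ≤ |b - z.2| + |z.2 - a| := abs_sub_le _ _ _
    _ ≤ η + |z.2 - z.1| := add_le_add (Metric.mem_ball.1 hb).le (hseg a (uIoc_subset_uIcc ha))
    _ < h := hηh

lemma hasDerivAt_integral_lower_of_mem_diagStrip (hP : Continuous P) (hN : Continuous N)
    (hPN : ∀ z ∈ diagStrip h, HasDerivAt (fun b => P (z.1, b)) (N z) z.2)
    (hQN : ∀ z ∈ diagStrip h, HasDerivAt (fun a => Q (a, z.2)) (N z) z.1)
    {z : ℝ × ℝ} (hz : z ∈ diagStrip h) :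
    HasDerivAt (fun b => ∫ a in b..z.1, P (a, b)) (Q z - Q (z.2, z.2) - P (z.2, z.2)) z.2 := by
  have hI : ∀ b a₁ a₂, IntervalIntegrable (fun a => P (a, b)) MeasureTheory.volume a₁ a₂ :=
    fun b _ _ => (hP.comp (by fun_prop : Continuous fun a => (a, b))).intervalIntegrable _ _
  have hsplit : ∀ b, ∫ a in b..z.1, P (a, b) =
      (∫ a in z.2..z.1, P (a, b)) - ∫ a in z.2..b, P (a, b) := fun b =>
    (intervalIntegral.integral_interval_sub_left (hI _ _ _) (hI _ _ _)).symm
  simp only [hsplit]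
  exact (hasDerivAt_integral_of_mem_diagStrip hP hN hPN hQN hz).sub (hasDerivAt_integral_diag hP _)

lemma hasStrictFDerivAt_potential {f₀ : ℝ → ℝ} (hP : Continuous P) (hQ : Continuous Q)
    (hN : Continuous N)
    (hPN : ∀ z ∈ diagStrip h, HasDerivAt (fun b => P (z.1, b)) (N z) z.2)
    (hQN : ∀ z ∈ diagStrip h, HasDerivAt (fun a => Q (a, z.2)) (N z) z.1)
    (hf₀ : ∀ b, HasDerivAt f₀ (P (b, b) + Q (b, b)) b) {z : ℝ × ℝ} (hz : z ∈ diagStrip h) :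
    HasStrictFDerivAt (fun z : ℝ × ℝ => f₀ z.2 + ∫ a in z.2..z.1, P (a, z.2))
      (form (P z) (Q z)) z := by
  have hfst : ∀ w : ℝ × ℝ,
      HasDerivAt (fun a => f₀ w.2 + ∫ a' in w.2..a, P (a', w.2)) (P w) w.1 := fun w =>
    ((hP.comp (by fun_prop : Continuous fun a => (a, w.2))).integral_hasStrictDerivAt
      w.2 w.1).hasDerivAt.const_add _
  have hsnd : ∀ w ∈ diagStrip h,
      HasDerivAt (fun b => f₀ b + ∫ a in b..w.1, P (a, b)) (Q w) w.2 := fun w hw =>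
    ((hf₀ w.2).add (hasDerivAt_integral_lower_of_mem_diagStrip hP hN hPN hQN hw)).congr_deriv
      (by ring)
  have hspan := (ContinuousLinearMap.toSpanSingletonCLE (𝕜 := ℝ) (E := ℝ)).continuous
  refine (hasStrictFDerivAt_uncurry_coprod (𝕜 := ℝ) (u := z)
    (f := fun a b => f₀ b + ∫ a' in b..a, P (a', b))
    (f₁ := fun a b => ContinuousLinearMap.toSpanSingleton ℝ (P (a, b)))
    (f₂ := fun a b => ContinuousLinearMap.toSpanSingleton ℝ (Q (a, b)))
    (Eventually.of_forall fun w => (hfst w).hasFDerivAt)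
    (((isOpen_diagStrip h).eventually_mem hz).mono fun w hw => (hsnd w hw).hasFDerivAt)
    (hspan.comp hP).continuousAt (hspan.comp hQ).continuousAt).congr_fderiv ?_
  ext <;> simp [Function.HasUncurry.uncurry]

end Potential

/-- The differential of `(a, b) ↦ (t, x)` at a point where the speed is `c`, `∂t/∂a = p` and
`∂t/∂b = -q`, as an invertible map. -/
noncomputable def labelEquiv {c p q : ℝ} (hc : c ≠ 0) (hp : p ≠ 0) (hq : q ≠ 0) :
    (ℝ × ℝ) ≃L[ℝ] (ℝ × ℝ) :=
  ContinuousLinearEquiv.equivOfInverse ((form p (-q)).prod (form (c * p) (c * q)))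
    ((form (1 / (2 * p)) (1 / (2 * (c * p)))).prod (form (-(1 / (2 * q))) (1 / (2 * (c * q)))))
    (fun z => by ext <;> simp <;> field_simp <;> ring)
    (fun z => by ext <;> simp <;> field_simp <;> ring)

/-- The change from labels to time and space for the constant speed `1`. -/
noncomputable def flatLabelEquiv : (ℝ × ℝ) ≃L[ℝ] (ℝ × ℝ) :=
  labelEquiv one_ne_zero (one_half_pos (α := ℝ)).ne' (one_half_pos (α := ℝ)).ne'

lemma norm_form_le {a b D : ℝ} (h : |a| + |b| ≤ D) : ‖form a b‖ ≤ D := by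
  refine ContinuousLinearMap.opNorm_le_bound _ ((add_nonneg (abs_nonneg a) (abs_nonneg b)).trans h)
    fun z => ?_
  rw [form_apply, Real.norm_eq_abs]
  calc |a * z.1 + b * z.2| ≤ |a| * |z.1| + |b| * |z.2| := by
        rw [← abs_mul, ← abs_mul]
        exact abs_add_le _ _
    _ ≤ |a| * ‖z‖ + |b| * ‖z‖ := add_le_add
        (mul_le_mul_of_nonneg_left (norm_fst_le z) (abs_nonneg _))
        (mul_le_mul_of_nonneg_left (norm_snd_le z) (abs_nonneg _))
    _ ≤ D * ‖z‖ := by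
        rw [← add_mul]
        exact mul_le_mul_of_nonneg_right h (norm_nonneg _)

lemma norm_prod_form_le {a b a' b' D : ℝ} (h : |a| + |b| ≤ D) (h' : |a'| + |b'| ≤ D) :
    ‖(form a b).prod (form a' b')‖ ≤ D := by
  rw [ContinuousLinearMap.opNorm_prod, Prod.norm_def, max_le_iff]
  exact ⟨norm_form_le h, norm_form_le h'⟩

lemma half_le_nnnorm_flatLabelEquiv_symm_inv :
    (2 : NNReal)⁻¹ ≤ ‖(flatLabelEquiv.symm : ℝ × ℝ →L[ℝ] ℝ × ℝ)‖₊⁻¹ := by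
  refine inv_anti₀ flatLabelEquiv.nnnorm_symm_pos ?_
  rw [← NNReal.coe_le_coe, coe_nnnorm]
  exact norm_prod_form_le (by norm_num) (by norm_num)

lemma closedBall_diag_subset_diagStrip {h : ℝ} (hh : 0 < h) (x : ℝ) :
    Metric.closedBall (x, x) (h / 4) ⊆ diagStrip h := fun z hz => by
  rw [Metric.mem_closedBall, Prod.dist_eq, max_le_iff, Real.dist_eq, Real.dist_eq] at hz
  calc |z.2 - z.1| ≤ |z.2 - x| + |x - z.1| := abs_sub_le _ _ _
    _ ≤ h / 4 + h / 4 := add_le_add hz.2 (abs_sub_comm x z.1 ▸ hz.1)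
    _ < h := by linarith

lemma exists_inverse_near_initial_line {Ψ : ℝ × ℝ → ℝ × ℝ} {h : ℝ} (hh : 0 < h)
    {A : ℝ × ℝ → (ℝ × ℝ) ≃L[ℝ] (ℝ × ℝ)}
    (happ : ApproximatesLinearOn Ψ (flatLabelEquiv : ℝ × ℝ →L[ℝ] ℝ × ℝ) (diagStrip h) (1 / 4))
    (hdiag : ∀ x, Ψ (x, x) = (0, x))
    (hderiv : ∀ z ∈ diagStrip h, HasFDerivAt Ψ (A z : ℝ × ℝ →L[ℝ] ℝ × ℝ) z) :
    ∃ w : ℝ × ℝ → ℝ × ℝ, (∀ x, w (0, x) = (x, x)) ∧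
      ∀ z : ℝ × ℝ, |z.1| ≤ h / 16 → HasFDerivAt w ((A (w z)).symm : ℝ × ℝ →L[ℝ] ℝ × ℝ) z := by
  have hinv := half_le_nnnorm_flatLabelEquiv_symm_inv
  have hlt : (1 / 4 : NNReal) < ‖(flatLabelEquiv.symm : ℝ × ℝ →L[ℝ] ℝ × ℝ)‖₊⁻¹ :=
    hinv.trans_lt' (by rw [← NNReal.coe_lt_coe]; norm_num)
  let e := happ.toOpenPartialHomeomorph Ψ (diagStrip h) (Or.inr hlt) (isOpen_diagStrip h)
  have htarget : ∀ z : ℝ × ℝ, |z.1| ≤ h / 16 → z ∈ e.target := fun z hz => by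
    refine happ.closedBall_subset_target (Or.inr hlt) (isOpen_diagStrip h) (by positivity)
      (closedBall_diag_subset_diagStrip hh z.2) ?_
    rw [hdiag, Metric.mem_closedBall, Prod.dist_eq, max_le_iff, dist_self, Real.dist_eq, sub_zero]
    have hradius : h / 16 ≤ (((‖(flatLabelEquiv.symm : ℝ × ℝ →L[ℝ] ℝ × ℝ)‖₊⁻¹ : NNReal) : ℝ) -
        ((1 / 4 : NNReal) : ℝ)) * (h / 4) := by
      rw [← NNReal.coe_le_coe] at hinv
      push_cast at hinv ⊢
      nlinarith
    exact ⟨hz.trans hradius, (by positivity : 0 ≤ h / 16).trans hradius⟩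
  refine ⟨e.symm, fun x => ?_, fun z hz => ?_⟩
  · have hx : (x, x) ∈ e.source := closedBall_diag_subset_diagStrip hh x
      (Metric.mem_closedBall_self (by positivity))
    rw [← hdiag]
    exact e.left_inv hx
  · exact e.hasFDerivAt_symm (htarget z hz) (hderiv _ (e.map_target (htarget z hz)))

/-- A parametrization `w` of the slab `|t| ≤ T` by the labels of the characteristics of a speed
`C` given as a function of the labels. Its differential is the inverse of that of
`(a, b) ↦ (t, x)`, where `∂t/∂a = p` and `∂t/∂b = -q`. -/
structure IsCharLabelling (C : ℝ × ℝ → ℝ) (T : ℝ) (w : ℝ × ℝ → ℝ × ℝ) (p q : ℝ × ℝ → ℝ) :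
    Prop where
  continuous_fst : Continuous p
  continuous_snd : Continuous q
  fst_near_half : ∀ z, |p z - 1 / 2| ≤ 1 / 50
  snd_near_half : ∀ z, |q z - 1 / 2| ≤ 1 / 50
  initial : ∀ x, w (0, x) = (x, x)
  hasFDerivAt : ∀ z : ℝ × ℝ, |z.1| ≤ T →
    HasFDerivAt w ((form (1 / (2 * p (w z))) (1 / (2 * (C (w z) * p (w z))))).prod
      (form (-(1 / (2 * q (w z)))) (1 / (2 * (C (w z) * q (w z)))))) z

/-- Time and space as functions of the labels, recovered from `∂t/∂a = p` by integration starting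
from the diagonal, which is mapped to the initial line. -/
noncomputable def labelMap (C p : ℝ × ℝ → ℝ) (z : ℝ × ℝ) : ℝ × ℝ :=
  (0 + ∫ a in z.2..z.1, p (a, z.2), z.2 + ∫ a in z.2..z.1, C (a, z.2) * p (a, z.2))

lemma labelMap_diag (C p : ℝ × ℝ → ℝ) (x : ℝ) : labelMap C p (x, x) = (0, x) := by
  simp [labelMap]

section Labelling

variable {C Cα Cβ p q N : ℝ × ℝ → ℝ} {B h : ℝ}

lemma pos_of_near_half {y : ℝ} (hy : |y - 1 / 2| ≤ 1 / 50) : 0 < y := by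
  linarith [(abs_le.1 hy).1]

lemma IsLabelTime.hasFDerivAt_labelMap (hN : IsLabelTime C Cα Cβ h p q N)
    (hC : IsLabelSpeed C Cα Cβ B) {z : ℝ × ℝ} (hz : z ∈ diagStrip h) :
    HasFDerivAt (labelMap C p)
      ((form (p z) (-q z)).prod (form (C z * p z) (C z * q z))) z := by
  have htime := hasStrictFDerivAt_potential (f₀ := fun _ => 0) hN.continuous_fst
    hN.continuous_snd.neg hN.continuous_mixed hN.hasDerivAt_fst
    (fun z hz => (hN.hasDerivAt_snd z hz).neg.congr_deriv (neg_neg _))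
    (fun b => (hasDerivAt_const b (0 : ℝ)).congr_deriv (by
      rw [Pi.neg_apply, hN.fst_diag, hN.snd_diag, add_neg_cancel])) hz
  have hspace := hasStrictFDerivAt_potential (P := fun z => C z * p z) (Q := fun z => C z * q z)
    (N := fun z => Cβ z * p z + C z * N z) (f₀ := fun b => b)
    (hC.continuous.mul hN.continuous_fst) (hC.continuous.mul hN.continuous_snd)
    ((hC.continuous_snd.mul hN.continuous_fst).add (hC.continuous.mul hN.continuous_mixed))
    (fun z hz => (hC.hasDerivAt_snd z).mul (hN.hasDerivAt_fst z hz))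
    (fun z hz => ((hC.hasDerivAt_fst z).mul (hN.hasDerivAt_snd z hz)).congr_deriv (by
      have hmixed := hN.mixed_eq z
      rw [mixedDeriv, eq_div_iff (mul_pos two_pos (hC.pos z)).ne'] at hmixed
      linear_combination -hmixed))
    (fun b => (hasDerivAt_id b).congr_deriv (by
      have hCb := (hC.pos (b, b)).ne'
      rw [hN.fst_diag, hN.snd_diag]
      field_simp
      norm_num)) hz
  exact (htime.prodMk hspace).hasFDerivAt

lemma IsLabelTime.approximatesLinearOn_labelMap (hN : IsLabelTime C Cα Cβ h p q N)
    (hC : IsLabelSpeed C Cα Cβ B) :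
    ApproximatesLinearOn (labelMap C p) (flatLabelEquiv : ℝ × ℝ →L[ℝ] ℝ × ℝ) (diagStrip h)
      (1 / 4) := by
  have hmul : ∀ {z : ℝ × ℝ} {y : ℝ}, |y - 1 / 2| ≤ 1 / 50 → |C z * y - 1 / 2| ≤ 1 / 8 :=
    fun {z y} hy => by
      have hCz := abs_le.1 (hC.near_one z)
      rw [abs_le] at hy ⊢
      constructor <;> nlinarith
  intro x hx y hy
  refine (convex_diagStrip h).norm_image_sub_le_of_norm_hasFDerivWithin_le' (𝕜 := ℝ) (C := 1 / 4)
    (fun z hz => (hN.hasFDerivAt_labelMap hC hz).hasFDerivWithinAt) (fun z _ => ?_) hy hx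
  have hsub : (form (p z) (-q z)).prod (form (C z * p z) (C z * q z)) -
      (flatLabelEquiv : ℝ × ℝ →L[ℝ] ℝ × ℝ) = (form (p z - 1 / 2) (-(q z - 1 / 2))).prod
        (form (C z * p z - 1 / 2) (C z * q z - 1 / 2)) := by
    change _ - (form (1 / 2) (-(1 / 2))).prod (form (1 * (1 / 2)) (1 * (1 / 2))) = _
    ext <;> simp [neg_add_eq_sub]
  rw [hsub]
  refine norm_prod_form_le ?_ ?_
  · rw [abs_neg]
    linarith [hN.fst_near_half z, hN.snd_near_half z]
  · linarith [hmul (z := z) (hN.fst_near_half z), hmul (z := z) (hN.snd_near_half z)]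

lemma IsLabelSpeed.exists_isCharLabelling (hC : IsLabelSpeed C Cα Cβ B) (hh : 0 < h)
    (hB : B * h ≤ 1 / 200) : ∃ w p q, IsCharLabelling C (h / 16) w p q := by
  obtain ⟨p, q, N, hN⟩ := hC.exists_isLabelTime hh hB
  obtain ⟨w, hw₀, hw⟩ := exists_inverse_near_initial_line hh
    (A := fun z => labelEquiv (hC.pos z).ne' (pos_of_near_half (hN.fst_near_half z)).ne'
      (pos_of_near_half (hN.snd_near_half z)).ne')
    (hN.approximatesLinearOn_labelMap hC) (labelMap_diag C p)
    (fun z hz => hN.hasFDerivAt_labelMap hC hz)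
  exact ⟨w, p, q, hN.continuous_fst, hN.continuous_snd, hN.fst_near_half, hN.snd_near_half, hw₀, hw⟩

end Labelling

/-! ### Local existence -/

lemma IsSpeed.isLabelSpeed {k r₀ s₀ : ℝ → ℝ} {K M : ℝ} (hk : IsSpeed k K)
    (hr : ContDiff ℝ 1 r₀) (hs : ContDiff ℝ 1 s₀) (hrM : ∀ x, |deriv r₀ x| ≤ M)
    (hsM : ∀ x, |deriv s₀ x| ≤ M) :
    IsLabelSpeed (fun z => k ((r₀ z.1 - s₀ z.2) / 2))
      (fun z => deriv k ((r₀ z.1 - s₀ z.2) / 2) * (deriv r₀ z.1 / 2))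
      (fun z => deriv k ((r₀ z.1 - s₀ z.2) / 2) * (-deriv s₀ z.2 / 2)) (K * M) := by
  have hkc := hk.continuous
  have hkc' := hk.continuous_deriv
  have hrc := hr.continuous
  have hsc := hs.continuous
  have hrd : ∀ x, HasDerivAt r₀ (deriv r₀ x) x :=
    fun x => (hr.differentiable one_ne_zero x).hasDerivAt
  have hsd : ∀ x, HasDerivAt s₀ (deriv s₀ x) x :=
    fun x => (hs.differentiable one_ne_zero x).hasDerivAt
  have hhalf : ∀ {d : ℝ} (q : ℝ), |d| ≤ M → |deriv k q * (d / 2)| ≤ K * M := fun {d} q hd => by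
    rw [abs_mul, abs_div, abs_two]
    exact mul_le_mul (hk.deriv_le q) (by linarith [abs_nonneg d]) (by positivity) hk.nonneg
  exact
    { continuous := by fun_prop
      continuous_fst := by fun_prop
      continuous_snd := by fun_prop
      near_one := fun z => hk.near_one _
      abs_fst_le := fun z => hhalf _ (hrM z.1)
      abs_snd_le := fun z => hhalf _ ((abs_neg _).trans_le (hsM z.2))
      hasDerivAt_fst := fun z =>
        (hk.hasDerivAt _).comp z.1 (((hrd z.1).sub_const (s₀ z.2)).div_const 2)
      hasDerivAt_snd := fun z =>
        (hk.hasDerivAt _).comp z.2 (((hsd z.2).const_sub (r₀ z.1)).div_const 2) }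

lemma abs_div_two_mul_mul_le {D c y M : ℝ} (hD : |D| ≤ M) (hc : |c - 1| ≤ 1 / 100)
    (hy : |y - 1 / 2| ≤ 1 / 50) : |D / (2 * (c * y))| ≤ 2 * M := by
  have hM : 0 ≤ M := (abs_nonneg D).trans hD
  rw [abs_le] at hc hy
  have hlower : 1 / 2 ≤ 2 * (c * y) := by nlinarith
  rw [abs_div, abs_of_pos (by linarith : 0 < 2 * (c * y)), div_le_iff₀ (by linarith)]
  nlinarith

namespace IsCharLabelling

variable {C p q : ℝ × ℝ → ℝ} {T : ℝ} {w : ℝ × ℝ → ℝ × ℝ} {r₀ s₀ : ℝ → ℝ} {z : ℝ × ℝ}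

lemma abs_fst_le_of_mem_slab (hz : z ∈ slab T) : |z.1| ≤ T := by
  rw [abs_of_nonneg hz.1.1]
  exact hz.1.2.le

lemma continuousOn (hw : IsCharLabelling C T w p q) : ContinuousOn w (slab T) := fun z hz =>
  (hw.hasFDerivAt z (abs_fst_le_of_mem_slab hz)).continuousAt.continuousWithinAt

lemma fst_pos (hw : IsCharLabelling C T w p q) (z : ℝ × ℝ) : 0 < p z :=
  pos_of_near_half (hw.fst_near_half z)

lemma snd_pos (hw : IsCharLabelling C T w p q) (z : ℝ × ℝ) : 0 < q z :=
  pos_of_near_half (hw.snd_near_half z)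

lemma hasFDerivAt_left (hw : IsCharLabelling C T w p q) (hC : ∀ z, C z ≠ 0)
    (hr : Differentiable ℝ r₀) (hz : z ∈ slab T) :
    HasFDerivAt (fun z => r₀ (w z).1)
      (form (C (w z) * (deriv r₀ (w z).1 / (2 * (C (w z) * p (w z)))))
        (deriv r₀ (w z).1 / (2 * (C (w z) * p (w z))))) z := by
  have hcomp := (hr (w z).1).hasDerivAt.hasFDerivAt.comp z
    (hw.hasFDerivAt z (abs_fst_le_of_mem_slab hz)).fst
  have hCz := hC (w z)
  have hpz := (hw.fst_pos (w z)).ne'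
  refine hcomp.congr_fderiv ?_
  ext <;> simp <;> field_simp

lemma hasFDerivAt_right (hw : IsCharLabelling C T w p q) (hC : ∀ z, C z ≠ 0)
    (hs : Differentiable ℝ s₀) (hz : z ∈ slab T) :
    HasFDerivAt (fun z => s₀ (w z).2)
      (form (-(C (w z) * (deriv s₀ (w z).2 / (2 * (C (w z) * q (w z))))))
        (deriv s₀ (w z).2 / (2 * (C (w z) * q (w z))))) z := by
  have hcomp := (hs (w z).2).hasDerivAt.hasFDerivAt.comp z
    (hw.hasFDerivAt z (abs_fst_le_of_mem_slab hz)).snd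
  have hCz := hC (w z)
  have hqz := (hw.snd_pos (w z)).ne'
  refine hcomp.congr_fderiv ?_
  ext <;> simp <;> field_simp

lemma dx_left (hw : IsCharLabelling C T w p q) (hC : ∀ z, C z ≠ 0) (hr : Differentiable ℝ r₀)
    (hz : z ∈ slab T) : dx (fun t x => r₀ (w (t, x)).1) z.1 z.2 =
      deriv r₀ (w z).1 / (2 * (C (w z) * p (w z))) :=
  (hasDerivAt_of_hasFDerivWithinAt_slab (f := fun t x => r₀ (w (t, x)).1) hz.1
    (hw.hasFDerivAt_left hC hr hz).hasFDerivWithinAt).deriv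

lemma dx_right (hw : IsCharLabelling C T w p q) (hC : ∀ z, C z ≠ 0) (hs : Differentiable ℝ s₀)
    (hz : z ∈ slab T) : dx (fun t x => s₀ (w (t, x)).2) z.1 z.2 =
      deriv s₀ (w z).2 / (2 * (C (w z) * q (w z))) :=
  (hasDerivAt_of_hasFDerivWithinAt_slab (f := fun t x => s₀ (w (t, x)).2) hz.1
    (hw.hasFDerivAt_right hC hs hz).hasFDerivWithinAt).deriv

lemma isDiagSolution {k : ℝ → ℝ}
    (hw : IsCharLabelling (fun z => k ((r₀ z.1 - s₀ z.2) / 2)) T w p q) (hkc : Continuous k)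
    (hk : ∀ θ, k θ ≠ 0) (hr : ContDiff ℝ 1 r₀) (hs : ContDiff ℝ 1 s₀) :
    IsDiagSolution k T (fun t x => r₀ (w (t, x)).1) (fun t x => s₀ (w (t, x)).2) := by
  have hr' := hr.differentiable one_ne_zero
  have hs' := hs.differentiable one_ne_zero
  have hrc := hr.continuous
  have hsc := hs.continuous
  have hpc := hw.continuous_fst
  have hqc := hw.continuous_snd
  have hwc := hw.continuousOn
  refine ⟨fun t ht x => ?_, fun t ht x => ?_, ?_, ?_⟩
  · rw [hw.dx_left (fun _ => hk _) hr' (z := (t, x)) (mem_slab.2 ht)]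
    exact (hw.hasFDerivAt_left (fun _ => hk _) hr' (mem_slab.2 ht)).hasFDerivWithinAt
  · rw [hw.dx_right (fun _ => hk _) hs' (z := (t, x)) (mem_slab.2 ht)]
    exact (hw.hasFDerivAt_right (fun _ => hk _) hs' (mem_slab.2 ht)).hasFDerivWithinAt
  · refine ContinuousOn.congr ?_ fun z hz => hw.dx_left (fun _ => hk _) hr' hz
    exact ContinuousOn.div (by fun_prop) (by fun_prop) fun z _ =>
      mul_ne_zero two_ne_zero (mul_ne_zero (hk _) (hw.fst_pos _).ne')
  · refine ContinuousOn.congr ?_ fun z hz => hw.dx_right (fun _ => hk _) hs' hz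
    exact ContinuousOn.div (by fun_prop) (by fun_prop) fun z _ =>
      mul_ne_zero two_ne_zero (mul_ne_zero (hk _) (hw.snd_pos _).ne')

end IsCharLabelling

/-- The diagonal system has a solution on `[0, T) × ℝ` with bounded gradient and initial data
`r₀`, `s₀`. -/
def HasDiagSolution (k r₀ s₀ : ℝ → ℝ) (T : ℝ) : Prop :=
  ∃ r s, IsDiagSolution k T r s ∧ (∃ M, GradientBound T r s M) ∧ r 0 = r₀ ∧ s 0 = s₀

lemma IsSpeed.exists_uniform_hasDiagSolution {k : ℝ → ℝ} {K M : ℝ} (hk : IsSpeed k K)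
    (hM : 0 ≤ M) :
    ∃ T > 0, ∀ r₀ s₀ : ℝ → ℝ, ContDiff ℝ 1 r₀ → ContDiff ℝ 1 s₀ →
      (∀ x, |deriv r₀ x| ≤ M) → (∀ x, |deriv s₀ x| ≤ M) → HasDiagSolution k r₀ s₀ T := by
  have hKM : 0 ≤ K * M := mul_nonneg hk.nonneg hM
  refine ⟨1 / (200 * (K * M + 1)) / 16, by positivity, fun r₀ s₀ hr hs hrM hsM => ?_⟩
  have hC := hk.isLabelSpeed hr hs hrM hsM
  have hC₀ : ∀ z : ℝ × ℝ, k ((r₀ z.1 - s₀ z.2) / 2) ≠ 0 := fun z => (hk.pos _).ne'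
  have hr' := hr.differentiable one_ne_zero
  have hs' := hs.differentiable one_ne_zero
  obtain ⟨w, p, q, hw⟩ := hC.exists_isCharLabelling (h := 1 / (200 * (K * M + 1))) (by positivity)
    (by
      rw [mul_one_div, div_le_div_iff₀ (by positivity) (by norm_num)]
      linarith)
  refine ⟨_, _, hw.isDiagSolution hk.continuous (fun q => (hk.pos q).ne') hr hs,
    ⟨2 * M, fun t ht x => ⟨?_, ?_⟩⟩, funext fun x => ?_, funext fun x => ?_⟩
  · rw [hw.dx_left hC₀ hr' (z := (t, x)) (mem_slab.2 ht)]
    exact abs_div_two_mul_mul_le (hrM _) (hC.near_one _) (hw.fst_near_half _)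
  · rw [hw.dx_right hC₀ hs' (z := (t, x)) (mem_slab.2 ht)]
    exact abs_div_two_mul_mul_le (hsM _) (hC.near_one _) (hw.snd_near_half _)
  · rw [hw.initial]
  · rw [hw.initial]

/-! ### Gluing and continuation -/

/-- The diagonal system at the point `(t, x)`, relative to a set of points `A`. -/
structure IsDiagSolutionAt (k : ℝ → ℝ) (A : Set (ℝ × ℝ)) (r s : ℝ → ℝ → ℝ) (t x : ℝ) : Prop where
  left : HasFDerivWithinAt (fun z : ℝ × ℝ => r z.1 z.2)
    (form (k (strain r s t x) * dx r t x) (dx r t x)) A (t, x)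
  right : HasFDerivWithinAt (fun z : ℝ × ℝ => s z.1 z.2)
    (form (-(k (strain r s t x) * dx s t x)) (dx s t x)) A (t, x)
  continuousWithinAt_dx_left : ContinuousWithinAt (fun z : ℝ × ℝ => dx r z.1 z.2) A (t, x)
  continuousWithinAt_dx_right : ContinuousWithinAt (fun z : ℝ × ℝ => dx s z.1 z.2) A (t, x)

/-- The function equal to `f` before time `T`, and to `g` started at time `t₀` from then on. -/
noncomputable def concat (t₀ T : ℝ) (f g : ℝ → ℝ → ℝ) (t : ℝ) : ℝ → ℝ :=
  if t < T then f t else g (t - t₀)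

lemma slab_mem_nhdsWithin {T T' t x : ℝ} (h : t < T') : slab T' ∈ 𝓝[slab T] (t, x) := by
  filter_upwards [self_mem_nhdsWithin, mem_nhdsWithin_of_mem_nhds
    ((isOpen_lt continuous_fst continuous_const).mem_nhds h)] with z hz hzT'
  exact ⟨⟨hz.1.1, hzT'⟩, mem_univ _⟩

lemma dx_congr {f g : ℝ → ℝ → ℝ} {t t' : ℝ} (h : f t = g t') (x : ℝ) : dx f t x = dx g t' x := by
  simp only [dx, h]

section Concat

variable {t₀ t T : ℝ} {f g : ℝ → ℝ → ℝ}

lemma concat_of_lt (ht : t < T) : concat t₀ T f g t = f t := if_pos ht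

lemma concat_of_le (hfg : ∀ t ∈ Ico t₀ T, f t = g (t - t₀)) (ht : t₀ ≤ t) :
    concat t₀ T f g t = g (t - t₀) := by
  rcases lt_or_ge t T with htT | htT
  · rw [concat_of_lt htT, hfg t ⟨ht, htT⟩]
  · exact if_neg htT.not_gt

end Concat

lemma isDiagSolution_iff {k : ℝ → ℝ} {T : ℝ} {r s : ℝ → ℝ → ℝ} :
    IsDiagSolution k T r s ↔ ∀ t ∈ Ico 0 T, ∀ x, IsDiagSolutionAt k (slab T) r s t x :=
  ⟨fun h t ht x => ⟨h.left t ht x, h.right t ht x, h.continuousOn_dx_left _ (mem_slab.2 ht),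
    h.continuousOn_dx_right _ (mem_slab.2 ht)⟩,
  fun h => ⟨fun t ht x => (h t ht x).left, fun t ht x => (h t ht x).right,
    fun z hz => (h z.1 hz.1 z.2).continuousWithinAt_dx_left,
    fun z hz => (h z.1 hz.1 z.2).continuousWithinAt_dx_right⟩⟩

namespace IsDiagSolutionAt

variable {k : ℝ → ℝ} {A A' : Set (ℝ × ℝ)} {r s r' s' : ℝ → ℝ → ℝ} {t x : ℝ}

lemma congr (h : IsDiagSolutionAt k A' r' s' t x) (hA : A' ∈ 𝓝[A] (t, x)) (htA : (t, x) ∈ A)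
    (heq : ∀ᶠ z : ℝ × ℝ in 𝓝[A] (t, x), r z.1 = r' z.1 ∧ s z.1 = s' z.1) :
    IsDiagSolutionAt k A r s t x := by
  obtain ⟨hr, hs⟩ : r t = r' t ∧ s t = s' t := heq.self_of_nhdsWithin htA
  have hstrain : strain r s t x = strain r' s' t x := by rw [strain, strain, hr, hs]
  refine ⟨?_, ?_, ?_, ?_⟩
  · rw [hstrain, dx_congr hr]
    exact (h.left.mono_of_mem_nhdsWithin hA).congr_of_eventuallyEq
      (heq.mono fun z hz => congrFun hz.1 z.2) (congrFun hr x)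
  · rw [hstrain, dx_congr hs]
    exact (h.right.mono_of_mem_nhdsWithin hA).congr_of_eventuallyEq
      (heq.mono fun z hz => congrFun hz.2 z.2) (congrFun hs x)
  · exact (h.continuousWithinAt_dx_left.mono_of_mem_nhdsWithin hA).congr_of_eventuallyEq
      (heq.mono fun z hz => dx_congr hz.1 z.2) (dx_congr hr x)
  · exact (h.continuousWithinAt_dx_right.mono_of_mem_nhdsWithin hA).congr_of_eventuallyEq
      (heq.mono fun z hz => dx_congr hz.2 z.2) (dx_congr hs x)

lemma shift {a : ℝ} (h : IsDiagSolutionAt k A r s (t - a) x) :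
    IsDiagSolutionAt k ((fun z : ℝ × ℝ => (z.1 - a, z.2)) ⁻¹' A) (fun t => r (t - a))
      (fun t => s (t - a)) t x := by
  have htranslate : HasFDerivWithinAt (fun z : ℝ × ℝ => (z.1 - a, z.2))
      (ContinuousLinearMap.id ℝ (ℝ × ℝ)) ((fun z : ℝ × ℝ => (z.1 - a, z.2)) ⁻¹' A) (t, x) :=
    (((hasFDerivWithinAt_fst (𝕜 := ℝ) (E := ℝ) (F := ℝ)).sub_const a).prodMk
      hasFDerivWithinAt_snd).congr_fderiv (by ext <;> simp)
  have hmaps := mapsTo_preimage (fun z : ℝ × ℝ => (z.1 - a, z.2)) A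
  refine ⟨?_, ?_, ?_, ?_⟩
  · exact HasFDerivWithinAt.comp (g := fun z : ℝ × ℝ => r z.1 z.2) (t, x) h.left htranslate hmaps
  · exact HasFDerivWithinAt.comp (g := fun z : ℝ × ℝ => s z.1 z.2) (t, x) h.right htranslate hmaps
  · exact ContinuousWithinAt.comp (g := fun z : ℝ × ℝ => dx r z.1 z.2) (x := (t, x))
      h.continuousWithinAt_dx_left htranslate.continuousWithinAt hmaps
  · exact ContinuousWithinAt.comp (g := fun z : ℝ × ℝ => dx s z.1 z.2) (x := (t, x))
      h.continuousWithinAt_dx_right htranslate.continuousWithinAt hmaps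

end IsDiagSolutionAt

namespace IsDiagSolution

variable {k : ℝ → ℝ} {K T T' t₀ M : ℝ} {r s r' s' : ℝ → ℝ → ℝ}

lemma shift (h : IsDiagSolution k T r s) (ht₀ : 0 ≤ t₀) :
    IsDiagSolution k (T - t₀) (fun t => r (t + t₀)) (fun t => s (t + t₀)) := by
  refine isDiagSolution_iff.2 fun t ht x => ?_
  have hat := isDiagSolution_iff.1 h (t + t₀) ⟨by linarith [ht.1], by linarith [ht.2]⟩ x
  rw [← sub_neg_eq_add] at hat
  have hshift := hat.shift
  simp only [sub_neg_eq_add] at hshift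
  exact hshift.congr
    (mem_of_superset self_mem_nhdsWithin fun z hz =>
      ⟨⟨by linarith [hz.1.1], by linarith [hz.1.2]⟩, mem_univ _⟩)
    (mem_slab.2 ht) (Eventually.of_forall fun _ => ⟨rfl, rfl⟩)

lemma contDiff_left (h : IsDiagSolution k T r s) (ht₀ : t₀ ∈ Ico 0 T) : ContDiff ℝ 1 (r t₀) := by
  have hderiv := h.hasDerivAt_left ht₀
  refine contDiff_one_iff_deriv.2 ⟨fun x => (hderiv x).differentiableAt, ?_⟩
  exact h.continuousOn_dx_left.comp_continuous (f := fun x => (t₀, x)) (by fun_prop)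
    fun _ => mem_slab.2 ht₀

lemma contDiff_right (h : IsDiagSolution k T r s) (ht₀ : t₀ ∈ Ico 0 T) : ContDiff ℝ 1 (s t₀) := by
  have hderiv := h.hasDerivAt_right ht₀
  refine contDiff_one_iff_deriv.2 ⟨fun x => (hderiv x).differentiableAt, ?_⟩
  exact h.continuousOn_dx_right.comp_continuous (f := fun x => (t₀, x)) (by fun_prop)
    fun _ => mem_slab.2 ht₀

lemma concat (h : IsDiagSolution k T r s) (h' : IsDiagSolution k T' r' s') (ht₀ : t₀ < T)
    (hr : ∀ t ∈ Ico t₀ T, r t = r' (t - t₀)) (hs : ∀ t ∈ Ico t₀ T, s t = s' (t - t₀)) :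
    IsDiagSolution k (t₀ + T') (concat t₀ T r r') (concat t₀ T s s') := by
  refine isDiagSolution_iff.2 fun t ht x => ?_
  rcases lt_or_ge t T with htT | htT
  · refine (isDiagSolution_iff.1 h t ⟨ht.1, htT⟩ x).congr (slab_mem_nhdsWithin htT)
      (mem_slab.2 ht) ?_
    filter_upwards [slab_mem_nhdsWithin htT] with z hz
    exact ⟨concat_of_lt hz.1.2, concat_of_lt hz.1.2⟩
  · have ht₀t := ht₀.trans_le htT
    have hat := isDiagSolution_iff.1 h' (t - t₀) ⟨by linarith, by linarith [ht.2]⟩ x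
    have hlater : ∀ᶠ z : ℝ × ℝ in 𝓝[slab (t₀ + T')] (t, x), t₀ < z.1 :=
      mem_nhdsWithin_of_mem_nhds ((isOpen_lt continuous_const continuous_fst).mem_nhds ht₀t)
    refine hat.shift.congr ?_ (mem_slab.2 ht) ?_
    · filter_upwards [hlater, self_mem_nhdsWithin] with z hz hzT'
      exact mem_slab.2 ⟨sub_nonneg.2 hz.le, sub_lt_iff_lt_add'.2 hzT'.1.2⟩
    · filter_upwards [hlater] with z hz
      exact ⟨concat_of_le hr hz.le, concat_of_le hs hz.le⟩

end IsDiagSolution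

lemma GradientBound.concat {T T' t₀ M M' : ℝ} {r s r' s' : ℝ → ℝ → ℝ}
    (hM : GradientBound T r s M) (hM' : GradientBound T' r' s' M') (ht₀ : t₀ < T)
    (hr : ∀ t ∈ Ico t₀ T, r t = r' (t - t₀)) (hs : ∀ t ∈ Ico t₀ T, s t = s' (t - t₀)) :
    GradientBound (t₀ + T') (concat t₀ T r r') (concat t₀ T s s') (max M M') := fun t ht x => by
  rcases lt_or_ge t T with htT | htT
  · rw [dx_congr (concat_of_lt htT), dx_congr (concat_of_lt htT)]
    exact hM.mono le_rfl (le_max_left _ _) t ⟨ht.1, htT⟩ x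
  · have ht₀t := (ht₀.trans_le htT).le
    rw [dx_congr (concat_of_le hr ht₀t), dx_congr (concat_of_le hs ht₀t)]
    exact hM'.mono le_rfl (le_max_right _ _) (t - t₀) ⟨by linarith, by linarith [ht.2]⟩ x

section Continuation

variable {k r₀ s₀ : ℝ → ℝ} {K N T : ℝ}

lemma exists_isDiagSolution_of_forall_lt (hk : IsSpeed k K) (hrN : ∀ x, |r₀ x| ≤ N)
    (hsN : ∀ x, |s₀ x| ≤ N) (hT : 0 < T) (h : ∀ T' < T, 0 < T' → HasDiagSolution k r₀ s₀ T') :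
    ∃ r s, IsDiagSolution k T r s ∧ (∀ T' < T, ∃ M, GradientBound T' r s M) ∧
      r 0 = r₀ ∧ s 0 = s₀ := by
  choose! R S hRS hM hR₀ hS₀ using h
  have hmid : ∀ {t}, t < T → t < (t + T) / 2 ∧ (t + T) / 2 < T := fun ht => by
    constructor <;> linarith
  have hagree : ∀ τ < T, ∀ t ∈ Ico 0 τ, R ((t + T) / 2) t = R τ t ∧ S ((t + T) / 2) t = S τ t := by
    intro τ hτ t ht
    obtain ⟨htσ, hσ⟩ := hmid (ht.2.trans hτ)
    have hτ₀ := ht.1.trans_lt ht.2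
    have hσ₀ := ht.1.trans_lt htσ
    obtain ⟨M, hMσ⟩ := hM _ hσ hσ₀
    obtain ⟨M', hMτ⟩ := hM τ hτ hτ₀
    exact ((hRS _ hσ hσ₀).mono (min_le_left _ τ)).eq_of_initial_eq
      ((hRS τ hτ hτ₀).mono (min_le_right _ τ)) hk ⟨M, hMσ.mono (min_le_left _ _) le_rfl⟩
      ⟨M', hMτ.mono (min_le_right _ _) le_rfl⟩ (by rw [hR₀ _ hσ hσ₀, hR₀ τ hτ hτ₀])
      (by rw [hS₀ _ hσ hσ₀, hS₀ τ hτ hτ₀]) (by rwa [hR₀ _ hσ hσ₀]) (by rwa [hS₀ _ hσ hσ₀])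
      ⟨ht.1, lt_min htσ ht.2⟩
  have hmid₀ := hmid hT
  have hpos : 0 < (0 + T) / 2 := hmid₀.1
  refine ⟨fun t => R ((t + T) / 2) t, fun t => S ((t + T) / 2) t,
    isDiagSolution_iff.2 fun t ht x => ?_, fun T' hT' => ?_,
    hR₀ _ hmid₀.2 hpos, hS₀ _ hmid₀.2 hpos⟩
  · obtain ⟨htσ, hσ⟩ := hmid ht.2
    refine (isDiagSolution_iff.1 (hRS _ hσ (ht.1.trans_lt htσ)) t ⟨ht.1, htσ⟩ x).congr
      (slab_mem_nhdsWithin htσ) (mem_slab.2 ht) ?_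
    filter_upwards [slab_mem_nhdsWithin htσ] with z hz
    exact hagree _ hσ z.1 hz.1
  · rcases le_or_gt T' 0 with hT'₀ | hT'₀
    · exact ⟨0, fun t ht => absurd (ht.1.trans_lt ht.2) hT'₀.not_gt⟩
    · obtain ⟨M, hMT'⟩ := hM T' hT' hT'₀
      refine ⟨M, fun t ht x => ?_⟩
      obtain ⟨hR, hS⟩ := hagree T' hT' t ht
      rw [dx_congr (f := fun t => R ((t + T) / 2) t) hR,
        dx_congr (f := fun t => S ((t + T) / 2) t) hS]
      exact hMT' t ht x

lemma HasDiagSolution.exists_gt (h : HasDiagSolution k r₀ s₀ T) (hk : IsSpeed k K)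
    (hrN : ∀ x, |r₀ x| ≤ N) (hsN : ∀ x, |s₀ x| ≤ N) (hT : 0 < T) :
    ∃ T' > T, HasDiagSolution k r₀ s₀ T' := by
  obtain ⟨r, s, h, ⟨M, hM⟩, rfl, rfl⟩ := h
  obtain ⟨τ, hτ, hlocal⟩ := hk.exists_uniform_hasDiagSolution
    ((abs_nonneg _).trans (hM 0 ⟨le_rfl, hT⟩ 0).1)
  obtain ⟨t₀, ht₀, hTτ⟩ : ∃ t₀ ∈ Ico 0 T, T < t₀ + τ := by
    refine ⟨max 0 (T - τ / 2), ⟨le_max_left _ _, max_lt hT (by linarith)⟩, ?_⟩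
    linarith [le_max_right 0 (T - τ / 2)]
  obtain ⟨r', s', h', ⟨M', hM'⟩, hr', hs'⟩ := hlocal (r t₀) (s t₀) (h.contDiff_left ht₀)
    (h.contDiff_right ht₀) (fun x => (hM t₀ ht₀ x).1) (fun x => (hM t₀ ht₀ x).2)
  have hagree : ∀ t ∈ Ico t₀ T, r t = r' (t - t₀) ∧ s t = s' (t - t₀) := fun t ht => by
    have heq := (h.shift ht₀.1).eq_of_initial_eq (h'.mono (by linarith : T - t₀ ≤ τ)) hk (N := N)
      ⟨M, fun t ht x => hM (t + t₀) ⟨by linarith [ht.1, ht₀.1], by linarith [ht.2]⟩ x⟩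
      ⟨M', hM'.mono (by linarith) le_rfl⟩
      (by rw [zero_add, hr']) (by rw [zero_add, hs'])
      (by rw [zero_add]; exact h.abs_left_le hk hM hrN ht₀)
      (by rw [zero_add]; exact h.abs_right_le hk hM hsN ht₀)
      (t := t - t₀) ⟨by linarith [ht.1], by linarith [ht.2]⟩
    simpa only [sub_add_cancel] using heq
  have hr := fun t ht => (hagree t ht).1
  have hs := fun t ht => (hagree t ht).2
  exact ⟨t₀ + τ, hTτ, concat t₀ T r r', concat t₀ T s s', h.concat h' ht₀.2 hr hs,
    ⟨max M M', hM.concat hM' ht₀.2 hr hs⟩, concat_of_lt hT, concat_of_lt hT⟩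

end Continuation

/-! ### Truncation of the wave speed -/

lemma exists_contDiff_cutoff {ρ : ℝ} (hρ : 0 < ρ) :
    ∃ χ : ℝ → ℝ, ContDiff ℝ 1 χ ∧ HasCompactSupport χ ∧ (∀ θ, |χ θ| < ρ) ∧
      ∀ θ, |θ| < ρ / 2 → χ θ = θ := by
  let b : ContDiffBump (0 : ℝ) := ⟨ρ / 2, ρ, by positivity, by linarith⟩
  refine ⟨fun θ => b θ * θ, b.contDiff.mul contDiff_id, b.hasCompactSupport.mul_right,
    fun θ => ?_, fun θ hθ => ?_⟩
  · rw [abs_mul, abs_of_nonneg b.nonneg]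
    rcases lt_or_ge |θ| ρ with hθ | hθ
    · exact (mul_le_of_le_one_left (abs_nonneg θ) b.le_one).trans_lt hθ
    · rwa [b.zero_of_le_dist (by rwa [Real.dist_eq, sub_zero]), zero_mul]
  · simp only [b.one_of_mem_closedBall (mem_closedBall_zero_iff.2 hθ.le), one_mul]

lemma exists_isSpeed_eventuallyEq {U : Set ℝ} (hU : IsOpen U) (h0U : (0 : ℝ) ∈ U) {c : ℝ → ℝ}
    (hc0 : c 0 = 1) (hc : ContDiffOn ℝ 1 c U) :
    ∃ δ > 0, ∃ a K, IsSpeed a K ∧ ∀ θ, |θ| ≤ δ → θ ∈ U ∧ a =ᶠ[𝓝 θ] c := by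
  have hcont : ContinuousAt c 0 := hc.continuousOn.continuousAt (hU.mem_nhds h0U)
  have hnear : ∀ᶠ θ in 𝓝 (0 : ℝ), θ ∈ U ∧ |c θ - 1| < 1 / 100 :=
    Eventually.and (hU.mem_nhds h0U)
      ((hcont.sub_const 1).abs.eventually_lt_const (by rw [hc0]; norm_num))
  obtain ⟨ρ, hρ, hball⟩ := Metric.eventually_nhds_iff.1 hnear
  obtain ⟨χ, hχ, hsupp, hχρ, hχid⟩ := exists_contDiff_cutoff hρ
  have hχU : ∀ θ, χ θ ∈ U ∧ |c (χ θ) - 1| < 1 / 100 := fun θ =>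
    hball (by rw [Real.dist_eq, sub_zero]; exact hχρ θ)
  have ha : ContDiff ℝ 1 (c ∘ χ) :=
    contDiffOn_univ.1 (hc.comp hχ.contDiffOn fun θ _ => (hχU θ).1)
  have hasupp : HasCompactSupport fun θ => (c ∘ χ) θ - 1 :=
    hsupp.comp_left (g := fun y => c y - 1) (by rw [hc0, sub_self])
  obtain ⟨K, hK⟩ := hasupp.deriv.exists_bound_of_continuous
    ((ha.sub contDiff_const).continuous_deriv le_rfl)
  simp only [deriv_sub_const, Real.norm_eq_abs] at hK
  refine ⟨ρ / 4, by positivity, c ∘ χ, K, ⟨ha, fun θ => (hχU θ).2.le, hK⟩, fun θ hθ => ?_⟩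
  have hθρ : |θ| < ρ / 2 := by linarith
  refine ⟨hχid θ hθρ ▸ (hχU θ).1, ?_⟩
  filter_upwards [continuous_abs.continuousAt.eventually_lt_const hθρ] with y hy
  rw [Function.comp, hχid y hy]

lemma exists_inverse_of_le_deriv {L a : ℝ → ℝ} {m : ℝ} (hL : ∀ w, HasDerivAt L (a w) w)
    (hm : 0 < m) (ha : ∀ w, m ≤ a w) :
    ∃ G : ℝ → ℝ, (∀ w, G (L w) = w) ∧ (∀ q, L (G q) = q) ∧
      ∀ q, HasDerivAt G (a (G q))⁻¹ q := by
  have hmono : StrictMono L := strictMono_of_deriv_pos fun w => by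
    rw [(hL w).deriv]; exact hm.trans_le (ha w)
  have hgrowth : Monotone fun w => L w - m * w := by
    have hderiv : ∀ w, HasDerivAt (fun w => L w - m * w) (a w - m * 1) w :=
      fun w => (hL w).sub ((hasDerivAt_id w).const_mul m)
    refine monotone_of_deriv_nonneg (fun w => (hderiv w).differentiableAt) fun w => ?_
    rw [(hderiv w).deriv, mul_one]
    exact sub_nonneg.2 (ha w)
  have hsurj : Function.Surjective L := by
    refine Continuous.surjective (continuous_iff_continuousAt.2 fun w => (hL w).continuousAt) ?_ ?_
    · refine tendsto_atTop_mono' _ ?_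
        (tendsto_atTop_add_const_right _ (L 0) (tendsto_id.const_mul_atTop hm))
      filter_upwards [eventually_ge_atTop 0] with w hw
      have hle : L _ - m * _ ≤ L _ - m * _ := hgrowth hw
      simp only [id]
      linarith
    · refine tendsto_atBot_mono' _ ?_
        (tendsto_atBot_add_const_right _ (L 0) (tendsto_id.const_mul_atBot hm))
      filter_upwards [eventually_le_atBot 0] with w hw
      have hle : L _ - m * _ ≤ L _ - m * _ := hgrowth hw
      simp only [id]
      linarith
  let e := hmono.orderIsoOfSurjective L hsurj
  exact ⟨e.symm, e.symm_apply_apply, e.apply_symm_apply, fun q =>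
    HasDerivAt.of_local_left_inverse e.symm.continuous.continuousAt (hL _)
      (hm.trans_le (ha _)).ne' (Eventually.of_forall e.apply_symm_apply)⟩

/-- `a` is an admissible speed on the line that agrees with the wave speed `c` near every point of
`[-δ, δ]`, `L` its primitive vanishing at `0`, and `G` the inverse function of `L`. -/
structure SpeedExtension (U : Set ℝ) (c : ℝ → ℝ) (δ : ℝ) (a : ℝ → ℝ) (K : ℝ) (L G : ℝ → ℝ) :
    Prop where
  pos : 0 < δ
  subset : ∀ θ, |θ| ≤ δ → θ ∈ U
  eventuallyEq : ∀ θ, |θ| ≤ δ → a =ᶠ[𝓝 θ] c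
  isSpeed : IsSpeed a K
  hasDerivAt : ∀ w, HasDerivAt L (a w) w
  map_zero : L 0 = 0
  left_inv : ∀ w, G (L w) = w
  right_inv : ∀ q, L (G q) = q
  hasDerivAt_inv : ∀ q, HasDerivAt G (a (G q))⁻¹ q

lemma exists_speedExtension {U : Set ℝ} (hU : IsOpen U) (h0U : (0 : ℝ) ∈ U) {c : ℝ → ℝ}
    (hc0 : c 0 = 1) (hc : ContDiffOn ℝ 1 c U) :
    ∃ δ a K L G, SpeedExtension U c δ a K L G := by
  obtain ⟨δ, hδ, a, K, ha, heq⟩ := exists_isSpeed_eventuallyEq hU h0U hc0 hc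
  have hL : ∀ w, HasDerivAt (fun w => ∫ θ in (0 : ℝ)..w, a θ) (a w) w := fun w =>
    (ha.continuous.integral_hasStrictDerivAt 0 w).hasDerivAt
  obtain ⟨G, hleft, hright, hG⟩ := exists_inverse_of_le_deriv hL (by norm_num) ha.lower
  exact ⟨δ, a, K, _, G, hδ, fun θ hθ => (heq θ hθ).1, fun θ hθ => (heq θ hθ).2, ha, hL,
    intervalIntegral.integral_same, hleft, hright, hG⟩

namespace SpeedExtension

variable {U : Set ℝ} {c : ℝ → ℝ} {δ δ' : ℝ} {a L G : ℝ → ℝ} {K : ℝ}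

lemma mono (h : SpeedExtension U c δ a K L G) (hδ' : 0 < δ') (hδ : δ' ≤ δ) :
    SpeedExtension U c δ' a K L G :=
  { h with
    pos := hδ'
    subset := fun θ hθ => h.subset θ (hθ.trans hδ)
    eventuallyEq := fun θ hθ => h.eventuallyEq θ (hθ.trans hδ) }

lemma eq_of_abs_le (h : SpeedExtension U c δ a K L G) {θ : ℝ} (hθ : |θ| ≤ δ) : a θ = c θ :=
  (h.eventuallyEq θ hθ).eq_of_nhds

lemma hasDerivAt_speed (h : SpeedExtension U c δ a K L G) (q : ℝ) :
    HasDerivAt (a ∘ G) (deriv a (G q) / a (G q)) q :=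
  (h.isSpeed.hasDerivAt (G q)).comp q (h.hasDerivAt_inv q)

lemma isSpeed_comp (h : SpeedExtension U c δ a K L G) : IsSpeed (a ∘ G) (2 * K) := by
  have ha := h.isSpeed
  have hG : Continuous G :=
    continuous_iff_continuousAt.2 fun q => (h.hasDerivAt_inv q).continuousAt
  refine ⟨contDiff_one_iff_deriv.2 ⟨fun q => (h.hasDerivAt_speed q).differentiableAt, ?_⟩,
    fun q => ha.near_one _, fun q => ?_⟩
  · rw [funext fun q => (h.hasDerivAt_speed q).deriv]
    exact (ha.continuous_deriv.comp hG).div (ha.continuous.comp hG) fun q => (ha.pos _).ne'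
  · rw [(h.hasDerivAt_speed q).deriv, abs_div, abs_of_pos (ha.pos _), div_le_iff₀ (ha.pos _)]
    have hone : 1 ≤ 2 * a (G q) := by linarith [ha.lower (G q)]
    calc |deriv a (G q)| ≤ K := ha.deriv_le _
      _ ≤ K * (2 * a (G q)) := le_mul_of_one_le_right ha.nonneg hone
      _ = 2 * K * a (G q) := by ring

lemma contDiff_map (h : SpeedExtension U c δ a K L G) : ContDiff ℝ 1 L :=
  contDiff_one_iff_deriv.2 ⟨fun w => (h.hasDerivAt w).differentiableAt, by
    rw [funext fun w => (h.hasDerivAt w).deriv]; exact h.isSpeed.continuous⟩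

lemma abs_map_sub_le (h : SpeedExtension U c δ a K L G) (w : ℝ) : |L w - w| ≤ 1 / 100 * |w| := by
  simpa only [h.map_zero, sub_zero, Real.norm_eq_abs] using
    convex_univ.norm_image_sub_le_of_norm_hasDerivWithin_le (f := fun w => L w - w)
      (fun x _ => ((h.hasDerivAt x).sub (hasDerivAt_id x)).hasDerivWithinAt)
      (fun x _ => h.isSpeed.near_one x) (mem_univ 0) (mem_univ w)

lemma abs_map_le (h : SpeedExtension U c δ a K L G) (w : ℝ) : |L w| ≤ 101 / 100 * |w| := by
  linarith [h.abs_map_sub_le w, abs_sub_abs_le_abs_sub (L w) w]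

lemma abs_inv_le (h : SpeedExtension U c δ a K L G) (q : ℝ) : |G q| ≤ 100 / 99 * |q| := by
  have hsub := h.abs_map_sub_le (G q)
  rw [h.right_inv, abs_sub_comm] at hsub
  linarith [abs_sub_abs_le_abs_sub (G q) q]

end SpeedExtension

/-! ### Partial derivatives on slabs -/

/-- The function `f` is differentiable on `[0, T) × ℝ`, up to the boundary `t = 0`, with partial
derivatives `ft` in time and `fx` in space. -/
def HasPartials (T : ℝ) (f ft fx : ℝ → ℝ → ℝ) : Prop :=
  ∀ t ∈ Ico 0 T, ∀ x,
    HasFDerivWithinAt (fun z : ℝ × ℝ => f z.1 z.2) (form (ft t x) (fx t x)) (slab T) (t, x)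

lemma uniqueDiffOn_slab (T : ℝ) : UniqueDiffOn ℝ (slab T) :=
  (uniqueDiffOn_Ico 0 T).prod uniqueDiffOn_univ

lemma slab_subset_closure_interior (T : ℝ) : slab T ⊆ closure (interior (slab T)) := by
  intro z hz
  rw [slab, interior_prod_eq, interior_univ, interior_Ico, closure_prod_eq, closure_univ,
    closure_Ioo (hz.1.1.trans_lt hz.1.2).ne]
  exact ⟨Ico_subset_Icc_self hz.1, mem_univ _⟩

lemma eq_form (A : ℝ × ℝ →L[ℝ] ℝ) : A = form (A (1, 0)) (A (0, 1)) := by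
  ext <;> simp

section

variable {f : ℝ → ℝ → ℝ} {T t x : ℝ} {A : ℝ × ℝ →L[ℝ] ℝ}

lemma dt_eq_of_hasFDerivWithinAt_slab (ht : t ∈ Ico 0 T)
    (h : HasFDerivWithinAt (fun z : ℝ × ℝ => f z.1 z.2) A (slab T) (t, x)) :
    dt f t x = A (1, 0) := by
  have hslice : HasDerivWithinAt (fun s : ℝ => (s, x)) ((1 : ℝ), (0 : ℝ)) (Ico 0 T) t :=
    (hasDerivWithinAt_id t _).prodMk (hasDerivWithinAt_const t _ x)
  have hIco : Ico 0 T ∈ 𝓝[Ici 0] t := by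
    rw [← Ici_inter_Iio]
    exact inter_mem self_mem_nhdsWithin (mem_nhdsWithin_of_mem_nhds (Iio_mem_nhds ht.2))
  exact ((HasFDerivWithinAt.comp_hasDerivWithinAt t h hslice fun _ hs => mem_slab.2 hs)
    |>.mono_of_mem_nhdsWithin hIco).derivWithin (uniqueDiffOn_Ici 0 t ht.1)

lemma dx_eq_of_hasFDerivWithinAt_slab (ht : t ∈ Ico 0 T)
    (h : HasFDerivWithinAt (fun z : ℝ × ℝ => f z.1 z.2) A (slab T) (t, x)) :
    dx f t x = A (0, 1) := by
  rw [eq_form A] at h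
  exact (hasDerivAt_of_hasFDerivWithinAt_slab ht h).deriv

end

namespace HasPartials

variable {T : ℝ} {f ft fx g gt gx : ℝ → ℝ → ℝ}

lemma dt_eq (h : HasPartials T f ft fx) {t : ℝ} (ht : t ∈ Ico 0 T) (x : ℝ) :
    dt f t x = ft t x := by
  simp [dt_eq_of_hasFDerivWithinAt_slab ht (h t ht x)]

lemma hasDerivAt (h : HasPartials T f ft fx) {t : ℝ} (ht : t ∈ Ico 0 T) (x : ℝ) :
    HasDerivAt (f t) (fx t x) x :=
  hasDerivAt_of_hasFDerivWithinAt_slab ht (h t ht x)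

lemma dx_eq (h : HasPartials T f ft fx) {t : ℝ} (ht : t ∈ Ico 0 T) (x : ℝ) :
    dx f t x = fx t x :=
  (h.hasDerivAt ht x).deriv

lemma continuousOn (h : HasPartials T f ft fx) :
    ContinuousOn (fun z : ℝ × ℝ => f z.1 z.2) (slab T) :=
  fun z hz => (h z.1 hz.1 z.2).continuousWithinAt

lemma hasDerivWithinAt_time (h : HasPartials T f ft fx) {t t₁ : ℝ} (ht₁ : t₁ < T)
    (ht : t ∈ Icc 0 t₁) (x : ℝ) :
    HasDerivWithinAt (fun τ => f τ x) (ft t x) (Icc 0 t₁) t := by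
  simpa using hasDerivWithinAt_along_of_hasFDerivWithinAt_slab ht₁
    (h t (mem_Ico_of_mem_Icc ht₁ ht) x) (hasDerivWithinAt_const t (Icc 0 t₁) x)

lemma congr (h : HasPartials T f ft fx) (hg : ∀ t ∈ Ico 0 T, ∀ x, g t x = f t x)
    (hgt : ∀ t ∈ Ico 0 T, ∀ x, gt t x = ft t x) (hgx : ∀ t ∈ Ico 0 T, ∀ x, gx t x = fx t x) :
    HasPartials T g gt gx := fun t ht x => by
  rw [hgt t ht, hgx t ht]
  exact (h t ht x).congr (fun z hz => hg z.1 hz.1 z.2) (hg t ht x)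

lemma add (hf : HasPartials T f ft fx) (hg : HasPartials T g gt gx) :
    HasPartials T (fun t x => f t x + g t x) (fun t x => ft t x + gt t x)
      (fun t x => fx t x + gx t x) := fun t ht x =>
  ((hf t ht x).add (hg t ht x)).congr_fderiv (by ext <;> simp)

lemma sub (hf : HasPartials T f ft fx) (hg : HasPartials T g gt gx) :
    HasPartials T (fun t x => f t x - g t x) (fun t x => ft t x - gt t x)
      (fun t x => fx t x - gx t x) := fun t ht x =>
  ((hf t ht x).sub (hg t ht x)).congr_fderiv (by ext <;> simp)

lemma comp {L L' : ℝ → ℝ} (hf : HasPartials T f ft fx)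
    (hL : ∀ t ∈ Ico 0 T, ∀ x, HasDerivAt L (L' (f t x)) (f t x)) :
    HasPartials T (fun t x => L (f t x)) (fun t x => L' (f t x) * ft t x)
      (fun t x => L' (f t x) * fx t x) := fun t ht x =>
  ((hL t ht x).comp_hasFDerivWithinAt (t, x) (hf t ht x)).congr_fderiv (by ext <;> simp)

lemma contDiffOn_succ {n : ℕ} (h : HasPartials T f ft fx)
    (hft : ContDiffOn ℝ n (fun z : ℝ × ℝ => ft z.1 z.2) (slab T))
    (hfx : ContDiffOn ℝ n (fun z : ℝ × ℝ => fx z.1 z.2) (slab T)) :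
    ContDiffOn ℝ (n + 1) (fun z : ℝ × ℝ => f z.1 z.2) (slab T) := by
  rw [contDiffOn_succ_iff_fderivWithin (uniqueDiffOn_slab T)]
  refine ⟨fun z hz => (h z.1 hz.1 z.2).differentiableWithinAt, by simp, ?_⟩
  have hform : ContDiffOn ℝ n (fun z : ℝ × ℝ => form (ft z.1 z.2) (fx z.1 z.2)) (slab T) :=
    (hft.smul contDiffOn_const).add (hfx.smul contDiffOn_const)
  exact hform.congr fun z hz => (h z.1 hz.1 z.2).fderivWithin (uniqueDiffOn_slab T z hz)

lemma add_integral_eq (h : HasPartials T f ft fx)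
    (hft : ContinuousOn (fun z : ℝ × ℝ => ft z.1 z.2) (slab T)) {t : ℝ} (ht : t ∈ Ico 0 T)
    (x : ℝ) : f 0 x + ∫ τ in (0 : ℝ)..t, ft τ x = f t x := by
  have hcont : ContinuousOn (fun τ => ft τ x) (uIcc 0 t) := by
    rw [uIcc_of_le ht.1]
    exact hft.comp (f := fun τ : ℝ => (τ, x)) (by fun_prop)
      fun τ hτ => mem_slab.2 (mem_Ico_of_mem_Icc ht.2 hτ)
  have hderiv : ∀ τ ∈ Icc 0 t, HasDerivWithinAt (fun τ => f τ x) (ft τ x) (Icc 0 t) τ :=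
    fun τ hτ => h.hasDerivWithinAt_time ht.2 hτ x
  rw [intervalIntegral.integral_eq_sub_of_hasDerivAt_of_le ht.1
    (fun τ hτ => (hderiv τ hτ).continuousWithinAt)
    (fun τ hτ => (hderiv τ (Ioo_subset_Icc_self hτ)).hasDerivAt (Icc_mem_nhds hτ.1 hτ.2))
    hcont.intervalIntegrable]
  ring

end HasPartials

section

variable {T : ℝ} {f : ℝ → ℝ → ℝ}

lemma hasPartials_of_contDiffOn (h : ContDiffOn ℝ 1 (fun z : ℝ × ℝ => f z.1 z.2) (slab T)) :
    HasPartials T f (dt f) (dx f) := fun t ht x => by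
  have hderiv := (h.differentiableOn one_ne_zero (t, x) (mem_slab.2 ht)).hasFDerivWithinAt
  rw [dt_eq_of_hasFDerivWithinAt_slab ht hderiv, dx_eq_of_hasFDerivWithinAt_slab ht hderiv,
    ← eq_form]
  exact hderiv

lemma fderivWithin_slab_eq_form {n : WithTop ℕ∞} {z : ℝ × ℝ}
    (h : ContDiffOn ℝ (n + 1) (fun z : ℝ × ℝ => f z.1 z.2) (slab T)) (hz : z ∈ slab T) :
    fderivWithin ℝ (fun z : ℝ × ℝ => f z.1 z.2) (slab T) z = form (dt f z.1 z.2) (dx f z.1 z.2) :=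
  (hasPartials_of_contDiffOn (h.of_le le_add_self) z.1 hz.1 z.2).fderivWithin
    (uniqueDiffOn_slab T z hz)

lemma contDiffOn_dt {n : WithTop ℕ∞}
    (h : ContDiffOn ℝ (n + 1) (fun z : ℝ × ℝ => f z.1 z.2) (slab T)) :
    ContDiffOn ℝ n (fun z : ℝ × ℝ => dt f z.1 z.2) (slab T) :=
  ((h.fderivWithin (uniqueDiffOn_slab T) le_rfl).clm_apply
    (contDiffOn_const (c := ((1 : ℝ), (0 : ℝ))))).congr fun z hz => by
      simp [fderivWithin_slab_eq_form h hz]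

lemma contDiffOn_dx {n : WithTop ℕ∞}
    (h : ContDiffOn ℝ (n + 1) (fun z : ℝ × ℝ => f z.1 z.2) (slab T)) :
    ContDiffOn ℝ n (fun z : ℝ × ℝ => dx f z.1 z.2) (slab T) :=
  ((h.fderivWithin (uniqueDiffOn_slab T) le_rfl).clm_apply
    (contDiffOn_const (c := ((0 : ℝ), (1 : ℝ))))).congr fun z hz => by
      simp [fderivWithin_slab_eq_form h hz]

lemma dt_dx_comm (h : ContDiffOn ℝ 2 (fun z : ℝ × ℝ => f z.1 z.2) (slab T)) {t : ℝ}
    (ht : t ∈ Ico 0 T) (x : ℝ) : dt (dx f) t x = dx (dt f) t x := by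
  have htx : (t, x) ∈ slab T := mem_slab.2 ht
  rw [← one_add_one_eq_two] at h
  set F' := fderivWithin ℝ (fun z : ℝ × ℝ => f z.1 z.2) (slab T) with hF'
  have hderiv : HasFDerivWithinAt F' (fderivWithin ℝ F' (slab T) (t, x)) (slab T) (t, x) :=
    ((h.fderivWithin (uniqueDiffOn_slab T) le_rfl).differentiableOn one_ne_zero _ htx)
      |>.hasFDerivWithinAt
  have hdt : HasFDerivWithinAt (fun z : ℝ × ℝ => dt f z.1 z.2)
      ((fderivWithin ℝ F' (slab T) (t, x)).flip (1, 0)) (slab T) (t, x) :=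
    (hderiv.clm_apply (hasFDerivWithinAt_const ((1 : ℝ), (0 : ℝ)) _ _)).congr_fderiv
      (by ext <;> simp) |>.congr (fun z hz => by simp [hF', fderivWithin_slab_eq_form h hz])
      (by simp [hF', fderivWithin_slab_eq_form h htx])
  have hdx : HasFDerivWithinAt (fun z : ℝ × ℝ => dx f z.1 z.2)
      ((fderivWithin ℝ F' (slab T) (t, x)).flip (0, 1)) (slab T) (t, x) :=
    (hderiv.clm_apply (hasFDerivWithinAt_const ((0 : ℝ), (1 : ℝ)) _ _)).congr_fderiv
      (by ext <;> simp) |>.congr (fun z hz => by simp [hF', fderivWithin_slab_eq_form h hz])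
      (by simp [hF', fderivWithin_slab_eq_form h htx])
  rw [dt_eq_of_hasFDerivWithinAt_slab ht hdx, dx_eq_of_hasFDerivWithinAt_slab ht hdt]
  exact ContDiffWithinAt.isSymmSndFDerivWithinAt (h _ htx) (by simp [one_add_one_eq_two])
    (uniqueDiffOn_slab T) (slab_subset_closure_interior T htx) htx _ _

end

section

variable {v vx : ℝ → ℝ → ℝ} {f f' : ℝ → ℝ}

lemma hasDerivAt_integral_of_continuous_uncurry (hv : Continuous fun z : ℝ × ℝ => v z.1 z.2)
    (hvx : Continuous fun z : ℝ × ℝ => vx z.1 z.2)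
    (hderiv : ∀ t x, HasDerivAt (v t) (vx t x) x) (t x : ℝ) :
    HasDerivAt (fun y => ∫ τ in (0 : ℝ)..t, v τ y) (∫ τ in (0 : ℝ)..t, vx τ x) x := by
  have hslice : ∀ y, Continuous fun τ => v τ y := fun y =>
    hv.comp (by fun_prop : Continuous fun τ : ℝ => (τ, y))
  obtain ⟨D, hD⟩ := ((isCompact_uIcc (a := (0 : ℝ)) (b := t)).prod
    (isCompact_closedBall x 1)).exists_bound_of_continuousOn hvx.continuousOn
  exact (intervalIntegral.hasDerivAt_integral_of_dominated_loc_of_deriv_le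
    (F := fun y τ => v τ y) (F' := fun y τ => vx τ y) (bound := fun _ => D)
    (Metric.ball_mem_nhds x one_pos)
    (Eventually.of_forall fun y => (hslice y).aestronglyMeasurable)
    ((hslice x).intervalIntegrable _ _)
    (hvx.comp (by fun_prop : Continuous fun τ : ℝ => (τ, x))).aestronglyMeasurable
    (Eventually.of_forall fun τ hτ y hy =>
      hD (τ, y) ⟨uIoc_subset_uIcc hτ, Metric.ball_subset_closedBall hy⟩)
    intervalIntegrable_const (Eventually.of_forall fun τ _ y _ => hderiv τ y)).2

lemma hasFDerivAt_add_integral (hv : Continuous fun z : ℝ × ℝ => v z.1 z.2)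
    (hvx : Continuous fun z : ℝ × ℝ => vx z.1 z.2)
    (hderiv : ∀ t x, HasDerivAt (v t) (vx t x) x) (hf : ∀ x, HasDerivAt f (f' x) x)
    (hf' : Continuous f') (t x : ℝ) :
    HasFDerivAt (fun z : ℝ × ℝ => f z.2 + ∫ τ in (0 : ℝ)..z.1, v τ z.2)
      (form (v t x) (f' x + ∫ τ in (0 : ℝ)..t, vx τ x)) (t, x) := by
  have hpartial_time : ∀ z : ℝ × ℝ,
      HasDerivAt (fun s => f z.2 + ∫ τ in (0 : ℝ)..s, v τ z.2) (v z.1 z.2) z.1 := fun z =>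
    ((hv.comp (by fun_prop : Continuous fun τ : ℝ => (τ, z.2))).integral_hasStrictDerivAt 0 z.1)
      |>.hasDerivAt.const_add _
  have hpartial_space : ∀ z : ℝ × ℝ, HasDerivAt (fun y => f y + ∫ τ in (0 : ℝ)..z.1, v τ y)
      (f' z.2 + ∫ τ in (0 : ℝ)..z.1, vx τ z.2) z.2 := fun z =>
    (hf z.2).add (hasDerivAt_integral_of_continuous_uncurry hv hvx hderiv z.1 z.2)
  have hcont : Continuous fun z : ℝ × ℝ => f' z.2 + ∫ τ in (0 : ℝ)..z.1, vx τ z.2 :=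
    (hf'.comp continuous_snd).add
      (intervalIntegral.continuous_parametric_intervalIntegral_of_continuous
        (f := fun (z : ℝ × ℝ) τ => vx τ z.2)
        (hvx.comp (by fun_prop : Continuous fun p : (ℝ × ℝ) × ℝ => (p.2, p.1.2))) continuous_fst)
  have hspan := (ContinuousLinearMap.toSpanSingletonCLE (𝕜 := ℝ) (E := ℝ)).continuous
  refine (hasStrictFDerivAt_uncurry_coprod (𝕜 := ℝ) (u := (t, x))
    (f := fun s y => f y + ∫ τ in (0 : ℝ)..s, v τ y)
    (f₁ := fun s y => ContinuousLinearMap.toSpanSingleton ℝ (v s y))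
    (f₂ := fun s y => ContinuousLinearMap.toSpanSingleton ℝ (f' y + ∫ τ in (0 : ℝ)..s, vx τ y))
    (Eventually.of_forall fun z => (hpartial_time z).hasFDerivAt)
    (Eventually.of_forall fun z => (hpartial_space z).hasFDerivAt)
    (hspan.comp hv).continuousAt (hspan.comp hcont).continuousAt).hasFDerivAt.congr_fderiv ?_
  ext <;> simp [Function.HasUncurry.uncurry]

/-- The time `τ` moved to the nearest point of `[0, t₁]`; it extends functions on a slab to all
times. -/
def clampTime (t₁ τ : ℝ) : ℝ := max 0 (min τ t₁)

lemma clampTime_of_mem {t₁ τ : ℝ} (hτ : τ ∈ Icc 0 t₁) : clampTime t₁ τ = τ := by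
  rw [clampTime, min_eq_left hτ.2, max_eq_right hτ.1]

lemma clampTime_mem_Ico {t₁ T : ℝ} (h₀ : 0 ≤ t₁) (h₁ : t₁ < T) (τ : ℝ) :
    clampTime t₁ τ ∈ Ico 0 T :=
  ⟨le_max_left _ _, (max_le h₀ (min_le_right _ _)).trans_lt h₁⟩

lemma continuous_comp_clampTime {t₁ T : ℝ} (h₀ : 0 ≤ t₁) (h₁ : t₁ < T)
    (hv : ContinuousOn (fun z : ℝ × ℝ => v z.1 z.2) (slab T)) :
    Continuous fun z : ℝ × ℝ => v (clampTime t₁ z.1) z.2 :=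
  hv.comp_continuous (f := fun z : ℝ × ℝ => (clampTime t₁ z.1, z.2))
    (by unfold clampTime; fun_prop) fun z => mem_slab.2 (clampTime_mem_Ico h₀ h₁ z.1)

lemma integral_comp_clampTime {t t₁ : ℝ} (ht : t ∈ Icc 0 t₁) (x : ℝ) :
    ∫ τ in (0 : ℝ)..t, v (clampTime t₁ τ) x = ∫ τ in (0 : ℝ)..t, v τ x := by
  refine intervalIntegral.integral_congr fun τ hτ => ?_
  rw [uIcc_of_le ht.1] at hτ
  simp only [clampTime_of_mem (Icc_subset_Icc_right ht.2 hτ)]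

lemma hasPartials_add_integral {T : ℝ} (hv : ContinuousOn (fun z : ℝ × ℝ => v z.1 z.2) (slab T))
    (hvx : ContinuousOn (fun z : ℝ × ℝ => vx z.1 z.2) (slab T))
    (hderiv : ∀ t ∈ Ico 0 T, ∀ x, HasDerivAt (v t) (vx t x) x)
    (hf : ∀ x, HasDerivAt f (f' x) x) (hf' : Continuous f') :
    HasPartials T (fun t x => f x + ∫ τ in (0 : ℝ)..t, v τ x) v
      (fun t x => f' x + ∫ τ in (0 : ℝ)..t, vx τ x) := by
  intro t ht x
  obtain ⟨t₁, htt₁, ht₁⟩ := exists_between ht.2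
  have ht₁₀ : 0 ≤ t₁ := ht.1.trans htt₁.le
  have htm : t ∈ Icc 0 t₁ := ⟨ht.1, htt₁.le⟩
  have hclamped := hasFDerivAt_add_integral (continuous_comp_clampTime ht₁₀ ht₁ hv)
    (continuous_comp_clampTime ht₁₀ ht₁ hvx)
    (fun τ => hderiv _ (clampTime_mem_Ico ht₁₀ ht₁ τ)) hf hf' t x
  rw [clampTime_of_mem htm, integral_comp_clampTime htm] at hclamped
  refine hclamped.hasFDerivWithinAt.congr_of_eventuallyEq ?_ ?_
  · filter_upwards [slab_mem_nhdsWithin htt₁] with z hz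
    rw [integral_comp_clampTime (Ico_subset_Icc_self hz.1)]
  · simp only [integral_comp_clampTime htm]

end

lemma HasPartials.potential {T : ℝ} {v vt vx w wx : ℝ → ℝ → ℝ} {f : ℝ → ℝ}
    (hv : HasPartials T v vt vx) (hw : HasPartials T w vx wx)
    (hvx : ContinuousOn (fun z : ℝ × ℝ => vx z.1 z.2) (slab T))
    (hf : ∀ x, HasDerivAt f (w 0 x) x) :
    HasPartials T (fun t x => f x + ∫ τ in (0 : ℝ)..t, v τ x) v w := by
  intro t ht
  have h₀ : (0 : ℝ) ∈ Ico 0 T := ⟨le_rfl, ht.1.trans_lt ht.2⟩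
  have hw₀ : Continuous (w 0) := continuous_iff_continuousAt.2 fun x =>
    (hw.hasDerivAt h₀ x).continuousAt
  exact (hasPartials_add_integral hv.continuousOn hvx (fun _ hτ => hv.hasDerivAt hτ) hf hw₀).congr
    (fun _ _ _ => rfl) (fun _ _ _ => rfl)
    (fun _ hτ x => (hw.add_integral_eq hvx hτ x).symm) t ht

/-! ### Riemann invariants -/

/-- The Riemann invariant `u_t + L(u_x)` of the wave equation, where `L` is a primitive of the wave
speed. It is carried by the left-going characteristics. -/
noncomputable def riemannLeft (L : ℝ → ℝ) (u : ℝ → ℝ → ℝ) (t x : ℝ) : ℝ :=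
  dt u t x + L (dx u t x)

/-- The Riemann invariant `u_t - L(u_x)`, carried by the right-going characteristics. -/
noncomputable def riemannRight (L : ℝ → ℝ) (u : ℝ → ℝ → ℝ) (t x : ℝ) : ℝ :=
  dt u t x - L (dx u t x)

/-- The initial value of `riemannLeft` for the Cauchy data `u = f`, `u_t = g`. -/
noncomputable def initialLeft (L f g : ℝ → ℝ) (x : ℝ) : ℝ := g x + L (deriv f x)

/-- The initial value of `riemannRight` for the Cauchy data `u = f`, `u_t = g`. -/
noncomputable def initialRight (L f g : ℝ → ℝ) (x : ℝ) : ℝ := g x - L (deriv f x)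

/-- Bounded smooth Cauchy data whose Riemann invariants are small compared to the size `δ` of the
strains for which the wave speed is controlled. -/
structure SmallData (L : ℝ → ℝ) (δ : ℝ) (f g : ℝ → ℝ) : Prop where
  contDiff : ContDiff ℝ 2 f
  contDiff_dt : ContDiff ℝ 1 g
  bounded : ∃ B, ∀ x, |f x| ≤ B
  bounded_deriv : ∃ B, ∀ x, |deriv (deriv f) x| ≤ B ∧ |deriv g x| ≤ B
  left_le : ∀ x, |initialLeft L f g x| ≤ δ / 4
  right_le : ∀ x, |initialRight L f g x| ≤ δ / 4

lemma strain_riemann (L : ℝ → ℝ) (u : ℝ → ℝ → ℝ) (t x : ℝ) :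
    strain (riemannLeft L u) (riemannRight L u) t x = L (dx u t x) := by
  simp only [strain, riemannLeft, riemannRight]
  ring

lemma initialLeft_sub_initialRight (L f g : ℝ → ℝ) (x : ℝ) :
    (initialLeft L f g x - initialRight L f g x) / 2 = L (deriv f x) := by
  simp only [initialLeft, initialRight]
  ring

lemma abs_mul_le_two_mul {a b B : ℝ} (ha₀ : 0 ≤ a) (ha : a ≤ 2) (hb : |b| ≤ B) :
    |a * b| ≤ 2 * B := by
  rw [abs_mul, abs_of_nonneg ha₀]
  gcongr

section

variable {U : Set ℝ} {c : ℝ → ℝ} {δ : ℝ} {a L G : ℝ → ℝ} {K T B : ℝ} {f g : ℝ → ℝ}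
  {u : ℝ → ℝ → ℝ}

lemma SpeedExtension.abs_speed_mul_le (h : SpeedExtension U c δ a K L G) (w : ℝ) {b : ℝ}
    (hb : |b| ≤ B) : |a w * b| ≤ 2 * B :=
  abs_mul_le_two_mul (h.isSpeed.pos w).le (by linarith [h.isSpeed.upper w]) hb

lemma SpeedExtension.abs_inv_speed_mul_le (h : SpeedExtension U c δ a K L G) (w : ℝ) {b : ℝ}
    (hb : |b| ≤ B) : |(a w)⁻¹ * b| ≤ 2 * B :=
  abs_mul_le_two_mul (inv_pos.2 (h.isSpeed.pos w)).le
    (inv_le_of_inv_le₀ (by norm_num) (by linarith [h.isSpeed.lower w])) hb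

lemma SpeedExtension.abs_inv_le_half (h : SpeedExtension U c δ a K L G) {q : ℝ}
    (hq : |q| ≤ δ / 4) : |G q| ≤ δ / 2 := by
  linarith [h.abs_inv_le q, h.pos]

lemma SpeedExtension.abs_le_half (h : SpeedExtension U c δ a K L G) {w : ℝ}
    (hw : |L w| ≤ δ / 4) : |w| ≤ δ / 2 := by
  simpa only [h.left_inv] using h.abs_inv_le_half hw

namespace IsClassicalSolution

lemma mono {T' : ℝ} (h : IsClassicalSolution c U f g T u) (hT : T' ≤ T) :
    IsClassicalSolution c U f g T' u where
  contDiffOn := h.contDiffOn.mono (slab_mono hT)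
  dx_mem t ht := h.dx_mem t ⟨ht.1, ht.2.trans_le hT⟩
  equation t ht := h.equation t ⟨ht.1, ht.2.trans_le hT⟩
  initial := h.initial
  initial_dt := h.initial_dt

lemma dx_zero (h : IsClassicalSolution c U f g T u) (x : ℝ) : dx u 0 x = deriv f x := by
  simp only [dx, h.initial]

lemma riemannLeft_zero (h : IsClassicalSolution c U f g T u) (x : ℝ) :
    riemannLeft L u 0 x = initialLeft L f g x := by
  rw [riemannLeft, initialLeft, h.initial_dt, h.dx_zero]

lemma riemannRight_zero (h : IsClassicalSolution c U f g T u) (x : ℝ) :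
    riemannRight L u 0 x = initialRight L f g x := by
  rw [riemannRight, initialRight, h.initial_dt, h.dx_zero]

lemma contDiffOn_dt_one (h : IsClassicalSolution c U f g T u) :
    ContDiffOn ℝ 1 (fun z : ℝ × ℝ => dt u z.1 z.2) (slab T) :=
  contDiffOn_dt (by rw [one_add_one_eq_two]; exact h.contDiffOn)

lemma contDiffOn_dx_one (h : IsClassicalSolution c U f g T u) :
    ContDiffOn ℝ 1 (fun z : ℝ × ℝ => dx u z.1 z.2) (slab T) :=
  contDiffOn_dx (by rw [one_add_one_eq_two]; exact h.contDiffOn)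

lemma hasPartials_dt (h : IsClassicalSolution c U f g T u) :
    HasPartials T (dt u) (dt (dt u)) (dx (dt u)) :=
  hasPartials_of_contDiffOn h.contDiffOn_dt_one

lemma hasPartials_dx (h : IsClassicalSolution c U f g T u) :
    HasPartials T (dx u) (dx (dt u)) (dx (dx u)) :=
  (hasPartials_of_contDiffOn h.contDiffOn_dx_one).congr (fun _ _ _ => rfl)
    (fun _ ht x => (dt_dx_comm h.contDiffOn ht x).symm) fun _ _ _ => rfl

lemma continuousOn_dx_dt (h : IsClassicalSolution c U f g T u) :
    ContinuousOn (fun z : ℝ × ℝ => dx (dt u) z.1 z.2) (slab T) :=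
  (contDiffOn_dx (n := 0) (by simpa using h.contDiffOn_dt_one)).continuousOn

lemma continuousOn_dx_dx (h : IsClassicalSolution c U f g T u) :
    ContinuousOn (fun z : ℝ × ℝ => dx (dx u) z.1 z.2) (slab T) :=
  (contDiffOn_dx (n := 0) (by simpa using h.contDiffOn_dx_one)).continuousOn

lemma hasPartials_riemannLeft (h : IsClassicalSolution c U f g T u)
    (hL : ∀ w, HasDerivAt L (a w) w) :
    HasPartials T (riemannLeft L u)
      (fun t x => dt (dt u) t x + a (dx u t x) * dx (dt u) t x)
      (fun t x => dx (dt u) t x + a (dx u t x) * dx (dx u) t x) :=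
  h.hasPartials_dt.add (h.hasPartials_dx.comp fun _ _ _ => hL _)

lemma hasPartials_riemannRight (h : IsClassicalSolution c U f g T u)
    (hL : ∀ w, HasDerivAt L (a w) w) :
    HasPartials T (riemannRight L u)
      (fun t x => dt (dt u) t x - a (dx u t x) * dx (dt u) t x)
      (fun t x => dx (dt u) t x - a (dx u t x) * dx (dx u) t x) :=
  h.hasPartials_dt.sub (h.hasPartials_dx.comp fun _ _ _ => hL _)

lemma isDiagSolution (E : SpeedExtension U c δ a K L G) (h : IsClassicalSolution c U f g T u)
    (hδ : ∀ t ∈ Ico 0 T, ∀ x, |dx u t x| ≤ δ) :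
    IsDiagSolution (a ∘ G) T (riemannLeft L u) (riemannRight L u) := by
  have hleft := h.hasPartials_riemannLeft E.hasDerivAt
  have hright := h.hasPartials_riemannRight E.hasDerivAt
  have hspeed : ∀ t x, (a ∘ G) (strain (riemannLeft L u) (riemannRight L u) t x) = a (dx u t x) :=
    fun t x => by rw [strain_riemann, Function.comp_apply, E.left_inv]
  have hwave : ∀ t ∈ Ico 0 T, ∀ x, dt (dt u) t x = a (dx u t x) ^ 2 * dx (dx u) t x := by
    intro t ht x
    rw [E.eq_of_abs_le (hδ t ht x)]
    exact sub_eq_zero.1 (h.equation t ht x)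
  have hcont : ContinuousOn (fun z : ℝ × ℝ => a (dx u z.1 z.2)) (slab T) :=
    E.isSpeed.continuous.comp_continuousOn h.hasPartials_dx.continuousOn
  refine ⟨fun t ht x => ?_, fun t ht x => ?_, ?_, ?_⟩
  · rw [hspeed, hleft.dx_eq ht]
    convert hleft t ht x using 2
    simp only [hwave t ht x]
    ring
  · rw [hspeed, hright.dx_eq ht]
    convert hright t ht x using 2
    simp only [hwave t ht x]
    ring
  · exact (h.continuousOn_dx_dt.add (hcont.mul h.continuousOn_dx_dx)).congr
      fun z hz => hleft.dx_eq hz.1 z.2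
  · exact (h.continuousOn_dx_dt.sub (hcont.mul h.continuousOn_dx_dx)).congr
      fun z hz => hright.dx_eq hz.1 z.2

lemma gradientBound (E : SpeedExtension U c δ a K L G) (h : IsClassicalSolution c U f g T u)
    (hB : ∀ t ∈ Ico 0 T, ∀ x, |dx (dt u) t x| ≤ B ∧ |dx (dx u) t x| ≤ B) :
    GradientBound T (riemannLeft L u) (riemannRight L u) (3 * B) := by
  intro t ht x
  have hmul := E.abs_speed_mul_le (dx u t x) (hB t ht x).2
  rw [(h.hasPartials_riemannLeft E.hasDerivAt).dx_eq ht,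
    (h.hasPartials_riemannRight E.hasDerivAt).dx_eq ht]
  exact ⟨(abs_add_le _ _).trans (by linarith [(hB t ht x).1]),
    (abs_sub _ _).trans (by linarith [(hB t ht x).1])⟩

lemma abs_dx_sub_le (h : IsClassicalSolution c U f g T u)
    (hB : ∀ t ∈ Ico 0 T, ∀ x, |dx (dt u) t x| ≤ B) {t t' : ℝ} (ht : t ∈ Ico 0 T)
    (ht' : t' ∈ Icc 0 t) (x : ℝ) : |dx u t x - dx u t' x| ≤ B * (t - t') := by
  simpa [abs_of_nonneg (sub_nonneg.2 ht'.2)] using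
    (convex_Icc 0 t).norm_image_sub_le_of_norm_hasDerivWithin_le
      (fun τ hτ => h.hasPartials_dx.hasDerivWithinAt_time ht.2 hτ x)
      (fun τ hτ => hB τ (mem_Ico_of_mem_Icc ht.2 hτ) x) ht' (right_mem_Icc.2 ht.1)

lemma abs_dx_le_half (E : SpeedExtension U c δ a K L G) (D : SmallData L δ f g)
    (h : IsClassicalSolution c U f g T u)
    (hB : ∀ t ∈ Ico 0 T, ∀ x, |dx (dt u) t x| ≤ B ∧ |dx (dx u) t x| ≤ B)
    (hδ : ∀ t ∈ Ico 0 T, ∀ x, |dx u t x| ≤ δ) {t : ℝ} (ht : t ∈ Ico 0 T) (x : ℝ) :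
    |dx u t x| ≤ δ / 2 := by
  have hdiag := h.isDiagSolution E hδ
  have hgrad := h.gradientBound E hB
  refine E.abs_le_half ?_
  rw [← strain_riemann L]
  exact abs_strain_le
    (hdiag.abs_left_le E.isSpeed_comp hgrad (fun y => by rw [h.riemannLeft_zero]; exact D.left_le y)
      ht x)
    (hdiag.abs_right_le E.isSpeed_comp hgrad
      (fun y => by rw [h.riemannRight_zero]; exact D.right_le y) ht x)

end IsClassicalSolution

lemma forall_abs_le_of_bootstrap {q : ℝ → ℝ → ℝ} (hδ : 0 < δ) (hB : 0 ≤ B)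
    (hlip : ∀ t ∈ Ico 0 T, ∀ t' ∈ Icc 0 t, ∀ x, |q t x - q t' x| ≤ B * (t - t'))
    (hinit : ∀ x, |q 0 x| ≤ δ / 2)
    (hstep : ∀ T' ≤ T, (∀ t ∈ Ico 0 T', ∀ x, |q t x| ≤ δ) →
      ∀ t ∈ Ico 0 T', ∀ x, |q t x| ≤ δ / 2) :
    ∀ t ∈ Ico 0 T, ∀ x, |q t x| ≤ δ := by
  set η := δ / (2 * (B + 1)) with hη
  have hη₀ : 0 < η := by positivity
  have hBη : B * η ≤ δ / 2 := by
    rw [hη, mul_div_assoc', div_le_iff₀ (by positivity)]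
    nlinarith
  have hsteps : ∀ n : ℕ, ∀ t ∈ Ico 0 T, t < n * η → ∀ x, |q t x| ≤ δ := by
    intro n
    induction n with
    | zero => exact fun t ht htn => absurd ht.1 (not_le.2 (by simpa using htn))
    | succ n ih =>
      intro t ht htn x
      have hhalf : |q (max 0 (t - η)) x| ≤ δ / 2 := by
        rcases le_total (t - η) 0 with hle | hle
        · rw [max_eq_left hle]
          exact hinit x
        · rw [max_eq_right hle]
          refine hstep (min (n * η) T) (min_le_right _ _)
            (fun τ hτ => ih τ ⟨hτ.1, hτ.2.trans_le (min_le_right _ _)⟩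
              (hτ.2.trans_le (min_le_left _ _))) _ ⟨hle, lt_min ?_ ?_⟩ x
          · push_cast at htn
            linarith
          · linarith [ht.2]
      have hclose := hlip t ht (max 0 (t - η)) ⟨le_max_left _ _, max_le ht.1 (by linarith)⟩ x
      have hgap : B * (t - max 0 (t - η)) ≤ B * η := by
        gcongr
        linarith [le_max_right 0 (t - η)]
      linarith [abs_sub_abs_le_abs_sub (q t x) (q (max 0 (t - η)) x)]
  intro t ht
  obtain ⟨n, hn⟩ := exists_nat_gt (t / η)
  exact hsteps n t ht ((div_lt_iff₀ hη₀).1 hn)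

lemma IsClassicalSolution.abs_dx_le (E : SpeedExtension U c δ a K L G) (D : SmallData L δ f g)
    (h : IsClassicalSolution c U f g T u)
    (hB : ∀ t ∈ Ico 0 T, ∀ x, |dx (dt u) t x| ≤ B ∧ |dx (dx u) t x| ≤ B) :
    ∀ t ∈ Ico 0 T, ∀ x, |dx u t x| ≤ δ := by
  intro t ht
  have hB₀ : 0 ≤ B := (abs_nonneg _).trans (hB t ht 0).1
  have hinit : ∀ x, |dx u 0 x| ≤ δ / 2 := fun x => by
    refine E.abs_le_half ?_
    rw [h.dx_zero, ← initialLeft_sub_initialRight L f g]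
    exact abs_half_sub_le (D.left_le x) (D.right_le x)
  exact forall_abs_le_of_bootstrap E.pos hB₀
    (fun _ ht _ ht' => h.abs_dx_sub_le (fun τ hτ x => (hB τ hτ x).1) ht ht') hinit
    (fun T' hT' hδ _ ht => (h.mono hT').abs_dx_le_half E D
      (fun τ hτ => hB τ ⟨hτ.1, hτ.2.trans_le hT'⟩) hδ ht) t ht

end

/-! ### From the diagonal system back to the wave equation -/

/-- The velocity `u_t = (r + s) / 2` in terms of the Riemann invariants. -/
noncomputable def velocity (r s : ℝ → ℝ → ℝ) (t x : ℝ) : ℝ := (r t x + s t x) / 2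

/-- The displacement `u` recovered by integrating the velocity in time from `u = f` at `t = 0`. -/
noncomputable def displacement (f : ℝ → ℝ) (r s : ℝ → ℝ → ℝ) (t x : ℝ) : ℝ :=
  f x + ∫ τ in (0 : ℝ)..t, velocity r s τ x

lemma abs_velocity_le {r s : ℝ → ℝ → ℝ} {t x N : ℝ} (hr : |r t x| ≤ N) (hs : |s t x| ≤ N) :
    |velocity r s t x| ≤ N := by
  rw [velocity, abs_div, abs_two]
  linarith [abs_add_le (r t x) (s t x)]

lemma abs_displacement_le {f : ℝ → ℝ} {r s : ℝ → ℝ → ℝ} {t x B N : ℝ} (ht : 0 ≤ t)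
    (hf : |f x| ≤ B) (hr : ∀ τ ∈ Icc 0 t, |r τ x| ≤ N) (hs : ∀ τ ∈ Icc 0 t, |s τ x| ≤ N) :
    |displacement f r s t x| ≤ B + N * t := by
  have hint : ‖∫ τ in (0 : ℝ)..t, velocity r s τ x‖ ≤ N * |t - 0| :=
    intervalIntegral.norm_integral_le_of_norm_le_const fun τ hτ => by
      rw [uIoc_of_le ht] at hτ
      exact abs_velocity_le (hr τ (Ioc_subset_Icc_self hτ)) (hs τ (Ioc_subset_Icc_self hτ))
  rw [Real.norm_eq_abs, sub_zero, abs_of_nonneg ht] at hint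
  exact (abs_add_le _ _).trans (add_le_add hf hint)

section

variable {k : ℝ → ℝ} {T : ℝ} {r s : ℝ → ℝ → ℝ}

lemma IsDiagSolution.hasPartials_velocity (h : IsDiagSolution k T r s) :
    HasPartials T (velocity r s) (fun t x => k (strain r s t x) * strain (dx r) (dx s) t x)
      (velocity (dx r) (dx s)) := fun t ht x => by
  have hsum := ((h.left t ht x).add (h.right t ht x)).const_mul (2⁻¹ : ℝ)
  refine (hsum.congr_fderiv ?_).congr (fun z _ => ?_) ?_
  · ext <;> simp [velocity, strain] <;> ring
  all_goals simp [velocity]; ring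

lemma IsDiagSolution.hasPartials_strain (h : IsDiagSolution k T r s) :
    HasPartials T (strain r s) (fun t x => k (strain r s t x) * velocity (dx r) (dx s) t x)
      (strain (dx r) (dx s)) := fun t ht x => by
  have hdiff := ((h.left t ht x).sub (h.right t ht x)).const_mul (2⁻¹ : ℝ)
  refine (hdiff.congr_fderiv ?_).congr (fun z _ => ?_) ?_
  · ext <;> simp [velocity, strain] <;> ring
  all_goals simp [strain]; ring

lemma IsDiagSolution.continuousOn_velocity_dx (h : IsDiagSolution k T r s) :
    ContinuousOn (fun z : ℝ × ℝ => velocity (dx r) (dx s) z.1 z.2) (slab T) :=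
  (h.continuousOn_dx_left.add h.continuousOn_dx_right).div_const 2

lemma IsDiagSolution.continuousOn_strain_dx (h : IsDiagSolution k T r s) :
    ContinuousOn (fun z : ℝ × ℝ => strain (dx r) (dx s) z.1 z.2) (slab T) :=
  (h.continuousOn_dx_left.sub h.continuousOn_dx_right).div_const 2

end

namespace SpeedExtension

variable {U : Set ℝ} {c : ℝ → ℝ} {δ : ℝ} {a L G : ℝ → ℝ} {K T : ℝ} {f g : ℝ → ℝ}
  {r s : ℝ → ℝ → ℝ}

lemma hasPartials_inv_strain (E : SpeedExtension U c δ a K L G)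
    (h : IsDiagSolution (a ∘ G) T r s) :
    HasPartials T (fun t x => G (strain r s t x)) (velocity (dx r) (dx s))
      (fun t x => (a (G (strain r s t x)))⁻¹ * strain (dx r) (dx s) t x) :=
  (h.hasPartials_strain.comp (L' := fun q => (a (G q))⁻¹) fun _ _ _ => E.hasDerivAt_inv _).congr
    (fun _ _ _ => rfl)
    (fun t _ x => (inv_mul_cancel_left₀ (E.isSpeed.pos (G (strain r s t x))).ne' _).symm)
    fun _ _ _ => rfl

lemma hasPartials_displacement (E : SpeedExtension U c δ a K L G)
    (h : IsDiagSolution (a ∘ G) T r s) (hf : ∀ x, HasDerivAt f (G (strain r s 0 x)) x) :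
    HasPartials T (displacement f r s) (velocity r s) (fun t x => G (strain r s t x)) :=
  h.hasPartials_velocity.potential (E.hasPartials_inv_strain h) h.continuousOn_velocity_dx hf

lemma hasPartials_dt_displacement (E : SpeedExtension U c δ a K L G)
    (h : IsDiagSolution (a ∘ G) T r s) (hf : ∀ x, HasDerivAt f (G (strain r s 0 x)) x) :
    HasPartials T (dt (displacement f r s))
      (fun t x => a (G (strain r s t x)) * strain (dx r) (dx s) t x) (velocity (dx r) (dx s)) :=
  h.hasPartials_velocity.congr (fun _ ht => (E.hasPartials_displacement h hf).dt_eq ht)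
    (fun _ _ _ => rfl) fun _ _ _ => rfl

lemma hasPartials_dx_displacement (E : SpeedExtension U c δ a K L G)
    (h : IsDiagSolution (a ∘ G) T r s) (hf : ∀ x, HasDerivAt f (G (strain r s 0 x)) x) :
    HasPartials T (dx (displacement f r s)) (velocity (dx r) (dx s))
      (fun t x => (a (G (strain r s t x)))⁻¹ * strain (dx r) (dx s) t x) :=
  (E.hasPartials_inv_strain h).congr (fun _ ht => (E.hasPartials_displacement h hf).dx_eq ht)
    (fun _ _ _ => rfl) fun _ _ _ => rfl

lemma contDiffOn_displacement (E : SpeedExtension U c δ a K L G)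
    (h : IsDiagSolution (a ∘ G) T r s) (hf : ∀ x, HasDerivAt f (G (strain r s 0 x)) x) :
    ContDiffOn ℝ 2 (fun z : ℝ × ℝ => displacement f r s z.1 z.2) (slab T) := by
  have hspeed : ContinuousOn (fun z : ℝ × ℝ => a (G (strain r s z.1 z.2))) (slab T) :=
    E.isSpeed_comp.continuous.comp_continuousOn h.continuousOn_strain
  have hinv : ContinuousOn (fun z : ℝ × ℝ => (a (G (strain r s z.1 z.2)))⁻¹) (slab T) :=
    hspeed.inv₀ fun _ _ => (E.isSpeed.pos _).ne'
  have hvelocity := h.hasPartials_velocity.contDiffOn_succ (n := 0)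
    (contDiffOn_zero.2 (hspeed.mul h.continuousOn_strain_dx))
    (contDiffOn_zero.2 h.continuousOn_velocity_dx)
  have hstrain := (E.hasPartials_inv_strain h).contDiffOn_succ (n := 0)
    (contDiffOn_zero.2 h.continuousOn_velocity_dx)
    (contDiffOn_zero.2 (hinv.mul h.continuousOn_strain_dx))
  rw [Nat.cast_zero, zero_add] at hvelocity hstrain
  rw [← one_add_one_eq_two]
  exact (E.hasPartials_displacement h hf).contDiffOn_succ (n := 1) hvelocity hstrain

lemma inv_strain_zero (E : SpeedExtension U c δ a K L G) (hr : r 0 = initialLeft L f g)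
    (hs : s 0 = initialRight L f g) (x : ℝ) : G (strain r s 0 x) = deriv f x := by
  rw [strain, hr, hs, initialLeft_sub_initialRight, E.left_inv]

lemma abs_inv_strain_le (E : SpeedExtension U c δ a K L G) {t x : ℝ} (hr : |r t x| ≤ δ / 4)
    (hs : |s t x| ≤ δ / 4) : |G (strain r s t x)| ≤ δ :=
  (E.abs_inv_le_half (abs_strain_le hr hs)).trans (half_le_self E.pos.le)

lemma isClassicalSolution_displacement (E : SpeedExtension U c δ a K L G) (hT : 0 < T)
    (hf : Differentiable ℝ f) (h : IsDiagSolution (a ∘ G) T r s) (hr : r 0 = initialLeft L f g)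
    (hs : s 0 = initialRight L f g)
    (hsmall : ∀ t ∈ Ico 0 T, ∀ x, |r t x| ≤ δ / 4 ∧ |s t x| ≤ δ / 4) :
    IsClassicalSolution c U f g T (displacement f r s) := by
  have hf' : ∀ x, HasDerivAt f (G (strain r s 0 x)) x := fun x => by
    rw [E.inv_strain_zero hr hs]
    exact (hf x).hasDerivAt
  have hu := E.hasPartials_displacement h hf'
  have hδ : ∀ t ∈ Ico 0 T, ∀ x, |G (strain r s t x)| ≤ δ := fun t ht x =>
    E.abs_inv_strain_le (hsmall t ht x).1 (hsmall t ht x).2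
  refine ⟨E.contDiffOn_displacement h hf', fun t ht x => ?_, fun t ht x => ?_,
    fun x => by simp [displacement], fun x => ?_⟩
  · rw [hu.dx_eq ht]
    exact E.subset _ (hδ t ht x)
  · have hne := (E.isSpeed.pos (G (strain r s t x))).ne'
    rw [(E.hasPartials_dt_displacement h hf').dt_eq ht,
      (E.hasPartials_dx_displacement h hf').dx_eq ht, hu.dx_eq ht, ← E.eq_of_abs_le (hδ t ht x),
      pow_two, mul_assoc, mul_inv_cancel_left₀ hne, sub_self]
  · rw [hu.dt_eq ⟨le_rfl, hT⟩, velocity, hr, hs, initialLeft, initialRight]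
    ring

end SpeedExtension

/-! ### Norms -/

lemma supNorm_le_ofReal {f : ℝ → ℝ} {B : ℝ} (h : ∀ x, |f x| ≤ B) :
    supNorm f ≤ ENNReal.ofReal B :=
  iSup_le fun x => by
    rw [Real.enorm_eq_ofReal_abs]
    exact ENNReal.ofReal_le_ofReal (h x)

lemma abs_le_toReal_of_supNorm_le {f : ℝ → ℝ} {C : ℝ≥0∞} (hC : C ≠ ∞) (h : supNorm f ≤ C)
    (x : ℝ) : |f x| ≤ C.toReal := by
  rw [← ENNReal.ofReal_le_iff_le_toReal hC, ← Real.enorm_eq_ofReal_abs]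
  exact (le_iSup (fun x => ‖f x‖ₑ) x).trans h

section

variable {c : ℝ → ℝ} {u : ℝ → ℝ → ℝ} {t T : ℝ}

lemma abs_dx_le_toReal_of_supNorm_add_le {C : ℝ≥0∞} (hC : C ≠ ∞)
    (h : supNorm (dx (dt u) t) + supNorm (dx (dx u) t) ≤ C) (x : ℝ) :
    |dx (dt u) t x| ≤ C.toReal ∧ |dx (dx u) t x| ≤ C.toReal :=
  ⟨abs_le_toReal_of_supNorm_le hC (le_self_add.trans h) x,
    abs_le_toReal_of_supNorm_le hC (le_add_self.trans h) x⟩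

lemma supNorm_dx_add_supNorm_dx_le_totalNorm :
    supNorm (dx (dt u) t) + supNorm (dx (dx u) t) ≤ totalNorm c u t := by
  refine le_trans ?_ le_self_add
  gcongr
  exact le_add_self

lemma exists_bound_of_iSup_totalNorm_lt_top (h : ⨆ t ∈ Ico 0 T, totalNorm c u t < ∞) :
    ∃ B, ∀ t ∈ Ico 0 T, ∀ x, |dx (dt u) t x| ≤ B ∧ |dx (dx u) t x| ≤ B :=
  ⟨_, fun t ht => abs_dx_le_toReal_of_supNorm_add_le h.ne <|
    supNorm_dx_add_supNorm_dx_le_totalNorm.trans <|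
      le_iSup₂ (f := fun t (_ : t ∈ Ico 0 T) => totalNorm c u t) t ht⟩

lemma iSup_enorm_inv_le_two {f : ℝ → ℝ} (h : ∀ x, 1 / 2 ≤ f x) : ⨆ x, ‖f x‖ₑ⁻¹ ≤ 2 :=
  iSup_le fun x => by
    rw [Real.enorm_eq_ofReal_abs, ENNReal.inv_le_iff_inv_le, ← ENNReal.ofReal_ofNat,
      ← ENNReal.ofReal_inv_of_pos two_pos, ← one_div]
    exact ENNReal.ofReal_le_ofReal ((h x).trans (le_abs_self _))

lemma totalNorm_le {B : ℝ} (hu : ∀ x, |u t x| ≤ B) (hut : ∀ x, |dt u t x| ≤ B)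
    (hux : ∀ x, |dx u t x| ≤ B) (hutt : ∀ x, |dt (dt u) t x| ≤ B)
    (hutx : ∀ x, |dx (dt u) t x| ≤ B) (huxx : ∀ x, |dx (dx u) t x| ≤ B)
    (hc : ∀ x, 1 / 2 ≤ c (dx u t x)) : totalNorm c u t ≤ 6 * ENNReal.ofReal B + 2 := by
  calc totalNorm c u t
      ≤ ENNReal.ofReal B + ENNReal.ofReal B + ENNReal.ofReal B + ENNReal.ofReal B
          + ENNReal.ofReal B + ENNReal.ofReal B + 2 := by
        unfold totalNorm
        gcongr
        exacts [supNorm_le_ofReal hu, supNorm_le_ofReal hut, supNorm_le_ofReal hux,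
          supNorm_le_ofReal hutt, supNorm_le_ofReal hutx, supNorm_le_ofReal huxx,
          iSup_enorm_inv_le_two hc]
    _ = 6 * ENNReal.ofReal B + 2 := by ring

lemma IsSolutionUpTo.exists_bound {U : Set ℝ} {f g : ℝ → ℝ} (hu : IsSolutionUpTo c U f g T u)
    (hT : 0 < T) (hblow : ¬SecondDerivativesBlowUp T u) :
    ∃ B, ∀ t ∈ Ico 0 T, ∀ x, |dx (dt u) t x| ≤ B ∧ |dx (dx u) t x| ≤ B := by
  obtain ⟨C, hlimsup, hC⟩ := exists_between (lt_top_iff_ne_top.2 hblow)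
  obtain ⟨t₁, ht₁, hlate⟩ :=
    (mem_nhdsLT_iff_exists_Ioo_subset' hT).1 (eventually_lt_of_limsup_lt hlimsup)
  obtain ⟨t₂, ht₁₂, ht₂⟩ := exists_between (show t₁ < T from ht₁)
  obtain ⟨B, hearly⟩ := exists_bound_of_iSup_totalNorm_lt_top (hu.2 t₂ ht₂)
  refine ⟨max B C.toReal, fun t ht x => ?_⟩
  rcases lt_or_ge t t₂ with htt₂ | htt₂
  · exact (hearly t ⟨ht.1, htt₂⟩ x).imp le_max_of_le_left le_max_of_le_left
  · exact (abs_dx_le_toReal_of_supNorm_add_le hC.ne (hlate ⟨ht₁₂.trans_le htt₂, ht.2⟩).le x).imp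
      le_max_of_le_right le_max_of_le_right

end

/-! ### The lifespan -/

section

variable {k : ℝ → ℝ} {K T N : ℝ} {r s : ℝ → ℝ → ℝ} {r₀ s₀ : ℝ → ℝ}

lemma HasDiagSolution.mono (h : HasDiagSolution k r₀ s₀ T) {T' : ℝ} (hT : T' ≤ T) :
    HasDiagSolution k r₀ s₀ T' := by
  obtain ⟨r, s, h, ⟨M, hM⟩, hr, hs⟩ := h
  exact ⟨r, s, h.mono hT, ⟨M, hM.mono hT le_rfl⟩, hr, hs⟩

lemma IsDiagSolution.abs_le_of_forall_gradientBound (h : IsDiagSolution k T r s)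
    (hk : IsSpeed k K) (hM : ∀ T' < T, ∃ M, GradientBound T' r s M) (hr : ∀ x, |r 0 x| ≤ N)
    (hs : ∀ x, |s 0 x| ≤ N) : ∀ t ∈ Ico 0 T, ∀ x, |r t x| ≤ N ∧ |s t x| ≤ N := by
  intro t ht x
  obtain ⟨T', htT', hT'⟩ := exists_between ht.2
  obtain ⟨M, hM⟩ := hM T' hT'
  have h' := h.mono hT'.le
  exact ⟨h'.abs_left_le hk hM hr ⟨ht.1, htT'⟩ x, h'.abs_right_le hk hM hs ⟨ht.1, htT'⟩ x⟩

end

lemma contDiff_one_deriv {f : ℝ → ℝ} (hf : ContDiff ℝ 2 f) : ContDiff ℝ 1 (deriv f) :=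
  hf.iterate_deriv' 1 1

section

variable {U : Set ℝ} {c : ℝ → ℝ} {δ : ℝ} {a L G : ℝ → ℝ} {K T : ℝ} {f g : ℝ → ℝ}
  {r s : ℝ → ℝ → ℝ}

lemma SpeedExtension.totalNorm_displacement_le (E : SpeedExtension U c δ a K L G)
    (h : IsDiagSolution (a ∘ G) T r s) (hf : ∀ x, HasDerivAt f (G (strain r s 0 x)) x) {B M : ℝ}
    (hB : ∀ x, |f x| ≤ B) (hsmall : ∀ t ∈ Ico 0 T, ∀ x, |r t x| ≤ δ / 4 ∧ |s t x| ≤ δ / 4)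
    {t : ℝ} (ht : t ∈ Ico 0 T) (hM : ∀ x, |dx r t x| ≤ M ∧ |dx s t x| ≤ M) :
    totalNorm c (displacement f r s) t ≤ 6 * ENNReal.ofReal (B + δ * T + δ + 2 * M) + 2 := by
  have hu := E.hasPartials_displacement h hf
  have hut := E.hasPartials_dt_displacement h hf
  have hux := E.hasPartials_dx_displacement h hf
  have hδ := E.pos
  have hB₀ : 0 ≤ B := (abs_nonneg _).trans (hB 0)
  have hM₀ : 0 ≤ M := (abs_nonneg _).trans (hM 0).1
  have hδt : δ / 4 * t ≤ δ * T := mul_le_mul (by linarith) ht.2.le ht.1 hδ.le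
  have hδT : 0 ≤ δ * T := mul_nonneg hδ.le (ht.1.trans ht.2.le)
  have hstrain : ∀ x, |G (strain r s t x)| ≤ δ := fun x =>
    E.abs_inv_strain_le (hsmall t ht x).1 (hsmall t ht x).2
  have hdstrain : ∀ x, |strain (dx r) (dx s) t x| ≤ M := fun x =>
    abs_strain_le (hM x).1 (hM x).2
  refine totalNorm_le (fun x => ?_) (fun x => ?_) (fun x => ?_) (fun x => ?_) (fun x => ?_)
    (fun x => ?_) (fun x => ?_)
  · have hdisp := abs_displacement_le ht.1 (hB x)
      (fun τ hτ => (hsmall τ (mem_Ico_of_mem_Icc ht.2 hτ) x).1)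
      (fun τ hτ => (hsmall τ (mem_Ico_of_mem_Icc ht.2 hτ) x).2)
    linarith
  · rw [hu.dt_eq ht]
    linarith [abs_velocity_le (hsmall t ht x).1 (hsmall t ht x).2]
  · rw [hu.dx_eq ht]
    linarith [hstrain x]
  · rw [hut.dt_eq ht]
    linarith [E.abs_speed_mul_le (G (strain r s t x)) (hdstrain x)]
  · rw [hut.dx_eq ht]
    linarith [abs_velocity_le (hM x).1 (hM x).2]
  · rw [hux.dx_eq ht]
    linarith [E.abs_inv_speed_mul_le (G (strain r s t x)) (hdstrain x)]
  · rw [hu.dx_eq ht, ← E.eq_of_abs_le (hstrain x)]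
    linarith [E.isSpeed.lower (G (strain r s t x))]

namespace SmallData

lemma contDiff_initialLeft (D : SmallData L δ f g) (E : SpeedExtension U c δ a K L G) :
    ContDiff ℝ 1 (initialLeft L f g) :=
  D.contDiff_dt.add (E.contDiff_map.comp (contDiff_one_deriv D.contDiff))

lemma contDiff_initialRight (D : SmallData L δ f g) (E : SpeedExtension U c δ a K L G) :
    ContDiff ℝ 1 (initialRight L f g) :=
  D.contDiff_dt.sub (E.contDiff_map.comp (contDiff_one_deriv D.contDiff))

lemma exists_hasDiagSolution (D : SmallData L δ f g) (E : SpeedExtension U c δ a K L G) :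
    ∃ T > 0, HasDiagSolution (a ∘ G) (initialLeft L f g) (initialRight L f g) T := by
  obtain ⟨B, hB⟩ := D.bounded_deriv
  have hB₀ : 0 ≤ B := (abs_nonneg _).trans (hB 0).1
  have hg : ∀ x, HasDerivAt g (deriv g x) x := fun x =>
    (D.contDiff_dt.differentiable one_ne_zero x).hasDerivAt
  have hL : ∀ x, HasDerivAt (fun x => L (deriv f x)) (a (deriv f x) * deriv (deriv f) x) x :=
    fun x => (E.hasDerivAt _).comp x
      ((contDiff_one_deriv D.contDiff).differentiable one_ne_zero x).hasDerivAt
  have hbound : ∀ x, |a (deriv f x) * deriv (deriv f) x| ≤ 2 * B := fun x =>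
    E.abs_speed_mul_le _ (hB x).1
  obtain ⟨T, hT, hsol⟩ := E.isSpeed_comp.exists_uniform_hasDiagSolution (M := 3 * B) (by positivity)
  refine ⟨T, hT, hsol _ _ (D.contDiff_initialLeft E) (D.contDiff_initialRight E) (fun x => ?_)
    fun x => ?_⟩
  · rw [((hg x).add (hL x)).deriv (f := initialLeft L f g)]
    linarith [abs_add_le (deriv g x) (a (deriv f x) * deriv (deriv f) x), hbound x, (hB x).2]
  · rw [((hg x).sub (hL x)).deriv (f := initialRight L f g)]
    linarith [abs_sub (deriv g x) (a (deriv f x) * deriv (deriv f) x), hbound x, (hB x).2]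

lemma hasDiagSolution_of_isClassicalSolution (D : SmallData L δ f g)
    (E : SpeedExtension U c δ a K L G) {B : ℝ} {u : ℝ → ℝ → ℝ}
    (h : IsClassicalSolution c U f g T u)
    (hB : ∀ t ∈ Ico 0 T, ∀ x, |dx (dt u) t x| ≤ B ∧ |dx (dx u) t x| ≤ B) :
    HasDiagSolution (a ∘ G) (initialLeft L f g) (initialRight L f g) T :=
  ⟨_, _, h.isDiagSolution E (h.abs_dx_le E D hB), ⟨_, h.gradientBound E hB⟩,
    funext h.riemannLeft_zero, funext h.riemannRight_zero⟩

lemma exists_isClassicalSolution (D : SmallData L δ f g) (E : SpeedExtension U c δ a K L G)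
    (hT : 0 < T) (h : IsDiagSolution (a ∘ G) T r s) (hr : r 0 = initialLeft L f g)
    (hs : s 0 = initialRight L f g) (hM : ∀ T' < T, ∃ M, GradientBound T' r s M) :
    ∃ u, IsClassicalSolution c U f g T u ∧ ∀ T' ≤ T, ∀ M, GradientBound T' r s M →
      ⨆ t ∈ Ico 0 T', totalNorm c u t < ∞ := by
  have hsmall := h.abs_le_of_forall_gradientBound E.isSpeed_comp hM (hr ▸ D.left_le)
    (hs ▸ D.right_le)
  have hf : Differentiable ℝ f := D.contDiff.differentiable two_ne_zero
  obtain ⟨B, hB⟩ := D.bounded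
  refine ⟨displacement f r s, E.isClassicalSolution_displacement hT hf h hr hs hsmall,
    fun T' hT' M hM => ?_⟩
  refine (iSup₂_le fun t ht => E.totalNorm_displacement_le h (fun x => ?_) hB hsmall
    ⟨ht.1, ht.2.trans_le hT'⟩ (hM t ht)).trans_lt ?_
  · rw [E.inv_strain_zero hr hs]
    exact (hf x).hasDerivAt
  · exact ENNReal.add_lt_top.2 ⟨ENNReal.mul_lt_top (by norm_num) ENNReal.ofReal_lt_top, by norm_num⟩

lemma hasDiagSolution_iff (D : SmallData L δ f g) (E : SpeedExtension U c δ a K L G)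
    (hT : 0 < T) :
    HasDiagSolution (a ∘ G) (initialLeft L f g) (initialRight L f g) T ↔
      ∃ u, IsBoundedSolution c U f g T u := by
  constructor
  · rintro ⟨r, s, h, ⟨M, hM⟩, hr, hs⟩
    obtain ⟨u, hu, hbound⟩ := D.exists_isClassicalSolution E hT h hr hs
      fun T' hT' => ⟨M, hM.mono hT'.le le_rfl⟩
    exact ⟨u, hu, hbound T le_rfl M hM⟩
  · rintro ⟨u, hu, hbound⟩
    obtain ⟨B, hB⟩ := exists_bound_of_iSup_totalNorm_lt_top hbound
    exact D.hasDiagSolution_of_isClassicalSolution E hu hB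

lemma exists_isSolutionUpTo (D : SmallData L δ f g) (E : SpeedExtension U c δ a K L G)
    (hT : 0 < T) (h : ∀ T' < T, 0 < T' →
      HasDiagSolution (a ∘ G) (initialLeft L f g) (initialRight L f g) T') :
    ∃ u, IsSolutionUpTo c U f g T u := by
  obtain ⟨r, s, hdiag, hM, hr, hs⟩ :=
    exists_isDiagSolution_of_forall_lt E.isSpeed_comp D.left_le D.right_le hT h
  obtain ⟨u, hu, hbound⟩ := D.exists_isClassicalSolution E hT hdiag hr hs hM
  refine ⟨u, hu, fun T' hT' => ?_⟩
  obtain ⟨M, hM⟩ := hM T' hT'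
  exact hbound T' hT'.le M hM

lemma secondDerivativesBlowUp (D : SmallData L δ f g) (E : SpeedExtension U c δ a K L G)
    (hT : 0 < T)
    (hmax : ∀ T' > T, ¬HasDiagSolution (a ∘ G) (initialLeft L f g) (initialRight L f g) T')
    {u : ℝ → ℝ → ℝ} (hu : IsSolutionUpTo c U f g T u) : SecondDerivativesBlowUp T u := by
  by_contra hblow
  obtain ⟨B, hB⟩ := hu.exists_bound hT hblow
  obtain ⟨T', hT', h⟩ := (D.hasDiagSolution_of_isClassicalSolution E hu.1 hB).exists_gt
    E.isSpeed_comp D.left_le D.right_le hT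
  exact hmax T' hT' h

lemma exists_isLifespan_le (D : SmallData L δ f g) (E : SpeedExtension U c δ a K L G) {B : ℝ}
    (hB : ∀ T, 0 < T →
      HasDiagSolution (a ∘ G) (initialLeft L f g) (initialRight L f g) T → T ≤ B) :
    ∃ T, IsLifespan c U f g T ∧ T ≤ B ∧ (∃ u, IsSolutionUpTo c U f g T u) ∧
      ∀ u, IsSolutionUpTo c U f g T u → SecondDerivativesBlowUp T u := by
  set S : Set ℝ := {T' : ℝ | 0 < T' ∧ ∃ u, IsBoundedSolution c U f g T' u}
  have hmem : ∀ T, T ∈ S ↔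
      0 < T ∧ HasDiagSolution (a ∘ G) (initialLeft L f g) (initialRight L f g) T :=
    fun T => and_congr_right fun hT => (D.hasDiagSolution_iff E hT).symm
  obtain ⟨T₀, hT₀⟩ : S.Nonempty := (D.exists_hasDiagSolution E).imp fun T hT => (hmem T).2 hT
  have hbound : B ∈ upperBounds S := fun T hT => hB T hT.1 ((hmem T).1 hT).2
  have hlub : IsLUB S (sSup S) := isLUB_csSup ⟨T₀, hT₀⟩ ⟨B, hbound⟩
  have hpos : 0 < sSup S := hT₀.1.trans_le (hlub.1 hT₀)
  refine ⟨sSup S, hlub, hlub.2 hbound, D.exists_isSolutionUpTo E hpos fun T' hT' _ => ?_,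
    fun u => D.secondDerivativesBlowUp E hpos fun T' hT' hsol => ?_⟩
  · obtain ⟨T, hT, hlt⟩ := exists_lt_of_lt_csSup ⟨T₀, hT₀⟩ hT'
    exact ((hmem T).1 hT).2.mono hlt.le
  · exact hT'.not_ge (hlub.1 ((hmem T').2 ⟨hpos.trans hT', hsol⟩))

end SmallData

end

/-! ### The rate of blow-up -/

section

variable {k : ℝ → ℝ} {K T M : ℝ} {r s : ℝ → ℝ → ℝ} {r₀ s₀ : ℝ → ℝ}

lemma HasDiagSolution.reflect (h : HasDiagSolution k r₀ s₀ T) :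
    HasDiagSolution k (fun x => -s₀ (-x)) (fun x => -r₀ (-x)) T := by
  obtain ⟨r, s, h, ⟨M, hM⟩, rfl, rfl⟩ := h
  exact ⟨_, _, h.reflect, ⟨M, hM.reflect⟩, rfl, rfl⟩

-- By the time `x₁ + X`, the left-going characteristic from `x₁` meets only values of `s` that come
-- from the far field `(-∞, -X]`.
lemma IsDiagSolution.half_le_abs_strain (h : IsDiagSolution k T r s) (hk : IsSpeed k K)
    (hM : GradientBound T r s M) {μ X x₁ t x : ℝ} (hr : 2 * μ ≤ |r 0 x₁|)
    (hs : ∀ x ≤ -X, |s 0 x| ≤ μ) (ht : t ∈ Ico 0 T) (htX : x₁ + X ≤ t)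
    (hx : x ≤ x₁ - 99 / 100 * t) (hrx : r t x = r 0 x₁) : μ / 2 ≤ |strain r s t x| := by
  obtain ⟨y, hy, hsy⟩ := h.exists_right_eq_initial hk hM ht x
  have hyX : y ≤ -X := by linarith [ht.1]
  rw [strain, abs_div, abs_two, hrx, hsy]
  linarith [abs_sub_abs_le_abs_sub (r 0 x₁) (s 0 y), hs y hyX]

lemma four_div_mul_rpow_le {p κ m ε d : ℝ} (hκ : 0 < κ) (hm : 0 < m) (hε : 0 < ε)
    (hd : m * ε ≤ d) :
    4 / (κ * (m * ε / 2) ^ (p - 2) * d) ≤ 4 / (κ * (m / 2) ^ (p - 2) * m) * ε ^ (-(p - 1)) := by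
  have hsplit : (m * ε / 2) ^ (p - 2) = (m / 2) ^ (p - 2) * ε ^ (p - 2) := by
    rw [mul_div_right_comm, Real.mul_rpow (by positivity) hε.le]
  have hpow : ε ^ (p - 1) = ε ^ (p - 2) * ε := by
    rw [← Real.rpow_add_one hε.ne']
    ring_nf
  calc 4 / (κ * (m * ε / 2) ^ (p - 2) * d)
      ≤ 4 / (κ * (m * ε / 2) ^ (p - 2) * (m * ε)) := by gcongr
    _ = 4 / (κ * (m / 2) ^ (p - 2) * m * ε ^ (p - 1)) := by
      rw [hsplit, hpow]
      ring_nf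
    _ = 4 / (κ * (m / 2) ^ (p - 2) * m) * ε ^ (-(p - 1)) := by
      rw [Real.rpow_neg hε.le, ← div_eq_mul_inv, div_div]

lemma HasDiagSolution.le_mul_rpow (h : HasDiagSolution k r₀ s₀ T) (hk : IsSpeed k K)
    {p κ ρ m X x₁ ε : ℝ} (hp : 2 ≤ p) (hκ : 0 < κ)
    (hkκ : ∀ q, |q| ≤ ρ → κ * |q| ^ (p - 2) ≤ deriv k q) (hm : 0 < m) (hε : 0 < ε) (hε₁ : ε ≤ 1)
    (hr₀ : ∀ x, |r₀ x| ≤ ρ) (hs₀ : ∀ x, |s₀ x| ≤ ρ) (hderiv : m * ε ≤ deriv r₀ x₁)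
    (hvalue : 2 * (m * ε) ≤ |r₀ x₁|) (hfar : ∀ x ≤ -X, |s₀ x| ≤ m * ε) :
    T ≤ (|x₁ + X| + 4 / (κ * (m / 2) ^ (p - 2) * m)) * ε ^ (-(p - 1)) := by
  obtain ⟨r, s, h, ⟨M, hM⟩, rfl, rfl⟩ := h
  have hstrain : ∀ t ∈ Ico 0 T, ∀ x, |strain r s t x| ≤ ρ := fun t ht x =>
    abs_strain_le (h.abs_left_le hk hM hr₀ ht x) (h.abs_right_le hk hM hs₀ ht x)
  have hdx : 0 < dx r 0 x₁ := (mul_pos hm hε).trans_le hderiv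
  have hT := h.le_of_le_deriv_speed hk hM (a := κ * (m * ε / 2) ^ (p - 2))
    (fun t ht x => le_trans (by positivity) (hkκ _ (hstrain t ht x))) hdx (by positivity)
    (abs_nonneg (x₁ + X)) fun t ht x hx hrx => by
      have ht₀ : t ∈ Ico 0 T := ⟨(abs_nonneg _).trans ht.1, ht.2⟩
      refine le_trans ?_ (hkκ _ (hstrain t ht₀ x))
      gcongr
      exact h.half_le_abs_strain hk hM hvalue hfar ht₀ ((le_abs_self _).trans ht.1) hx hrx
  have hone : 1 ≤ ε ^ (-(p - 1)) :=
    Real.one_le_rpow_of_pos_of_le_one_of_nonpos hε hε₁ (by linarith)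
  rw [add_mul]
  exact hT.trans (add_le_add (le_mul_of_one_le_right (abs_nonneg _) hone)
    (four_div_mul_rpow_le hκ hm hε hderiv))

end

/-! ### Small multiples of fixed Cauchy data -/

section

variable (L φ ψ : ℝ → ℝ)

lemma initialLeft_const_mul (ε : ℝ) :
    initialLeft L (fun x => ε * φ x) (fun x => ε * ψ x) =
      fun x => ε * ψ x + L (ε * deriv φ x) := by
  ext x
  rw [initialLeft, deriv_const_mul_field']

lemma initialRight_const_mul (ε : ℝ) :
    initialRight L (fun x => ε * φ x) (fun x => ε * ψ x) =
      fun x => ε * ψ x - L (ε * deriv φ x) := by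
  ext x
  rw [initialRight, deriv_const_mul_field']

lemma deriv_neg_comp_neg : deriv (fun x => -φ (-x)) = fun x => deriv φ (-x) := by
  ext x
  rw [deriv.fun_neg, deriv_comp_neg, neg_neg]

lemma initialLeft_const_mul_reflect (ε : ℝ) :
    initialLeft L (fun x => ε * -φ (-x)) (fun x => ε * -ψ (-x)) =
      fun x => -initialRight L (fun x => ε * φ x) (fun x => ε * ψ x) (-x) := by
  rw [initialLeft_const_mul, initialRight_const_mul, deriv_neg_comp_neg]
  ext x
  ring

lemma initialRight_const_mul_reflect (ε : ℝ) :
    initialRight L (fun x => ε * -φ (-x)) (fun x => ε * -ψ (-x)) =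
      fun x => -initialLeft L (fun x => ε * φ x) (fun x => ε * ψ x) (-x) := by
  rw [initialLeft_const_mul, initialRight_const_mul, deriv_neg_comp_neg]
  ext x
  ring

end

lemma BoundedContDiff.reflect {n : ℕ} {φ : ℝ → ℝ} (hφ : BoundedContDiff n φ) :
    BoundedContDiff n (fun x => -φ (-x)) :=
  ⟨(hφ.1.comp contDiff_neg).neg, fun k hk => (hφ.2 k hk).imp fun B hB x => by
    simpa [iteratedDeriv_comp_neg, abs_mul] using hB (-x)⟩

lemma exists_lt_deriv_add_deriv_lt_abs_add {φ ψ : ℝ → ℝ} (hφ : ContDiff ℝ 2 φ)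
    (hψ : ContDiff ℝ 1 ψ) {x₀ : ℝ} (hx₀ : 0 < deriv ψ x₀ + deriv (deriv φ) x₀) :
    ∃ x₁, ∃ m > 0, m < deriv ψ x₁ + deriv (deriv φ) x₁ ∧ 2 * m < |ψ x₁ + deriv φ x₁| := by
  have hφ' := contDiff_one_deriv hφ
  obtain ⟨x₁, hderiv, hvalue⟩ := exists_deriv_pos_ne_zero
    (fun x => (hψ.differentiable one_ne_zero x).hasDerivAt.add
      (hφ'.differentiable one_ne_zero x).hasDerivAt)
    ((hψ.continuous_deriv le_rfl).add (hφ'.continuous_deriv le_rfl)) hx₀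
  obtain ⟨m, hm₀, hm⟩ := exists_between (lt_min hderiv (half_pos (abs_pos.2 hvalue)))
  exact ⟨x₁, m, hm₀, hm.trans_le (min_le_left _ _),
    (lt_div_iff₀' two_pos).1 (hm.trans_le (min_le_right _ _))⟩

namespace SpeedExtension

variable {U : Set ℝ} {c : ℝ → ℝ} {δ : ℝ} {a L G : ℝ → ℝ} {K p C m : ℝ} {φ ψ : ℝ → ℝ}

lemma speed_zero (E : SpeedExtension U c δ a K L G) (hc0 : c 0 = 1) : a 0 = 1 := by
  rw [E.eq_of_abs_le (by simpa using E.pos.le), hc0]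

lemma half_abs_le_abs_inv (E : SpeedExtension U c δ a K L G) (q : ℝ) : 1 / 2 * |q| ≤ |G q| := by
  have h := E.abs_map_le (G q)
  rw [E.right_inv] at h
  linarith [abs_nonneg (G q)]

lemma le_deriv_speed (E : SpeedExtension U c δ a K L G) (hp : 2 ≤ p) (hC : 0 < C)
    (hc : ∀ θ, |θ| ≤ δ → C * |θ| ^ (p - 2) ≤ deriv c θ) {q : ℝ} (hq : |q| ≤ δ / 4) :
    C / 2 * (1 / 2) ^ (p - 2) * |q| ^ (p - 2) ≤ deriv (a ∘ G) q := by
  have hGδ : |G q| ≤ δ := (E.abs_inv_le_half hq).trans (half_le_self E.pos.le)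
  have hderiv : C * |G q| ^ (p - 2) ≤ deriv a (G q) :=
    (E.eventuallyEq _ hGδ).deriv_eq ▸ hc _ hGδ
  have hnonneg : 0 ≤ C * |G q| ^ (p - 2) := by positivity
  rw [(E.hasDerivAt_speed q).deriv]
  calc C / 2 * (1 / 2) ^ (p - 2) * |q| ^ (p - 2)
      = C * (1 / 2 * |q|) ^ (p - 2) / 2 := by
        rw [Real.mul_rpow (by norm_num) (abs_nonneg q)]
        ring
    _ ≤ C * |G q| ^ (p - 2) / 2 := by
        gcongr
        exact E.half_abs_le_abs_inv q
    _ ≤ C * |G q| ^ (p - 2) / a (G q) :=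
        div_le_div_of_nonneg_left hnonneg (E.isSpeed.pos _) (by linarith [E.isSpeed.upper (G q)])
    _ ≤ deriv a (G q) / a (G q) := div_le_div_of_nonneg_right hderiv (E.isSpeed.pos _).le

lemma eventually_smallData (E : SpeedExtension U c δ a K L G) (hφ : BoundedContDiff 2 φ)
    (hψ : BoundedContDiff 1 ψ) :
    ∀ᶠ ε in 𝓝[>] (0 : ℝ), SmallData L δ (fun x => ε * φ x) (fun x => ε * ψ x) := by
  obtain ⟨A₀, hA₀⟩ := hφ.2 0 zero_le_two
  obtain ⟨A₁, hA₁⟩ := hφ.2 1 one_le_two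
  obtain ⟨A₂, hA₂⟩ := hφ.2 2 le_rfl
  obtain ⟨B₀, hB₀⟩ := hψ.2 0 zero_le_one
  obtain ⟨B₁, hB₁⟩ := hψ.2 1 le_rfl
  simp only [iteratedDeriv_succ, iteratedDeriv_zero] at hA₀ hA₁ hA₂ hB₀ hB₁
  have hsmall : ∀ᶠ ε in 𝓝[>] (0 : ℝ), ε * (B₀ + 2 * A₁) < δ / 4 := by
    have hcont : Continuous fun ε : ℝ => ε * (B₀ + 2 * A₁) := by fun_prop
    exact (hcont.continuousAt.eventually_lt_const (by linarith [E.pos])).filter_mono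
      nhdsWithin_le_nhds
  filter_upwards [hsmall, self_mem_nhdsWithin] with ε hεδ (hε : 0 < ε)
  have hscale : ∀ {b B : ℝ}, |b| ≤ B → |ε * b| ≤ ε * B := fun hb => by
    rw [abs_mul, abs_of_pos hε]
    exact mul_le_mul_of_nonneg_left hb hε.le
  have hL : ∀ x, |L (ε * deriv φ x)| ≤ ε * (2 * A₁) := fun x => by
    linarith [E.abs_map_le (ε * deriv φ x), hscale (hA₁ x), abs_nonneg (ε * deriv φ x)]
  refine ⟨contDiff_const.mul hφ.1, contDiff_const.mul hψ.1, ⟨ε * A₀, fun x => hscale (hA₀ x)⟩,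
    ⟨ε * max A₂ B₁, fun x => ?_⟩, fun x => ?_, fun x => ?_⟩
  · rw [deriv_const_mul_field', deriv_const_mul_field', deriv_const_mul_field']
    exact ⟨hscale (le_max_of_le_left (hA₂ x)), hscale (le_max_of_le_right (hB₁ x))⟩
  · rw [initialLeft_const_mul]
    linarith [abs_add_le (ε * ψ x) (L (ε * deriv φ x)), hL x, hscale (hB₀ x)]
  · rw [initialRight_const_mul]
    linarith [abs_sub (ε * ψ x) (L (ε * deriv φ x)), hL x, hscale (hB₀ x)]

lemma eventually_mul_le_deriv_initialLeft (E : SpeedExtension U c δ a K L G) (hc0 : c 0 = 1)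
    (hφ : ContDiff ℝ 2 φ) (hψ : ContDiff ℝ 1 ψ) {x₁ : ℝ}
    (hm : m < deriv ψ x₁ + deriv (deriv φ) x₁) :
    ∀ᶠ ε in 𝓝[>] (0 : ℝ),
      m * ε ≤ deriv (initialLeft L (fun x => ε * φ x) (fun x => ε * ψ x)) x₁ := by
  have hderiv : ∀ ε, deriv (initialLeft L (fun x => ε * φ x) (fun x => ε * ψ x)) x₁ =
      (deriv ψ x₁ + a (ε * deriv φ x₁) * deriv (deriv φ) x₁) * ε := fun ε => by
    have hψ' := (hψ.differentiable one_ne_zero x₁).hasDerivAt.const_mul ε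
    have hφ' := ((contDiff_one_deriv hφ).differentiable one_ne_zero x₁).hasDerivAt.const_mul ε
    have hsum : HasDerivAt (fun x => ε * ψ x + L (ε * deriv φ x)) _ x₁ :=
      hψ'.add ((E.hasDerivAt _).comp x₁ hφ')
    rw [initialLeft_const_mul, hsum.deriv]
    ring
  have hcont : Continuous fun ε => deriv ψ x₁ + a (ε * deriv φ x₁) * deriv (deriv φ) x₁ :=
    continuous_const.add
      ((E.isSpeed.continuous.comp (continuous_mul_const _)).mul continuous_const)
  have hlt : ∀ᶠ ε in 𝓝 (0 : ℝ), m < deriv ψ x₁ + a (ε * deriv φ x₁) * deriv (deriv φ) x₁ :=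
    hcont.continuousAt.eventually_const_lt (by simpa [E.speed_zero hc0] using hm)
  filter_upwards [hlt.filter_mono nhdsWithin_le_nhds, self_mem_nhdsWithin] with ε hlt (hε : 0 < ε)
  rw [hderiv]
  exact mul_le_mul_of_nonneg_right hlt.le hε.le

lemma eventually_mul_le_abs_initialLeft (E : SpeedExtension U c δ a K L G) (hc0 : c 0 = 1)
    {x₁ : ℝ} (hm : m < |ψ x₁ + deriv φ x₁|) :
    ∀ᶠ ε in 𝓝[>] (0 : ℝ), m * ε ≤ |initialLeft L (fun x => ε * φ x) (fun x => ε * ψ x) x₁| := by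
  have hderiv : HasDerivAt (fun ε => ε * ψ x₁ + L (ε * deriv φ x₁)) (ψ x₁ + deriv φ x₁) 0 := by
    have hL := (E.hasDerivAt _).comp (0 : ℝ) (hasDerivAt_mul_const (deriv φ x₁))
    rw [zero_mul, E.speed_zero hc0, one_mul] at hL
    exact (hasDerivAt_mul_const (ψ x₁)).add hL
  have hslope := (hasDerivAt_iff_tendsto_slope_zero.1 hderiv).mono_left
    (nhdsWithin_mono 0 fun ε (hε : 0 < ε) => hε.ne')
  filter_upwards [hslope.abs.eventually_const_lt hm, self_mem_nhdsWithin] with ε hlt (hε : 0 < ε)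
  simp only [zero_add, zero_mul, E.map_zero, add_zero, sub_zero, smul_eq_mul, abs_mul, abs_inv,
    abs_of_pos hε] at hlt
  rw [initialLeft_const_mul]
  exact ((lt_inv_mul_iff₀' hε).1 hlt).le

lemma exists_forall_abs_initialRight_le (E : SpeedExtension U c δ a K L G)
    (hφ : Tendsto (deriv φ) (cocompact ℝ) (𝓝 0)) (hψ : Tendsto ψ (cocompact ℝ) (𝓝 0))
    (hm : 0 < m) :
    ∃ X, ∀ x ≤ -X, ∀ ε > 0,
      |initialRight L (fun x => ε * φ x) (fun x => ε * ψ x) x| ≤ m * ε := by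
  have hlim : Tendsto (fun x => |ψ x| + 2 * |deriv φ x|) (cocompact ℝ) (𝓝 0) := by
    simpa using hψ.abs.add (hφ.abs.const_mul 2)
  obtain ⟨Y, hY⟩ := eventually_atBot.1
    ((hlim.eventually_lt_const hm).filter_mono atBot_le_cocompact)
  refine ⟨-Y, fun x hx ε hε => ?_⟩
  rw [initialRight_const_mul]
  calc |ε * ψ x - L (ε * deriv φ x)|
      ≤ |ε * ψ x| + 2 * |ε * deriv φ x| := by
        linarith [abs_sub (ε * ψ x) (L (ε * deriv φ x)), E.abs_map_le (ε * deriv φ x),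
          abs_nonneg (ε * deriv φ x)]
    _ = (|ψ x| + 2 * |deriv φ x|) * ε := by
        rw [abs_mul, abs_mul, abs_of_pos hε]
        ring
    _ ≤ m * ε := mul_le_mul_of_nonneg_right (hY x (by linarith)).le hε.le

lemma exists_forall_hasDiagSolution_le (E : SpeedExtension U c δ a K L G) (hc0 : c 0 = 1)
    (hp : 2 ≤ p) (hC : 0 < C) (hc : ∀ θ, |θ| ≤ δ → C * |θ| ^ (p - 2) ≤ deriv c θ)
    (hφ : BoundedContDiff 2 φ) (hψ : BoundedContDiff 1 ψ)
    (hφ_lim : Tendsto (deriv φ) (cocompact ℝ) (𝓝 0)) (hψ_lim : Tendsto ψ (cocompact ℝ) (𝓝 0))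
    {x₀ : ℝ} (hx₀ : 0 < deriv ψ x₀ + deriv (deriv φ) x₀) :
    ∃ C' > 0, ∀ᶠ ε in 𝓝[>] (0 : ℝ), ∀ T,
      HasDiagSolution (a ∘ G) (initialLeft L (fun x => ε * φ x) (fun x => ε * ψ x))
        (initialRight L (fun x => ε * φ x) (fun x => ε * ψ x)) T → T ≤ C' * ε ^ (-(p - 1)) := by
  obtain ⟨x₁, m, hm, hderiv, hvalue⟩ := exists_lt_deriv_add_deriv_lt_abs_add hφ.1 hψ.1 hx₀
  obtain ⟨X, hfar⟩ := E.exists_forall_abs_initialRight_le hφ_lim hψ_lim hm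
  refine ⟨|x₁ + X| + 4 / (C / 2 * (1 / 2) ^ (p - 2) * (m / 2) ^ (p - 2) * m), by positivity, ?_⟩
  filter_upwards [E.eventually_mul_le_deriv_initialLeft hc0 hφ.1 hψ.1 hderiv,
    E.eventually_mul_le_abs_initialLeft hc0 hvalue, E.eventually_smallData hφ hψ,
    Ioc_mem_nhdsGT one_pos] with ε hderiv hvalue D hε T h
  exact h.le_mul_rpow E.isSpeed_comp hp (by positivity) (fun q => E.le_deriv_speed hp hC hc) hm
    hε.1 hε.2 D.left_le D.right_le hderiv (by rwa [← mul_assoc]) fun x hx => hfar x hx ε hε.1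

-- The substitution `u ↦ -u(t, -x)` preserves the equation and turns the second case into the first.
lemma exists_forall_hasDiagSolution_le_of_or (E : SpeedExtension U c δ a K L G) (hc0 : c 0 = 1)
    (hp : 2 ≤ p) (hC : 0 < C) (hc : ∀ θ, |θ| ≤ δ → C * |θ| ^ (p - 2) ≤ deriv c θ)
    (hφ : BoundedContDiff 2 φ) (hψ : BoundedContDiff 1 ψ)
    (hφ_lim : Tendsto (deriv φ) (cocompact ℝ) (𝓝 0)) (hψ_lim : Tendsto ψ (cocompact ℝ) (𝓝 0))
    (hx₀ : ∃ x₀, 0 < deriv ψ x₀ + deriv (deriv φ) x₀ ∨ 0 < deriv ψ x₀ - deriv (deriv φ) x₀) :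
    ∃ C' > 0, ∀ᶠ ε in 𝓝[>] (0 : ℝ), ∀ T,
      HasDiagSolution (a ∘ G) (initialLeft L (fun x => ε * φ x) (fun x => ε * ψ x))
        (initialRight L (fun x => ε * φ x) (fun x => ε * ψ x)) T → T ≤ C' * ε ^ (-(p - 1)) := by
  obtain ⟨x₀, hleft | hright⟩ := hx₀
  · exact E.exists_forall_hasDiagSolution_le hc0 hp hC hc hφ hψ hφ_lim hψ_lim hleft
  have hneg : Tendsto (fun x : ℝ => -x) (cocompact ℝ) (cocompact ℝ) :=
    (Homeomorph.neg ℝ).isClosedEmbedding.tendsto_cocompact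
  obtain ⟨C', hC', hbound⟩ := E.exists_forall_hasDiagSolution_le hc0 hp hC hc hφ.reflect hψ.reflect
    (by rw [deriv_neg_comp_neg]; exact hφ_lim.comp hneg)
    (by simpa using (hψ_lim.comp hneg).neg) (x₀ := -x₀)
    (by simpa only [deriv_neg_comp_neg, deriv_comp_neg (deriv φ), neg_neg, ← sub_eq_add_neg]
      using hright)
  refine ⟨C', hC', hbound.mono fun ε hε T h => hε T ?_⟩
  rw [initialLeft_const_mul_reflect, initialRight_const_mul_reflect]
  exact h.reflect

end SpeedExtension

lemma DegenerateSpeed.contDiffOn_one {p : ℝ} {U : Set ℝ} {c : ℝ → ℝ} (h : DegenerateSpeed p U c)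
    (hp : 2 < p) : ContDiffOn ℝ 1 c U :=
  h.1.1.of_le (by exact_mod_cast Nat.one_le_ceil_iff.2 (sub_pos.2 hp))

lemma eventually_half_deriv_mul_rpow_le {U : Set ℝ} {c : ℝ → ℝ} (hU : IsOpen U)
    (h0U : (0 : ℝ) ∈ U) (hc : ContDiffOn ℝ 1 c U) (hder : 0 < deriv c 0) :
    ∀ᶠ θ in 𝓝 0, deriv c 0 / 2 * |θ| ^ ((2 : ℝ) - 2) ≤ deriv c θ := by
  have hcont : ContinuousAt (deriv c) 0 :=
    (hc.continuousOn_deriv_of_isOpen hU le_rfl).continuousAt (hU.mem_nhds h0U)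
  exact (hcont.eventually_const_lt (half_lt_self hder)).mono fun θ hθ => by simpa using hθ.le

end QuasilinearWave

theorem theorem2_general {U : Set ℝ} (hU : IsOpen U) (h0U : (0 : ℝ) ∈ U) {c : ℝ → ℝ}
    (hc0 : c 0 = 1) (hc : ContDiffOn ℝ 1 c U) {p C : ℝ} (hp : 2 ≤ p) (hC : 0 < C)
    (hder : ∀ᶠ θ in 𝓝 0, C * |θ| ^ (p - 2) ≤ deriv c θ) {φ ψ : ℝ → ℝ}
    (hφ : QuasilinearWave.BoundedContDiff 2 φ) (hψ : QuasilinearWave.BoundedContDiff 1 ψ)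
    (hφ_lim : Tendsto (deriv φ) (cocompact ℝ) (𝓝 0))
    (hψ_lim : Tendsto ψ (cocompact ℝ) (𝓝 0))
    (hx₀ : ∃ x₀ : ℝ, 0 < deriv ψ x₀ + deriv (deriv φ) x₀ ∨ 0 < deriv ψ x₀ - deriv (deriv φ) x₀) :
    QuasilinearWave.BlowsUpWithRate c U φ ψ (p - 1) := by
  obtain ⟨δ₁, a, K, L, G, E₁⟩ := QuasilinearWave.exists_speedExtension hU h0U hc0 hc
  obtain ⟨δ₂, hδ₂, hball⟩ := Metric.nhds_basis_closedBall.mem_iff.1 hder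
  have E := E₁.mono (lt_min E₁.pos hδ₂) (min_le_left δ₁ δ₂)
  obtain ⟨C', hC', hbound⟩ := E.exists_forall_hasDiagSolution_le_of_or hc0 hp hC
    (fun θ hθ => hball (by simpa using hθ.trans (min_le_right δ₁ δ₂))) hφ hψ hφ_lim hψ_lim hx₀
  obtain ⟨ε₀, hε₀, hsmall⟩ := mem_nhdsGT_iff_exists_Ioc_subset.1
    (hbound.and (E.eventually_smallData hφ hψ))
  refine ⟨ε₀, hε₀, C', hC', fun ε hε hεε₀ => ?_⟩
  obtain ⟨hle, D⟩ := hsmall ⟨hε, hεε₀⟩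
  exact D.exists_isLifespan_le E fun T _ => hle T

theorem theorem2 (U : Set ℝ) (hU : IsOpen U) (h0U : (0 : ℝ) ∈ U)
    (c : ℝ → ℝ) (hc0 : c 0 = 1)
    (φ ψ : ℝ → ℝ)
    (hφ : QuasilinearWave.BoundedContDiff 2 φ) (hψ : QuasilinearWave.BoundedContDiff 1 ψ)
    (hφ_lim : Tendsto (deriv φ) (cocompact ℝ) (𝓝 0))
    (hψ_lim : Tendsto ψ (cocompact ℝ) (𝓝 0))
    (hx₀ : ∃ x₀ : ℝ, 0 < deriv ψ x₀ + deriv (deriv φ) x₀ ∨ 0 < deriv ψ x₀ - deriv (deriv φ) x₀) :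
    (∀ p : ℝ, 2 < p → QuasilinearWave.DegenerateSpeed p U c →
      (∃ C > 0, ∀ θ ∈ U, C * |θ| ^ (p - 2) ≤ deriv c θ) →
      QuasilinearWave.BlowsUpWithRate c U φ ψ (p - 1)) ∧
    (ContDiffOn ℝ 1 c U → 0 < deriv c 0 → QuasilinearWave.BlowsUpWithRate c U φ ψ 1) := by
  refine ⟨fun p hp hdeg ⟨C, hC, hder⟩ => theorem2_general hU h0U hc0 (hdeg.contDiffOn_one hp) hp.le
    hC (eventually_of_mem (hU.mem_nhds h0U) hder) hφ hψ hφ_lim hψ_lim hx₀, fun hc hder => ?_⟩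
  simpa only [show (2 : ℝ) - 1 = 1 by norm_num] using theorem2_general hU h0U hc0 hc le_rfl
    (half_pos hder) (QuasilinearWave.eventually_half_deriv_mul_rpow_le hU h0U hc hder) hφ hψ hφ_lim
    hψ_lim hx₀
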